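/- Let $s\in\mathbb{R}$ with $s>-\tfrac12$ and, for an integer $N\ge 1$, let $\mathbb{H}(N)$ be the space of $N\times N$ complex Hermitian matrices with Lebesgue measure $d\mathbf{H}=\prod_{j}d\mathbf{H}_{jj}\prod_{j<k}d(\operatorname{Re}\mathbf{H}_{jk})\,d(\operatorname{Im}\mathbf{H}_{jk})$. Let $\mathfrak{M}_N^{(s)}$ be the Hua–Pickrell probability measure on $\mathbb{H}(N)$, $$\mathfrak{M}_N^{(s)}(d\mathbf{H})=\mathrm{const}\cdot\det\left(\left(1+\mathbf{H}^2\right)^{-s-N}\right)d\mathbf{H},$$ let $\mathbb{E}_N^{(s)}$ be the expectation with respect to it, and put, for $t\in\mathbb{R}$, $$\phi_N^{(s)}(t)=\mathbb{E}_N^{(s)}\left(e^{\frac{it}{2N}\operatorname{Tr}(\mathbf{H}_N)}\right),\qquad \tau_N^{(s)}(t)=t\,\frac{d}{dt}\log\phi_N^{(s)}(t).$$ Then, for every $N\ge1$, $\phi_N^{(s)}$ is real and strictly positive on $\mathbb{R}$, $\log\phi_N^{(s)}$ is differentiable and $\tau_N=\tau_N^{(s)}$ is twice continuously differentiable on $\mathbb{R}^*=\mathbb{R}\setminus\{0\}$,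 and for all $t\in\mathbb{R}^*$ the following $\sigma$-Painlevé V equation holds: $$\left(t\frac{d^2\tau_N}{dt^2}\right)^2=-4t\left(\frac{d\tau_N}{dt}\right)^3+\left(4s^2+4\tau_N+\frac{t^2}{N^2}\right)\left(\frac{d\tau_N}{dt}\right)^2+t\left(1+\frac{2s}{N}-\frac{2\tau_N}{N^2}\right)\frac{d\tau_N}{dt}-\left(1+\frac{2s}{N}-\frac{\tau_N}{N^2}\right)\tau_N .$$ Moreover, this equation reduces to a $\sigma$-Painlevé III$'$ equation as $N\to\infty$: for all fixed $t,x,p\in\mathbb{C}$, $$-4tp^3+\left(4s^2+4x+\frac{t^2}{N^2}\right)p^2+t\left(1+\frac{2s}{N}-\frac{2x}{N^2}\right)p-\left(1+\frac{2s}{N}-\frac{x}{N^2}\right)x\;\xrightarrow[N\to\infty]{}\;-4tp^3+\left(4s^2+4x\right)p^2+tp-x .$$ -/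

import Mathlib

open scoped Topology
open MeasureTheory Filter

noncomputable section

namespace HuaPickrell

/-- The space `ℍ(N)` of `N × N` complex Hermitian matrices. -/
abbrev HermitianMatrix (N : ℕ) : Type :=
  {H : Matrix (Fin N) (Fin N) ℂ // H.IsHermitian}

/-- The Borel structure of `ℍ(N)`: the smallest one that makes all matrix entries measurable. -/
instance instMeasurableSpace (N : ℕ) : MeasurableSpace (HermitianMatrix N) :=
  MeasurableSpace.comap (fun H (j k : Fin N) => H.1 j k) inferInstance

/-- The free real coordinates of a Hermitian matrix: the (real) diagonal entries and the
(complex) entries strictly above the diagonal. -/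
abbrev Coords (N : ℕ) : Type :=
  (Fin N → ℝ) × ({p : Fin N × Fin N // p.1 < p.2} → ℂ)

/-- The matrix with diagonal entries `c.1`, entries `c.2` above the diagonal and the complex
conjugate entries below it. -/
def matrixOfCoords {N : ℕ} (c : Coords N) : Matrix (Fin N) (Fin N) ℂ :=
  Matrix.of fun j k =>
    if h : j < k then c.2 ⟨(j, k), h⟩
    else if h : k < j then star (c.2 ⟨(k, j), h⟩)
    else (c.1 j : ℂ)

theorem isHermitian_matrixOfCoords {N : ℕ} (c : Coords N) : (matrixOfCoords c).IsHermitian := by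
  ext j k
  rcases lt_trichotomy j k with h | h | h
  · simp [matrixOfCoords, h, h.not_gt]
  · subst h
    simp [matrixOfCoords]
  · simp [matrixOfCoords, h, h.not_gt]

/-- The Hermitian matrix with given coordinates. -/
def ofCoords {N : ℕ} (c : Coords N) : HermitianMatrix N :=
  ⟨matrixOfCoords c, isHermitian_matrixOfCoords c⟩

/-- Every Hermitian matrix has exactly one coordinate vector. -/
theorem bijective_ofCoords (N : ℕ) : Function.Bijective (ofCoords (N := N)) := by
  constructor
  · intro c d h
    have h' : ∀ j k, matrixOfCoords c j k = matrixOfCoords d j k := fun j k =>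
      congrFun (congrFun (congrArg Subtype.val h) j) k
    refine Prod.ext ?_ ?_
    · funext j
      simpa [matrixOfCoords] using h' j j
    · funext ⟨⟨j, k⟩, hjk⟩
      have hjk' : j < k := hjk
      simpa [matrixOfCoords, hjk'] using h' j k
  · rintro ⟨H, hH⟩
    refine ⟨(fun j => (H j j).re, fun p => H p.1.1 p.1.2), Subtype.ext ?_⟩
    ext j k
    rcases lt_trichotomy j k with h | h | h
    · simp [ofCoords, matrixOfCoords, h]
    · subst h
      have := hH.coe_re_apply_self j
      simpa [ofCoords, matrixOfCoords] using this
    · have := hH.apply j k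
      simpa [ofCoords, matrixOfCoords, h, h.not_gt] using this

theorem measurable_ofCoords (N : ℕ) : Measurable (ofCoords (N := N)) := by
  refine measurable_comap_iff.2 ?_
  refine measurable_pi_lambda _ fun j => measurable_pi_lambda _ fun k => ?_
  change Measurable fun c : Coords N => matrixOfCoords c j k
  by_cases h : j < k
  · simp only [matrixOfCoords, Matrix.of_apply, h, dif_pos]
    fun_prop
  · by_cases h' : k < j
    · simp only [matrixOfCoords, Matrix.of_apply, h, h', dif_pos, dif_neg, not_false_eq_true]
      fun_prop
    · simp only [matrixOfCoords, Matrix.of_apply, h, h', dif_neg, not_false_eq_true]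
      fun_prop

/-- Lebesgue measure `dH = ∏ j, dH_jj ∏ j < k, d(Re H_jk) d(Im H_jk)` on `ℍ(N)`. -/
def lebesgue (N : ℕ) : Measure (HermitianMatrix N) :=
  (volume : Measure (Coords N)).map ofCoords

/-- The weight `det ((1 + H ^ 2) ^ (-s - N)) = (det (1 + H ^ 2)) ^ (-s - N)`; the determinant of the
positive definite matrix `1 + H ^ 2` is a positive real number. -/
def weight (s : ℝ) (N : ℕ) (H : HermitianMatrix N) : ℝ :=
  ((1 + H.1 ^ 2).det.re) ^ (-s - (N : ℝ))

/-- The unnormalised Hua-Pickrell measure `det ((1 + H ^ 2) ^ (-s - N)) dH`. -/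
def unnormalized (s : ℝ) (N : ℕ) : Measure (HermitianMatrix N) :=
  (lebesgue N).withDensity fun H => ENNReal.ofReal (weight s N H)

/-- The Hua-Pickrell measure on `ℍ(N)`: the previous measure divided by its total mass. -/
def measure (s : ℝ) (N : ℕ) : Measure (HermitianMatrix N) :=
  (unnormalized s N Set.univ)⁻¹ • unnormalized s N

/-- The characteristic function `φ_N(t) = 𝔼 exp (i t Tr H / (2 N))` of the scaled trace. -/
def phi (s : ℝ) (N : ℕ) (t : ℝ) : ℂ :=
  ∫ H : HermitianMatrix N, Complex.exp (Complex.I * t / (2 * N) * H.1.trace) ∂(measure s N)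

/-- `τ_N(t) = t (d/dt) log φ_N(t)`. -/
def tau (s : ℝ) (N : ℕ) (t : ℝ) : ℂ :=
  t * deriv (fun u : ℝ => Complex.log (phi s N u)) t

/-- The right-hand side of the `σ`-Painlevé V equation, at the time `t`, the value `x` of the
unknown function and the value `p` of its first derivative. -/
def painleveV (s : ℝ) (N : ℕ) (t x p : ℂ) : ℂ :=
  -4 * t * p ^ 3 + (4 * s ^ 2 + 4 * x + t ^ 2 / N ^ 2) * p ^ 2
    + t * (1 + 2 * s / N - 2 * x / N ^ 2) * p - (1 + 2 * s / N - x / N ^ 2) * x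

/-- The right-hand side of the `σ`-Painlevé III' equation. -/
def painleveIII' (s : ℝ) (t x p : ℂ) : ℂ :=
  -4 * t * p ^ 3 + (4 * s ^ 2 + 4 * x) * p ^ 2 + t * p - x

end HuaPickrell

end

/-!
The characteristic function of the trace is a ratio of Hankel determinants, and the `σ`-Painlevé V
equation comes from the orthogonal polynomials behind these determinants.

*Reduction to a Hankel determinant.* With `a = s + N`, the Weyl integration formula
(`lintegral_lebesgue_of_isClassFunction`) and Andréief's identity (`andreief`) give
`φ_N(t) = D (t / (2 N)) / D 0`, where `D u = det (m_{j + k}(u))_{j, k < N}` and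
`m_k(u) = ∫ x ^ k (1 + x ^ 2) ^ (-a) e ^ (i u x) dx` (`phi_eq_hankel`). The Weyl formula is proved
by induction on `N`. A Hermitian matrix of size `N + 1` is a matrix of size `N` with a border
`(x, v)`. If the smaller matrix is diagonal with entries `m_1 < ⋯ < m_N`, the spectrum `l` of the
larger one interlaces `m`, and `l ↦ (x, |v_i| ^ 2)` is a bijection from interlacing spectra to
borders up to phases, with Jacobian `Δ(l) / Δ(m)`; the remaining integral of `Δ(m)` over the box of
all `m` interlacing `l` is a multiple of `Δ(l)`.

*Positivity.* The weight `(1 + x ^ 2) ^ (-a)` is, up to a constant, the squared modulus of the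
Fourier transform of the gamma density `y ^ (a - 1) e ^ (-y)`. So by Fourier inversion `m_0(u)` is,
for `u > 0`, a multiple of `h(u) = e ^ (-u) ∫ y ^ p (y + u) ^ p e ^ (-2 y) dy`, `p = a - 1`, where
`y` runs over the positive half line (`moment_zero`), and `m_k` is a multiple of the `k`-th
derivative of `h`. The operators `(1 - ∂) ^ j (1 + ∂) ^ k` act on `h` by lowering the two exponents
separately; in this basis the Hankel determinant becomes the Gram determinant of a positive
measure, hence does not vanish (`det_hankelMatrix_besselMoment_pos`). This is why `φ_N` is real and
positive. The function `D` is even, so that negative times need no separate argument.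

*The differential equation.* Let `L` be the linear functional on polynomials with
`L (X ^ k) = h ^ (k) (u)`. The differential equation of `h` is an integration by parts identity for
`L` (`IsPearson`), as for the weight `e ^ (u z) (z ^ 2 - 1) ^ (-a)`. It implies a first order
differential system in `z` for two consecutive monic orthogonal polynomials `P`, `Q` of degrees `N`
and `N - 1` (`IsOrthPair.structure_relation`, `IsOrthPair.structure_relation_pred`). The coefficient
matrix of this system annihilates the nonzero vector `(P, Q)` at `z = 1` and at `z = -1`, and the
two vanishing determinants amount to a quadratic relation between `S`, `β` and `β'`, where `-S` is
the subleading coefficient of `P` and `β = L (P ^ 2) / L (Q ^ 2)`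
(`IsOrthPair.quadratic_relation`). Since `D' = S D` and `S' = β`, this relation is the `σ`-form
satisfied by `σ(u) = u S(u)` (`exists_sigma_form`), and `τ_N(t) = σ(|t| / (2 N))`.
-/

noncomputable section

namespace HuaPickrell

/-! ### Bordered diagonal matrices and the secular equation -/

section

open Finset Polynomial

/-- The strict interlacing relation `l 0 < m 0 < l 1 < m 1 < ⋯ < m (N - 1) < l N`. -/
def Interlaces {N : ℕ} (m : Fin N → ℝ) (l : Fin (N + 1) → ℝ) : Prop :=
  ∀ i, l i.castSucc < m i ∧ m i < l i.succ

theorem Interlaces.strictMono_left {N : ℕ} {m : Fin N → ℝ} {l : Fin (N + 1) → ℝ}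
    (h : Interlaces m l) : StrictMono m := by
  cases N with
  | zero => exact fun i => i.elim0
  | succ n =>
    refine Fin.strictMono_iff_lt_succ.2 fun i => ?_
    have h1 := (h i.castSucc).2
    have h2 := (h i.succ).1
    rw [Fin.succ_castSucc] at h1
    exact h1.trans h2

theorem Interlaces.strictMono_right {N : ℕ} {m : Fin N → ℝ} {l : Fin (N + 1) → ℝ}
    (h : Interlaces m l) : StrictMono l :=
  Fin.strictMono_iff_lt_succ.2 fun i => (h i).1.trans (h i).2

theorem Interlaces.le_castSucc {N : ℕ} {m : Fin N → ℝ} {l : Fin (N + 1) → ℝ}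
    (h : Interlaces m l) {i : Fin N} {j : Fin (N + 1)} (hij : j ≤ i.castSucc) : l j < m i :=
  (h.strictMono_right.monotone hij).trans_lt (h i).1

theorem Interlaces.succ_le {N : ℕ} {m : Fin N → ℝ} {l : Fin (N + 1) → ℝ}
    (h : Interlaces m l) {i : Fin N} {j : Fin (N + 1)} (hij : i.succ ≤ j) : m i < l j :=
  (h i).2.trans_le (h.strictMono_right.monotone hij)

theorem abs_prod_prod_erase_sub {n : ℕ} (v : Fin n → ℝ) :
    |∏ i, ∏ k ∈ univ.erase i, (v i - v k)| = (Matrix.vandermonde v).det ^ 2 := by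
  rw [← sq_abs, Matrix.det_vandermonde, abs_prod, abs_prod, sq]
  have h1 : ∀ i : Fin n, |∏ k ∈ univ.erase i, (v i - v k)|
      = (∏ k ∈ Ioi i, |v k - v i|) * ∏ k ∈ Iio i, |v i - v k| := by
    intro i
    have hu : (univ.erase i : Finset (Fin n)) = Ioi i ∪ Iio i := by
      ext k
      simp only [mem_erase, mem_univ, and_true, mem_union, mem_Ioi, mem_Iio]
      rw [ne_iff_lt_or_gt, or_comm]
    rw [hu, prod_union, abs_mul, abs_prod, abs_prod]
    · simp_rw [abs_sub_comm (v i)]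
    · rw [disjoint_left]
      intro a ha hb
      exact lt_asymm (mem_Ioi.1 ha) (mem_Iio.1 hb)
  simp_rw [h1, prod_mul_distrib, abs_prod]
  congr 1
  refine prod_comm' ?_
  intro x y
  simp

section Secular
variable {N : ℕ}

/-- The top left entry of a bordered diagonal matrix `[[x, v], [v*, diag m]]` with spectrum `l`. -/
def secularShift (m : Fin N → ℝ) (l : Fin (N + 1) → ℝ) : ℝ := ∑ j, l j - ∑ k, m k

/-- The squared moduli of the border `v` of a matrix `[[x, v], [v*, diag m]]` with spectrum `l`. -/
def secularWeight (m : Fin N → ℝ) (l : Fin (N + 1) → ℝ) (i : Fin N) : ℝ :=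
  -(∏ j, (m i - l j)) / ∏ k ∈ univ.erase i, (m i - m k)

/-- The characteristic polynomial of `[[x, v], [v*, diag m]]` with `r i = |v i| ^ 2`. -/
def secularPoly (m : Fin N → ℝ) (x : ℝ) (r : Fin N → ℝ) : ℝ[X] :=
  (X - C x) * (∏ k, (X - C (m k))) - ∑ i, C (r i) * ∏ k ∈ univ.erase i, (X - C (m k))

theorem degree_sum_erase_lt (m : Fin N → ℝ) (r : Fin N → ℝ) :
    (∑ i, C (r i) * ∏ k ∈ univ.erase i, (X - C (m k))).degree < ((N : ℕ) : WithBot ℕ) := by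
  refine (degree_sum_le _ _).trans_lt ?_
  rw [Finset.sup_lt_iff (by simp)]
  intro i _
  have h0 : 0 < N := i.pos
  refine (degree_mul_le _ _).trans_lt ((add_le_add_left degree_C_le _).trans_lt ?_)
  rw [zero_add, degree_prod]
  simp only [degree_X_sub_C, sum_const, card_erase_of_mem (mem_univ i), card_univ,
    Fintype.card_fin]
  rw [nsmul_one]
  exact_mod_cast Nat.sub_lt h0 one_pos

theorem degree_prod_sub_lt (m : Fin N → ℝ) (l : Fin (N + 1) → ℝ) :
    ((∏ j, (X - C (l j))) - (X - C (secularShift m l)) * ∏ k, (X - C (m k))).degree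
      < ((N : ℕ) : WithBot ℕ) := by
  have hm1 : (∏ j, (X - C (l j))).Monic := monic_prod_of_monic _ _ fun j _ => monic_X_sub_C _
  have hm2 : (∏ k, (X - C (m k))).Monic := monic_prod_of_monic _ _ fun j _ => monic_X_sub_C _
  have hm3 : ((X - C (secularShift m l)) * ∏ k, (X - C (m k))).Monic :=
    (monic_X_sub_C _).mul hm2
  have hd1 : (∏ j, (X - C (l j))).natDegree = N + 1 := by
    rw [natDegree_prod_of_monic _ _ fun j _ => monic_X_sub_C _]; simp
  have hd3 : ((X - C (secularShift m l)) * ∏ k, (X - C (m k))).natDegree = N + 1 := by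
    rw [(monic_X_sub_C _).natDegree_mul hm2,
      natDegree_prod_of_monic _ _ fun j _ => monic_X_sub_C _]
    simp [add_comm]
  have hn1 : (∏ j, (X - C (l j))).nextCoeff = - ∑ j, l j := prod_X_sub_C_nextCoeff _
  have hn3 : ((X - C (secularShift m l)) * ∏ k, (X - C (m k))).nextCoeff = - ∑ j, l j := by
    rw [(monic_X_sub_C _).nextCoeff_mul hm2, nextCoeff_X_sub_C, prod_X_sub_C_nextCoeff]
    rw [secularShift]; ring
  rw [nextCoeff_of_natDegree_pos (by omega), hd1] at hn1
  rw [nextCoeff_of_natDegree_pos (by omega), hd3] at hn3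
  rw [degree_lt_iff_coeff_zero]
  intro k hk
  rw [coeff_sub]
  rcases hk.eq_or_lt with rfl | hk
  · simp only [Nat.add_sub_cancel] at hn1 hn3
    rw [hn1, hn3, sub_self]
  · rcases Nat.succ_le_of_lt hk |>.eq_or_lt with rfl | hk'
    · have e1 := hm1.coeff_natDegree
      have e3 := hm3.coeff_natDegree
      rw [hd1] at e1
      rw [hd3] at e3
      rw [Nat.succ_eq_add_one, e1, e3, sub_self]
    · rw [coeff_eq_zero_of_natDegree_lt (by omega), coeff_eq_zero_of_natDegree_lt (by omega),
        sub_self]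

theorem eval_sum_erase_node (m : Fin N → ℝ) (r : Fin N → ℝ) (i : Fin N) :
    (∑ i, C (r i) * ∏ k ∈ univ.erase i, (X - C (m k))).eval (m i)
      = r i * ∏ k ∈ univ.erase i, (m i - m k) := by
  rw [eval_finsetSum, Finset.sum_eq_single i]
  · simp [eval_prod]
  · intro j _ hj
    rw [eval_mul, eval_prod, Finset.prod_eq_zero (mem_erase.2 ⟨hj.symm, mem_univ i⟩) (by simp),
      mul_zero]
  · simp

theorem prod_erase_sub_ne_zero {m : Fin N → ℝ} (hm : Function.Injective m) (i : Fin N) :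
    ∏ k ∈ univ.erase i, (m i - m k) ≠ 0 := by
  refine Finset.prod_ne_zero_iff.2 fun k hk => sub_ne_zero.2 fun h => ?_
  exact (mem_erase.1 hk).1 (hm h).symm

/-- Partial fractions: with `x` and `r` read off from `l`, the polynomial is `∏ j, (X - l j)`. -/
theorem secularPoly_eq_prod {m : Fin N → ℝ} (hm : Function.Injective m) (l : Fin (N + 1) → ℝ) :
    secularPoly m (secularShift m l) (secularWeight m l) = ∏ j, (X - C (l j)) := by
  have h := Polynomial.eq_of_degrees_lt_of_eval_index_eq (s := (univ : Finset (Fin N))) (v := m)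
    (f := (∏ j, (X - C (l j))) - (X - C (secularShift m l)) * ∏ k, (X - C (m k)))
    (g := - ∑ i, C (secularWeight m l i) * ∏ k ∈ univ.erase i, (X - C (m k)))
    hm.injOn (by simpa using degree_prod_sub_lt m l)
    (by simpa using degree_sum_erase_lt m (secularWeight m l)) ?_
  · rw [secularPoly, sub_eq_add_neg, ← h]; ring
  · intro i _
    rw [eval_neg, eval_sum_erase_node, eval_sub, eval_mul, eval_prod, eval_prod,
      Finset.prod_eq_zero (mem_univ i) (by simp), mul_zero, secularWeight,
      div_mul_cancel₀ _ (prod_erase_sub_ne_zero hm i)]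
    simp

/-- Conversely, the factorisation of the characteristic polynomial determines `x` and `r`. -/
theorem secular_of_secularPoly_eq {m : Fin N → ℝ} (hm : Function.Injective m)
    {l : Fin (N + 1) → ℝ} {x : ℝ} {r : Fin N → ℝ}
    (h : secularPoly m x r = ∏ j, (X - C (l j))) :
    secularShift m l = x ∧ secularWeight m l = r := by
  have h2 : secularWeight m l = r := by
    funext i
    have := congrArg (eval (m i)) h
    rw [secularPoly, eval_sub, eval_sum_erase_node, eval_mul, eval_prod,
      Finset.prod_eq_zero (mem_univ i) (by simp), mul_zero, eval_prod] at this
    simp only [eval_sub, eval_X, eval_C] at this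
    rw [secularWeight, ← this]
    field_simp [prod_erase_sub_ne_zero hm i]
    simp
  refine ⟨?_, h2⟩
  have h1 := secularPoly_eq_prod hm l
  rw [← h, h2, secularPoly, secularPoly, sub_left_inj] at h1
  have hm2 : (∏ k, (X - C (m k))).Monic := monic_prod_of_monic _ _ fun j _ => monic_X_sub_C _
  have := mul_right_cancel₀ hm2.ne_zero h1
  simpa using this

theorem Interlaces.secularWeight_pos {m : Fin N → ℝ} {l : Fin (N + 1) → ℝ} (h : Interlaces m l)
    (i : Fin N) : 0 < secularWeight m l i := by
  have hi := prod_erase_sub_ne_zero h.strictMono_left.injective i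
  have key : secularWeight m l i = (l i.succ - m i) * ((m i - l i.castSucc) *
      ∏ k ∈ univ.erase i, (m i - l (i.succ.succAbove k)) / (m i - m k)) := by
    rw [secularWeight, Fin.prod_univ_succAbove _ i.succ, prod_div_distrib,
      ← mul_prod_erase univ _ (mem_univ i), Fin.succAbove_of_castSucc_lt _ _ i.castSucc_lt_succ]
    ring
  rw [key]
  refine mul_pos (sub_pos.2 (h i).2) (mul_pos (sub_pos.2 (h i).1) (prod_pos fun k hk => ?_))
  rcases lt_or_gt_of_ne (mem_erase.1 hk).1 with hki | hki
  · rw [Fin.succAbove_of_castSucc_lt _ _ (by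
      exact (Fin.castSucc_lt_castSucc_iff.2 hki).trans i.castSucc_lt_succ)]
    exact div_pos (sub_pos.2 (h.le_castSucc (Fin.castSucc_lt_castSucc_iff.2 hki).le))
      (sub_pos.2 (h.strictMono_left hki))
  · rw [Fin.succAbove_of_le_castSucc _ _ (by
      rw [Fin.le_def]; simpa using hki)]
    refine div_pos_of_neg_of_neg (sub_neg.2 (h.succ_le (Fin.succ_le_succ_iff.2 hki.le)))
      (sub_neg.2 (h.strictMono_left hki))

end Secular

end

/-! ### Existence of interlacing spectra -/

section

open Finset Polynomial

section Roots
variable {N : ℕ}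

/-- The gap number `j` of the sorted nodes `m`: the interval `(m (j - 1), m j)`, unbounded at the
two extreme values of `j`. -/
def gap (m : Fin N → ℝ) (j : Fin (N + 1)) : Set ℝ :=
  {z | ∀ i, (i.castSucc < j → m i < z) ∧ (j ≤ i.castSucc → z < m i)}

theorem gap_ordConnected (m : Fin N → ℝ) (j : Fin (N + 1)) : (gap m j).OrdConnected := by
  refine ⟨fun a ha b hb z hz i => ⟨fun h => ((ha i).1 h).trans_le hz.1,
    fun h => hz.2.trans_lt ((hb i).2 h)⟩⟩

theorem ne_of_mem_gap {m : Fin N → ℝ} {j : Fin (N + 1)} {z : ℝ} (hz : z ∈ gap m j) (i : Fin N) :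
    z - m i ≠ 0 := by
  rcases lt_or_ge i.castSucc j with h | h
  · exact (sub_pos.2 ((hz i).1 h)).ne'
  · exact (sub_neg.2 ((hz i).2 h)).ne

/-- The secular function `z - x - ∑ i, r i / (z - m i)`. -/
def secularFun (m : Fin N → ℝ) (x : ℝ) (r : Fin N → ℝ) (z : ℝ) : ℝ :=
  z - x - ∑ i, r i / (z - m i)

theorem continuousOn_secularFun (m : Fin N → ℝ) (x : ℝ) (r : Fin N → ℝ) (j : Fin (N + 1)) :
    ContinuousOn (secularFun m x r) (gap m j) := by
  unfold secularFun
  refine ContinuousOn.sub (by fun_prop) (continuousOn_finsetSum _ fun i _ => ?_)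
  exact continuousOn_const.div (by fun_prop) fun z hz => ne_of_mem_gap hz i

theorem tendsto_secularFun_atTop (m : Fin N → ℝ) (x : ℝ) (r : Fin N → ℝ) :
    Tendsto (secularFun m x r) atTop atTop := by
  unfold secularFun
  have h : Tendsto (fun z => -(∑ i, r i / (z - m i))) atTop (𝓝 (-(∑ i : Fin N, 0))) := by
    refine (tendsto_finsetSum _ fun i _ => ?_).neg
    exact Tendsto.const_div_atTop (tendsto_atTop_add_const_right _ _ tendsto_id) _
  simp_rw [sub_eq_add_neg (_ - x)]
  exact (tendsto_atTop_add_const_right _ (-x) tendsto_id).atTop_add h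

theorem tendsto_secularFun_atBot (m : Fin N → ℝ) (x : ℝ) (r : Fin N → ℝ) :
    Tendsto (secularFun m x r) atBot atBot := by
  unfold secularFun
  have h : Tendsto (fun z => -(∑ i, r i / (z - m i))) atBot (𝓝 (-(∑ i : Fin N, 0))) := by
    refine (tendsto_finsetSum _ fun i _ => ?_).neg
    exact Tendsto.const_div_atBot (tendsto_atBot_add_const_right _ _ tendsto_id) _
  simp_rw [sub_eq_add_neg (_ - x)]
  exact (tendsto_atBot_add_const_right _ (-x) tendsto_id).atBot_add h

theorem secularFun_split (m : Fin N → ℝ) (x : ℝ) (r : Fin N → ℝ) (i : Fin N) (z : ℝ) :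
    secularFun m x r z = (z - x - ∑ k ∈ univ.erase i, r k / (z - m k)) + (-r i) / (z - m i) := by
  rw [secularFun, ← add_sum_erase univ _ (mem_univ i)]
  ring

theorem tendsto_secularFun_regular {m : Fin N → ℝ} (hm : Function.Injective m) (x : ℝ)
    (r : Fin N → ℝ) (i : Fin N) :
    Tendsto (fun z => z - x - ∑ k ∈ univ.erase i, r k / (z - m k)) (𝓝 (m i))
      (𝓝 (m i - x - ∑ k ∈ univ.erase i, r k / (m i - m k))) := by
  refine Tendsto.sub (tendsto_id.sub_const x) (tendsto_finsetSum _ fun k hk => ?_)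
  refine Tendsto.div tendsto_const_nhds (tendsto_id.sub_const _) (sub_ne_zero.2 fun h => ?_)
  exact (mem_erase.1 hk).1 (hm h).symm

theorem tendsto_secularFun_right {m : Fin N → ℝ} (hm : Function.Injective m) (x : ℝ)
    {r : Fin N → ℝ} (i : Fin N) (hr : 0 < r i) :
    Tendsto (secularFun m x r) (𝓝[>] (m i)) atBot := by
  rw [funext (secularFun_split m x r i)]
  refine ((tendsto_secularFun_regular hm x r i).mono_left nhdsWithin_le_nhds).add_atBot ?_
  have h0 : Tendsto (fun z => z - m i) (𝓝[>] (m i)) (𝓝[>] 0) := by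
    refine tendsto_nhdsWithin_of_tendsto_nhds_of_eventually_within _ ?_ ?_
    · have : Tendsto (fun z => z - m i) (𝓝 (m i)) (𝓝 (m i - m i)) := tendsto_id.sub_const _
      rw [sub_self] at this
      exact this.mono_left nhdsWithin_le_nhds
    · filter_upwards [self_mem_nhdsWithin] with z hz using sub_pos.2 (Set.mem_Ioi.1 hz)
  simp_rw [div_eq_mul_inv]
  exact (tendsto_inv_nhdsGT_zero.comp h0).const_mul_atTop_of_neg (neg_lt_zero.2 hr)

theorem tendsto_secularFun_left {m : Fin N → ℝ} (hm : Function.Injective m) (x : ℝ)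
    {r : Fin N → ℝ} (i : Fin N) (hr : 0 < r i) :
    Tendsto (secularFun m x r) (𝓝[<] (m i)) atTop := by
  rw [funext (secularFun_split m x r i)]
  refine ((tendsto_secularFun_regular hm x r i).mono_left nhdsWithin_le_nhds).add_atTop ?_
  have h0 : Tendsto (fun z => z - m i) (𝓝[<] (m i)) (𝓝[<] 0) := by
    refine tendsto_nhdsWithin_of_tendsto_nhds_of_eventually_within _ ?_ ?_
    · have : Tendsto (fun z => z - m i) (𝓝 (m i)) (𝓝 (m i - m i)) := tendsto_id.sub_const _
      rw [sub_self] at this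
      exact this.mono_left nhdsWithin_le_nhds
    · filter_upwards [self_mem_nhdsWithin] with z hz using sub_neg.2 (Set.mem_Iio.1 hz)
  simp_rw [div_eq_mul_inv]
  exact (tendsto_inv_nhdsLT_zero.comp h0).const_mul_atBot_of_neg (neg_lt_zero.2 hr)

/-- The secular function changes sign in every gap of the nodes. -/
theorem exists_mem_gap_secularFun_eq_zero {m : Fin N → ℝ} (hm : StrictMono m) (x : ℝ)
    {r : Fin N → ℝ} (hr : ∀ i, 0 < r i) (j : Fin (N + 1)) :
    ∃ z ∈ gap m j, secularFun m x r z = 0 := by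
  have hneg : ∃ z ∈ gap m j, secularFun m x r z ≤ 0 := by
    rcases Fin.eq_zero_or_eq_succ j with rfl | ⟨i, rfl⟩
    · have h1 : ∀ᶠ z in atBot, ∀ i, z < m i :=
        eventually_all.2 fun i => eventually_lt_atBot (m i)
      obtain ⟨z, h1, h2⟩ := (h1.and ((tendsto_secularFun_atBot m x r).eventually_le_atBot 0)).exists
      exact ⟨z, fun i => ⟨fun h => absurd h (Fin.not_lt_zero _), fun _ => h1 i⟩, h2⟩
    · have h1 : ∀ᶠ z in 𝓝[>] (m i), ∀ k, i < k → z < m k := by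
        refine eventually_all.2 fun k => ?_
        by_cases hk : i < k
        · filter_upwards [nhdsWithin_le_nhds (Iio_mem_nhds (hm hk))] with z hz _ using hz
        · exact Eventually.of_forall fun z h => absurd h hk
      obtain ⟨z, ⟨h1, h2⟩, h3⟩ := ((h1.and self_mem_nhdsWithin).and
        ((tendsto_secularFun_right hm.injective x i (hr i)).eventually_le_atBot 0)).exists
      refine ⟨z, fun k => ⟨fun h => ?_, fun h => h1 k ?_⟩, h3⟩
      · exact (hm.monotone (Fin.castSucc_lt_succ_iff.1 h)).trans_lt h2
      · exact Fin.succ_le_castSucc_iff.1 h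
  have hpos : ∃ z ∈ gap m j, 0 ≤ secularFun m x r z := by
    rcases Fin.eq_castSucc_or_eq_last j with ⟨i, rfl⟩ | rfl
    · have h1 : ∀ᶠ z in 𝓝[<] (m i), ∀ k, k < i → m k < z := by
        refine eventually_all.2 fun k => ?_
        by_cases hk : k < i
        · filter_upwards [nhdsWithin_le_nhds (Ioi_mem_nhds (hm hk))] with z hz _ using hz
        · exact Eventually.of_forall fun z h => absurd h hk
      obtain ⟨z, ⟨h1, h2⟩, h3⟩ := ((h1.and self_mem_nhdsWithin).and
        ((tendsto_secularFun_left hm.injective x i (hr i)).eventually_ge_atTop 0)).exists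
      refine ⟨z, fun k => ⟨fun h => h1 k (Fin.castSucc_lt_castSucc_iff.1 h), fun h => ?_⟩, h3⟩
      exact lt_of_lt_of_le h2 (hm.monotone (Fin.castSucc_le_castSucc_iff.1 h))
    · have h1 : ∀ᶠ z in atTop, ∀ i, m i < z :=
        eventually_all.2 fun i => eventually_gt_atTop (m i)
      obtain ⟨z, h1, h2⟩ := (h1.and ((tendsto_secularFun_atTop m x r).eventually_ge_atTop 0)).exists
      exact ⟨z, fun i => ⟨fun _ => h1 i, fun h => absurd h (Fin.castSucc_lt_last i).not_ge⟩, h2⟩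
  obtain ⟨a, ha, ha'⟩ := hneg
  obtain ⟨b, hb, hb'⟩ := hpos
  obtain ⟨z, hz, hz'⟩ := (gap_ordConnected m j).isPreconnected.intermediate_value ha hb
    (continuousOn_secularFun m x r j) ⟨ha', hb'⟩
  exact ⟨z, hz, hz'⟩

theorem eval_secularPoly (m : Fin N → ℝ) (x : ℝ) (r : Fin N → ℝ) {z : ℝ}
    (hz : ∀ i, z - m i ≠ 0) :
    (secularPoly m x r).eval z = secularFun m x r z * ∏ k, (z - m k) := by
  have h : ∀ i, r i / (z - m i) * ∏ k, (z - m k) = r i * ∏ k ∈ univ.erase i, (z - m k) := by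
    intro i
    rw [← mul_prod_erase univ (fun k => z - m k) (mem_univ i)]
    field_simp [hz i]
  simp only [secularPoly, secularFun, eval_sub, eval_mul, eval_X, eval_C, eval_prod,
    eval_finsetSum, sub_mul, sum_mul, h]

theorem monic_secularPoly (m : Fin N → ℝ) (x : ℝ) (r : Fin N → ℝ) :
    (secularPoly m x r).degree = ((N + 1 : ℕ) : WithBot ℕ) ∧ (secularPoly m x r).Monic := by
  have hm2 : (∏ k, (X - C (m k))).Monic := monic_prod_of_monic _ _ fun j _ => monic_X_sub_C _
  have hm3 : ((X - C x) * ∏ k, (X - C (m k))).Monic := (monic_X_sub_C _).mul hm2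
  have hd3 : ((X - C x) * ∏ k, (X - C (m k))).degree = ((N + 1 : ℕ) : WithBot ℕ) := by
    rw [degree_eq_natDegree hm3.ne_zero, (monic_X_sub_C _).natDegree_mul hm2,
      natDegree_prod_of_monic _ _ fun j _ => monic_X_sub_C _]
    simp [add_comm]
  have hlt : (∑ i, C (r i) * ∏ k ∈ univ.erase i, (X - C (m k))).degree
      < ((X - C x) * ∏ k, (X - C (m k))).degree := by
    rw [hd3]
    refine (degree_sum_erase_lt m r).trans ?_
    exact_mod_cast Nat.lt_succ_self N
  rw [secularPoly]
  exact ⟨(degree_sub_eq_left_of_degree_lt hlt).trans hd3, hm3.sub_of_left hlt⟩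

/-- Every bordered matrix has a spectrum interlacing the nodes. -/
theorem exists_interlaces {m : Fin N → ℝ} (hm : StrictMono m) (x : ℝ)
    {r : Fin N → ℝ} (hr : ∀ i, 0 < r i) :
    ∃ l, Interlaces m l ∧ secularShift m l = x ∧ secularWeight m l = r := by
  choose l hl hl0 using exists_mem_gap_secularFun_eq_zero hm x hr
  have hI : Interlaces m l := fun i =>
    ⟨(hl i.castSucc i).2 le_rfl, (hl i.succ i).1 i.castSucc_lt_succ⟩
  refine ⟨l, hI, secular_of_secularPoly_eq hm.injective ?_⟩
  obtain ⟨hd, hmon⟩ := monic_secularPoly m x r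
  have hm1 : (∏ j, (X - C (l j))).Monic := monic_prod_of_monic _ _ fun j _ => monic_X_sub_C _
  have hd1 : (∏ j, (X - C (l j))).degree = ((N + 1 : ℕ) : WithBot ℕ) := by
    rw [degree_eq_natDegree hm1.ne_zero, natDegree_prod_of_monic _ _ fun j _ => monic_X_sub_C _]
    simp
  refine Polynomial.eq_of_degree_sub_lt_of_eval_index_eq (univ : Finset (Fin (N + 1)))
    hI.strictMono_right.injective.injOn ?_ ?_
  · have := degree_sub_lt_left (hd.trans hd1.symm) hmon.ne_zero
      (hmon.leadingCoeff.trans hm1.leadingCoeff.symm)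
    rw [hd] at this
    simpa using this
  · intro j _
    rw [eval_secularPoly m x r (ne_of_mem_gap (hl j)), hl0, zero_mul, eval_prod,
      Finset.prod_eq_zero (mem_univ j) (by simp)]

theorem secular_injOn {m : Fin N → ℝ} {l l' : Fin (N + 1) → ℝ} (h : Interlaces m l)
    (h' : Interlaces m l') (hs : secularShift m l = secularShift m l')
    (hw : secularWeight m l = secularWeight m l') : l = l' := by
  have hp : ∏ j, (X - C (l j)) = ∏ j, (X - C (l' j)) := by
    rw [← secularPoly_eq_prod h.strictMono_left.injective, hs, hw,
      secularPoly_eq_prod h.strictMono_left.injective]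
  have hsub : ∀ {a b : Fin (N + 1) → ℝ}, ∏ j, (X - C (a j)) = ∏ j, (X - C (b j)) →
      Set.range a ⊆ Set.range b := by
    rintro a b hab _ ⟨j, rfl⟩
    have := congrArg (eval (a j)) hab
    rw [eval_prod, Finset.prod_eq_zero (mem_univ j) (by simp), eval_prod, eq_comm,
      Finset.prod_eq_zero_iff] at this
    obtain ⟨k, _, hk⟩ := this
    exact ⟨k, (sub_eq_zero.1 (by simpa using hk)).symm⟩
  exact (StrictMono.range_inj h.strictMono_right h'.strictMono_right).1
    ((hsub hp).antisymm (hsub hp.symm))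

end Roots

end

/-! ### The Jacobian of the spectrum of a bordered matrix -/

section

open Finset Polynomial

section Jacobian
variable {N : ℕ}

/-- The change of variables from the spectrum `l` of a bordered diagonal matrix to its top left
entry and the squared moduli of its border. -/
def secularMap (m : Fin N → ℝ) (l : Fin (N + 1) → ℝ) : Fin (N + 1) → ℝ :=
  Fin.cons (secularShift m l) (secularWeight m l)

/-- The Jacobian matrix of `secularMap`. -/
def secularJacobian (m : Fin N → ℝ) (l : Fin (N + 1) → ℝ) :
    Matrix (Fin (N + 1)) (Fin (N + 1)) ℝ :=
  Matrix.of (Fin.cons (fun _ => 1) fun i j =>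
    (∏ k ∈ univ.erase j, (m i - l k)) / ∏ k ∈ univ.erase i, (m i - m k))

theorem hasFDerivAt_secularMap (m : Fin N → ℝ) (l : Fin (N + 1) → ℝ) :
    HasFDerivAt (secularMap m)
      (LinearMap.toContinuousLinearMap (Matrix.toLin' (secularJacobian m l))) l := by
  rw [hasFDerivAt_pi']
  intro i
  refine Fin.cases ?_ (fun i => ?_) i
  · have h : HasFDerivAt (fun l : Fin (N + 1) → ℝ => ∑ j, l j - ∑ k, m k)
        (∑ j, ContinuousLinearMap.proj (R := ℝ) (φ := fun _ : Fin (N + 1) => ℝ) j) l :=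
      (HasFDerivAt.fun_sum fun j _ => hasFDerivAt_apply j l).sub_const _
    refine h.congr_fderiv (ContinuousLinearMap.ext fun v => ?_)
    simp [secularJacobian, Matrix.mulVec, dotProduct]
  · have h0 := HasFDerivAt.finsetProd (u := univ) (x := l)
      (g := fun j (l : Fin (N + 1) → ℝ) => m i - l j)
      (g' := fun j => -ContinuousLinearMap.proj (R := ℝ) (φ := fun _ : Fin (N + 1) => ℝ) j)
      fun j _ => (hasFDerivAt_apply j l).const_sub (m i)
    have h := (h0.neg).mul_const' (∏ k ∈ univ.erase i, (m i - m k))⁻¹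
    refine (h.congr_fderiv (ContinuousLinearMap.ext fun v => ?_) :)
    simp [secularJacobian, Matrix.mulVec, dotProduct, Finset.sum_mul, div_eq_mul_inv,
      mul_right_comm]

/-- The matrix of coefficients of the polynomials `∏ k ≠ j, (X - l k)`. -/
def cofactorCoeff (l : Fin (N + 1) → ℝ) : Matrix (Fin (N + 1)) (Fin (N + 1)) ℝ :=
  Matrix.of fun k j => (∏ i ∈ univ.erase j, (X - C (l i))).coeff k

theorem natDegree_cofactor (l : Fin (N + 1) → ℝ) (j : Fin (N + 1)) :
    (∏ i ∈ univ.erase j, (X - C (l i))).natDegree = N := by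
  rw [natDegree_prod_of_monic _ _ fun j _ => monic_X_sub_C _]
  simp

theorem sum_pow_mul_cofactorCoeff (l : Fin (N + 1) → ℝ) (j : Fin (N + 1)) (z : ℝ) :
    ∑ k : Fin (N + 1), z ^ (k : ℕ) * cofactorCoeff l k j = ∏ i ∈ univ.erase j, (z - l i) := by
  have h : (∏ i ∈ univ.erase j, (X - C (l i))).eval z = ∏ i ∈ univ.erase j, (z - l i) := by
    simp [eval_prod]
  rw [← h, eval_eq_sum_range' (n := N + 1) (by rw [natDegree_cofactor]; omega),
    Finset.sum_range]
  exact sum_congr rfl fun k _ => mul_comm _ _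

/-- The product of this matrix with the Vandermonde matrix is diagonal, by evaluation at the
nodes. -/
theorem abs_det_cofactorCoeff {l : Fin (N + 1) → ℝ} (hl : Function.Injective l) :
    |(cofactorCoeff l).det| = |(Matrix.vandermonde l).det| := by
  have h : Matrix.vandermonde l * cofactorCoeff l
      = Matrix.diagonal fun j => ∏ i ∈ univ.erase j, (l j - l i) := by
    ext i j
    rw [Matrix.mul_apply]
    simp only [Matrix.vandermonde_apply]
    rw [sum_pow_mul_cofactorCoeff, Matrix.diagonal_apply]
    split_ifs with hij
    · rw [hij]
    · exact Finset.prod_eq_zero (mem_erase.2 ⟨hij, mem_univ i⟩) (sub_self _)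
  have h2 := congrArg (fun M => |Matrix.det M|) h
  simp only [Matrix.det_mul, abs_mul, Matrix.det_diagonal, abs_prod_prod_erase_sub] at h2
  rw [← sq_abs, sq] at h2
  exact mul_left_cancel₀ (abs_ne_zero.2 (Matrix.det_vandermonde_ne_zero_iff.2 hl)) h2

/-- The Jacobian determinant of `secularMap` is the quotient of the two Vandermonde determinants. -/
theorem abs_det_secularJacobian {m : Fin N → ℝ} (hm : Function.Injective m)
    {l : Fin (N + 1) → ℝ} (hl : Function.Injective l) :
    |(Matrix.vandermonde m).det| * |(secularJacobian m l).det| = |(Matrix.vandermonde l).det| := by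
  let W : Matrix (Fin (N + 1)) (Fin (N + 1)) ℝ :=
    Matrix.of (Fin.cons (Pi.single (Fin.last N) 1) fun i k => m i ^ (k : ℕ))
  let c : Fin (N + 1) → ℝ := Fin.cons 1 fun i => ∏ k ∈ univ.erase i, (m i - m k)
  have hW : |W.det| = |(Matrix.vandermonde m).det| := by
    rw [Matrix.det_succ_row_zero, Finset.sum_eq_single (Fin.last N)]
    · have : W.submatrix Fin.succ (Fin.last N).succAbove = Matrix.vandermonde m := by
        ext i j
        simp [W, Matrix.vandermonde_apply]
      rw [this, abs_mul, abs_mul, abs_pow]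
      simp [W]
    · intro j _ hj
      simp [W, hj]
    · simp
  have h : W * cofactorCoeff l = Matrix.diagonal c * secularJacobian m l := by
    ext i j
    rw [Matrix.mul_apply, Matrix.diagonal_mul]
    refine Fin.cases ?_ (fun i => ?_) i
    · rw [Finset.sum_eq_single (Fin.last N)]
      · have := (monic_prod_of_monic (univ.erase j) (fun i => X - C (l i))
          fun i _ => monic_X_sub_C _).coeff_natDegree
        rw [natDegree_cofactor] at this
        simp [W, c, secularJacobian, cofactorCoeff, this]
      · intro k _ hk
        simp [W, hk]
      · simp
    · simp only [W, c, secularJacobian, Matrix.of_apply, Fin.cons_succ]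
      rw [sum_pow_mul_cofactorCoeff, mul_div_cancel₀ _ (prod_erase_sub_ne_zero hm i)]
  have h2 := congrArg (fun M => |Matrix.det M|) h
  simp only [Matrix.det_mul, abs_mul, Matrix.det_diagonal, hW, abs_det_cofactorCoeff hl] at h2
  rw [Fin.prod_univ_succ] at h2
  simp only [c, Fin.cons_zero, Fin.cons_succ, one_mul, abs_prod_prod_erase_sub] at h2
  rw [← sq_abs, sq, mul_assoc] at h2
  exact (mul_left_cancel₀ (abs_ne_zero.2 (Matrix.det_vandermonde_ne_zero_iff.2 hm)) h2).symm

theorem image_secularMap {m : Fin N → ℝ} (hm : StrictMono m) :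
    secularMap m '' {l | Interlaces m l} = {w | ∀ i : Fin N, 0 < w i.succ} := by
  ext w
  constructor
  · rintro ⟨l, hl, rfl⟩ i
    exact Interlaces.secularWeight_pos hl i
  · intro hw
    obtain ⟨l, hl, h1, h2⟩ := exists_interlaces hm (w 0) hw
    refine ⟨l, hl, ?_⟩
    rw [secularMap, h1, h2]
    exact Fin.cons_self_tail w

theorem injOn_secularMap (m : Fin N → ℝ) : Set.InjOn (secularMap m) {l | Interlaces m l} := by
  intro l hl l' hl' h
  obtain ⟨h1, h2⟩ := Fin.cons_inj.1 h
  exact secular_injOn hl hl' h1 h2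

theorem isOpen_interlaces (m : Fin N → ℝ) : IsOpen {l | Interlaces m l} := by
  simp only [Interlaces, Set.ofPred_forall]
  refine isOpen_iInter_of_finite fun i => IsOpen.inter ?_ ?_
  · exact isOpen_lt (continuous_apply _) continuous_const
  · exact isOpen_lt continuous_const (continuous_apply _)

/-- Change of variables from border data to interlacing spectra. -/
theorem vandermonde_mul_lintegral_border {m : Fin N → ℝ} (hm : StrictMono m)
    (g : (Fin (N + 1) → ℝ) → ENNReal) :
    ENNReal.ofReal |(Matrix.vandermonde m).det| * ∫⁻ w in {w | ∀ i : Fin N, 0 < w i.succ}, g w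
      = ∫⁻ l in {l | Interlaces m l},
          ENNReal.ofReal |(Matrix.vandermonde l).det| * g (secularMap m l) := by
  have hms : MeasurableSet {l | Interlaces m l} := (isOpen_interlaces m).measurableSet
  rw [← image_secularMap hm, lintegral_image_eq_lintegral_abs_det_fderiv_mul volume hms
    (fun l _ => (hasFDerivAt_secularMap m l).hasFDerivWithinAt) (injOn_secularMap m),
    ← lintegral_const_mul' _ _ ENNReal.ofReal_ne_top]
  refine setLIntegral_congr_fun hms fun l hl => ?_
  have hdet : (LinearMap.toContinuousLinearMap (Matrix.toLin' (secularJacobian m l))).det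
      = (secularJacobian m l).det := by
    simp [ContinuousLinearMap.det]
  rw [hdet, ← mul_assoc, ← ENNReal.ofReal_mul (abs_nonneg _),
    abs_det_secularJacobian hm.injective (Interlaces.strictMono_right hl).injective]

end Jacobian

end

/-! ### Integrals of Vandermonde determinants over interlacing boxes -/

section

open Finset

section ProductDeterminants
variable {n : ℕ} {𝕜 : Type*} [RCLike 𝕜]

theorem integrable_det_pi (ν : Fin n → Measure ℝ) [∀ i, SigmaFinite (ν i)]
    (f : Fin n → Fin n → ℝ → 𝕜) (hf : ∀ i j, Integrable (f i j) (ν i)) :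
    Integrable (fun x : Fin n → ℝ => (Matrix.of fun i j => f i j (x i)).det) (Measure.pi ν) := by
  simp_rw [← Matrix.det_transpose (Matrix.of _), Matrix.det_apply', Matrix.transpose_apply,
    Matrix.of_apply]
  exact integrable_finsetSum _ fun σ _ => (Integrable.fintype_prod fun i => hf i (σ i)).const_mul _

/-- A determinant whose rows depend on separate variables is integrated entry by entry. -/
theorem integral_det_pi (ν : Fin n → Measure ℝ) [∀ i, SigmaFinite (ν i)]
    (f : Fin n → Fin n → ℝ → 𝕜) (hf : ∀ i j, Integrable (f i j) (ν i)) :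
    ∫ x, (Matrix.of fun i j => f i j (x i)).det ∂(Measure.pi ν)
      = (Matrix.of fun i j => ∫ x, f i j x ∂(ν i)).det := by
  simp_rw [← Matrix.det_transpose (Matrix.of _), Matrix.det_apply', Matrix.transpose_apply,
    Matrix.of_apply]
  rw [integral_finsetSum _ fun σ _ =>
    (Integrable.fintype_prod fun i => hf i (σ i)).const_mul _]
  refine sum_congr rfl fun σ _ => ?_
  rw [integral_const_mul, integral_fintype_prod_eq_prod (fun i => f i (σ i))]

end ProductDeterminants

theorem det_vandermonde_pos {n : ℕ} {v : Fin n → ℝ} (hv : StrictMono v) :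
    0 < (Matrix.vandermonde v).det := by
  rw [Matrix.det_vandermonde]
  exact prod_pos fun i _ => prod_pos fun j hj => sub_pos.2 (hv (mem_Ioi.1 hj))

theorem det_vandermonde_eq_det_sub {n : ℕ} (l : Fin (n + 1) → ℝ) :
    (Matrix.vandermonde l).det
      = (Matrix.of fun i j : Fin n =>
          l i.succ ^ ((j : ℕ) + 1) - l i.castSucc ^ ((j : ℕ) + 1)).det := by
  rw [Matrix.det_eq_of_forall_row_eq_smul_add_pred (A := Matrix.vandermonde l)
    (B := Matrix.of (Fin.cons (fun j => l 0 ^ (j : ℕ)) fun i j =>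
      l i.succ ^ (j : ℕ) - l i.castSucc ^ (j : ℕ))) (fun _ => 1) (by simp [Matrix.vandermonde])
      (by simp [Matrix.vandermonde])]
  rw [Matrix.det_succ_column_zero, Fin.sum_univ_succ, Finset.sum_eq_zero]
  · simp only [Fin.coe_ofNat_eq_mod, Nat.zero_mod, pow_zero, Matrix.of_apply, Fin.cons_zero,
      mul_one, one_mul, add_zero]
    congr 1
  · intro i _
    simp

theorem integral_pow_Ioo {a b : ℝ} (hab : a ≤ b) (k : ℕ) :
    ∫ x in Set.Ioo a b, x ^ k = (b ^ (k + 1) - a ^ (k + 1)) / (k + 1) := by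
  rw [← integral_Ioc_eq_integral_Ioo, ← intervalIntegral.integral_of_le hab, integral_pow]

/-- The Vandermonde determinant integrates over an interlacing box to a Vandermonde determinant. -/
theorem lintegral_vandermonde_interlaces {n : ℕ} {l : Fin (n + 1) → ℝ} (hl : StrictMono l) :
    ∫⁻ m in {m | Interlaces m l}, ENNReal.ofReal |(Matrix.vandermonde m).det|
      = ENNReal.ofReal ((n.factorial : ℝ)⁻¹) * ENNReal.ofReal |(Matrix.vandermonde l).det| := by
  have hset : {m | Interlaces m l}
      = Set.univ.pi fun i : Fin n => Set.Ioo (l i.castSucc) (l i.succ) := by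
    ext m
    simp [Interlaces]
  have hmeas : MeasurableSet {m | Interlaces m l} := by
    rw [hset]
    exact MeasurableSet.univ_pi fun i => measurableSet_Ioo
  have hpi : (volume : Measure (Fin n → ℝ)).restrict {m | Interlaces m l}
      = Measure.pi fun i : Fin n => volume.restrict (Set.Ioo (l i.castSucc) (l i.succ)) := by
    rw [hset, volume_pi, Measure.restrict_pi_pi]
  have hI : ∀ i j : Fin n, Integrable (fun x : ℝ => x ^ (j : ℕ))
      (volume.restrict (Set.Ioo (l i.castSucc) (l i.succ))) := fun i j =>
    ((continuous_pow _).continuousOn.integrableOn_Icc).mono_set Set.Ioo_subset_Icc_self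
  have h1 := integrable_det_pi _ (fun _ j x => x ^ (j : ℕ)) hI
  have h2 := integral_det_pi _ (fun _ j x => x ^ (j : ℕ)) hI
  rw [← hpi] at h1 h2
  have hpos : ∀ᵐ m ∂(volume.restrict {m | Interlaces m l}),
      0 ≤ (Matrix.of fun i j : Fin n => m i ^ (j : ℕ)).det := by
    filter_upwards [ae_restrict_mem hmeas] with m hm
    exact (det_vandermonde_pos (Interlaces.strictMono_left hm)).le
  have h3 := ofReal_integral_eq_lintegral_ofReal h1 hpos
  have h4 : ∫⁻ m in {m | Interlaces m l}, ENNReal.ofReal |(Matrix.vandermonde m).det|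
      = ∫⁻ m in {m | Interlaces m l},
          ENNReal.ofReal ((Matrix.of fun i j : Fin n => m i ^ (j : ℕ)).det) := by
    refine setLIntegral_congr_fun hmeas fun m hm => ?_
    rw [abs_of_pos (det_vandermonde_pos (Interlaces.strictMono_left hm))]
    rfl
  rw [h4, ← h3, h2, ← ENNReal.ofReal_mul (by positivity), abs_of_pos (det_vandermonde_pos hl),
    det_vandermonde_eq_det_sub]
  congr 1
  have h5 : (Matrix.of fun i j : Fin n => ∫ x in Set.Ioo (l i.castSucc) (l i.succ), x ^ (j : ℕ))
      = Matrix.of fun i j : Fin n => (((j : ℕ) + 1 : ℝ)⁻¹) *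
        (Matrix.of fun i j : Fin n =>
          l i.succ ^ ((j : ℕ) + 1) - l i.castSucc ^ ((j : ℕ) + 1)) i j := by
    ext i j
    simp only [Matrix.of_apply]
    rw [integral_pow_Ioo (hl i.castSucc_lt_succ).le, div_eq_inv_mul]
  rw [h5, Matrix.det_mul_row, prod_inv_distrib, ← Finset.prod_range_add_one_eq_factorial,
    Finset.prod_range]
  push_cast
  rfl

end

/-! ### Lebesgue measure on bordered Hermitian matrices -/

section

open Finset

section Border
variable {N : ℕ}

/-- The square matrix `[[a, v], [w, M]]` with a first row and a first column added to `M`. -/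
def borderMatrix (a : ℂ) (v w : Fin N → ℂ) (M : Matrix (Fin N) (Fin N) ℂ) :
    Matrix (Fin (N + 1)) (Fin (N + 1)) ℂ :=
  Matrix.of (Fin.cons (Fin.cons a v) fun i => Fin.cons (w i) (M i))

/-- The Hermitian matrix `[[x, v], [v*, H]]`. -/
def border (x : ℝ) (v : Fin N → ℂ) (H : HermitianMatrix N) : HermitianMatrix (N + 1) :=
  ⟨borderMatrix x v (fun i => star (v i)) H.1, by
    ext i j
    refine Fin.cases ?_ (fun i => ?_) i <;> refine Fin.cases ?_ (fun j => ?_) j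
    · simp [borderMatrix]
    · simp [borderMatrix]
    · simp [borderMatrix]
    · simpa [borderMatrix] using H.2.apply i j⟩

theorem measurable_entry (j k : Fin N) : Measurable fun H : HermitianMatrix N => H.1 j k :=
  (measurable_pi_apply k).comp ((measurable_pi_apply j).comp (comap_measurable _))

theorem measurable_hermitian_of_entry {α : Type*} [MeasurableSpace α] {g : α → HermitianMatrix N}
    (h : ∀ j k, Measurable fun a => (g a).1 j k) : Measurable g :=
  measurable_comap_iff.2 (measurable_pi_lambda _ fun j => measurable_pi_lambda _ fun k => h j k)

theorem measurable_border : Measurable fun p : (ℝ × (Fin N → ℂ)) × HermitianMatrix N =>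
    border p.1.1 p.1.2 p.2 := by
  refine measurable_hermitian_of_entry fun i j => ?_
  refine Fin.cases ?_ (fun i => ?_) i <;> refine Fin.cases ?_ (fun j => ?_) j
  · simp only [border, borderMatrix, Matrix.of_apply, Fin.cons_zero]
    fun_prop
  · simp only [border, borderMatrix, Matrix.of_apply, Fin.cons_zero, Fin.cons_succ]
    fun_prop
  · simp only [border, borderMatrix, Matrix.of_apply, Fin.cons_zero, Fin.cons_succ]
    have h : Measurable fun p : (ℝ × (Fin N → ℂ)) × HermitianMatrix N => p.1.2 i := by fun_prop
    exact continuous_star.measurable.comp h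
  · simp only [border, borderMatrix, Matrix.of_apply, Fin.cons_succ]
    exact (measurable_entry i j).comp measurable_snd

/-- The positions above the diagonal, split into the first row and the others. -/
def pairEquiv (N : ℕ) : Fin N ⊕ {p : Fin N × Fin N // p.1 < p.2} ≃
    {p : Fin (N + 1) × Fin (N + 1) // p.1 < p.2} :=
  Equiv.ofBijective (Sum.elim (fun j => ⟨(0, j.succ), Fin.succ_pos j⟩)
    fun p => ⟨(p.1.1.succ, p.1.2.succ), Fin.succ_lt_succ_iff.2 p.2⟩) (by
    constructor
    · rintro (a | ⟨⟨a, a'⟩, ha⟩) (b | ⟨⟨b, b'⟩, hb⟩) h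
      · simpa using h
      · simp [(Fin.succ_ne_zero _).symm] at h
      · simp at h
      · simpa using h
    · rintro ⟨⟨a, b⟩, hab⟩
      have hb : b ≠ 0 := (Fin.pos_of_ne_zero (ne_of_gt (lt_of_le_of_lt (Fin.zero_le a) hab))).ne'
      obtain ⟨b', rfl⟩ := Fin.exists_succ_eq_of_ne_zero hb
      rcases Fin.eq_zero_or_eq_succ a with rfl | ⟨a', rfl⟩
      · exact ⟨Sum.inl b', rfl⟩
      · exact ⟨Sum.inr ⟨(a', b'), Fin.succ_lt_succ_iff.1 hab⟩, rfl⟩)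

/-- Joining the first row of the strict upper triangle to the others. -/
def joinUpper (N : ℕ) :
    (Fin N → ℂ) × ({p : Fin N × Fin N // p.1 < p.2} → ℂ) ≃ᵐ
      ({p : Fin (N + 1) × Fin (N + 1) // p.1 < p.2} → ℂ) :=
  (MeasurableEquiv.sumPiEquivProdPi fun _ => ℂ).symm.trans
    (MeasurableEquiv.piCongrLeft (fun _ => ℂ) (pairEquiv N))

theorem volume_preserving_joinUpper (N : ℕ) : MeasurePreserving (joinUpper N) :=
  (volume_measurePreserving_piCongrLeft (fun _ => ℂ) (pairEquiv N)).comp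
    (volume_measurePreserving_sumPiEquivProdPi_symm fun _ => ℂ)

theorem joinUpper_pairEquiv (v : Fin N → ℂ) (c : {p : Fin N × Fin N // p.1 < p.2} → ℂ)
    (p : Fin N ⊕ {p : Fin N × Fin N // p.1 < p.2}) :
    joinUpper N (v, c) (pairEquiv N p) = Sum.elim v c p := by
  have := Equiv.piCongrLeft_apply_apply (fun _ => ℂ) (pairEquiv N) (Sum.elim v c) p
  rw [← this]
  congr 2

theorem ofCoords_join (x : ℝ) (d : Fin N → ℝ) (v : Fin N → ℂ)
    (c : {p : Fin N × Fin N // p.1 < p.2} → ℂ) :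
    ofCoords (Fin.cons x d, joinUpper N (v, c)) = border x v (ofCoords (d, c)) := by
  have h0 : ∀ j : Fin N, joinUpper N (v, c) ⟨(0, j.succ), Fin.succ_pos j⟩ = v j :=
    fun j => joinUpper_pairEquiv v c (Sum.inl j)
  have h1 : ∀ (i j : Fin N) (h : i < j),
      joinUpper N (v, c) ⟨(i.succ, j.succ), Fin.succ_lt_succ_iff.2 h⟩ = c ⟨(i, j), h⟩ :=
    fun i j h => joinUpper_pairEquiv v c (Sum.inr ⟨(i, j), h⟩)
  refine Subtype.ext (Matrix.ext fun i j => ?_)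
  refine Fin.cases ?_ (fun i => ?_) i <;> refine Fin.cases ?_ (fun j => ?_) j
  · simp [border, borderMatrix, ofCoords, matrixOfCoords]
  · simp [border, borderMatrix, ofCoords, matrixOfCoords, h0]
  · simp [border, borderMatrix, ofCoords, matrixOfCoords, h0]
  · rcases lt_trichotomy i j with h | h | h
    · simp [border, borderMatrix, ofCoords, matrixOfCoords, h, h1 i j h]
    · subst h
      simp [border, borderMatrix, ofCoords, matrixOfCoords]
    · simp [border, borderMatrix, ofCoords, matrixOfCoords, h, h.not_gt, h1 j i h]

theorem lintegral_lebesgue (f : HermitianMatrix N → ENNReal) (hf : Measurable f) :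
    ∫⁻ H, f H ∂(lebesgue N) = ∫⁻ d : Fin N → ℝ,
      ∫⁻ c : {p : Fin N × Fin N // p.1 < p.2} → ℂ, f (ofCoords (d, c)) := by
  rw [lebesgue, lintegral_map hf (measurable_ofCoords N), Measure.volume_eq_prod,
    lintegral_prod (fun c => f (ofCoords c)) (hf.comp (measurable_ofCoords N)).aemeasurable]

/-- Lebesgue measure on `ℍ(N + 1)` is the product of Lebesgue measure on `ℍ(N)` and Lebesgue
measure on the borders. -/
theorem lintegral_lebesgue_succ (f : HermitianMatrix (N + 1) → ENNReal) (hf : Measurable f) :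
    ∫⁻ H, f H ∂(lebesgue (N + 1))
      = ∫⁻ H, (∫⁻ x : ℝ, ∫⁻ v : Fin N → ℂ, f (border x v H)) ∂(lebesgue N) := by
  have hF : Measurable fun p : (ℝ × (Fin N → ℂ)) × HermitianMatrix N =>
      f (border p.1.1 p.1.2 p.2) := hf.comp measurable_border
  have hF2 : Measurable fun p : (ℝ × (Fin N → ℂ)) × (Fin N → ℝ) ×
      ({p : Fin N × Fin N // p.1 < p.2} → ℂ) => f (border p.1.1 p.1.2 (ofCoords p.2)) :=
    hF.comp (measurable_fst.prodMk ((measurable_ofCoords N).comp measurable_snd))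
  have hg : Measurable fun H : HermitianMatrix N =>
      ∫⁻ x : ℝ, ∫⁻ v : Fin N → ℂ, f (border x v H) := by
    have h1 : Measurable fun p : (HermitianMatrix N × ℝ) × (Fin N → ℂ) =>
        f (border p.1.2 p.2 p.1.1) :=
      hF.comp (((measurable_snd.comp measurable_fst).prodMk measurable_snd).prodMk
        (measurable_fst.comp measurable_fst))
    exact (h1.lintegral_prod_right').lintegral_prod_right'
  have e1 := (volume_preserving_piFinSuccAbove (fun _ : Fin (N + 1) => ℝ) 0).symm
  rw [lintegral_lebesgue f hf, lintegral_lebesgue _ hg,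
    ← e1.lintegral_comp_emb (MeasurableEquiv.measurableEmbedding _), Measure.volume_eq_prod]
  have e2 : ∀ a : ℝ × (Fin N → ℝ), (∫⁻ c, f (ofCoords
      (((MeasurableEquiv.piFinSuccAbove (fun _ : Fin (N + 1) => ℝ) 0).symm) a, c)))
      = ∫⁻ v : Fin N → ℂ, ∫⁻ c, f (border a.1 v (ofCoords (a.2, c))) := by
    intro a
    rw [← (volume_preserving_joinUpper N).lintegral_comp_emb
      (MeasurableEquiv.measurableEmbedding _), Measure.volume_eq_prod, lintegral_prod]
    · have : (MeasurableEquiv.piFinSuccAbove (fun _ : Fin (N + 1) => ℝ) 0).symm a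
          = Fin.cons a.1 a.2 := by
        simp only [MeasurableEquiv.piFinSuccAbove]
        exact Fin.insertNth_zero' a.1 a.2
      simp_rw [this, ofCoords_join]
    · refine Measurable.aemeasurable ?_
      refine (hf.comp (measurable_ofCoords (N + 1))).comp (measurable_const.prodMk ?_)
      exact (joinUpper N).measurable
  simp_rw [e2]
  have h3 : Measurable fun p : ((ℝ × (Fin N → ℝ)) × (Fin N → ℂ)) ×
      ({p : Fin N × Fin N // p.1 < p.2} → ℂ) =>
      f (border p.1.1.1 p.1.2 (ofCoords (p.1.1.2, p.2))) :=
    hF2.comp (f := fun p : ((ℝ × (Fin N → ℝ)) × (Fin N → ℂ)) ×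
      ({p : Fin N × Fin N // p.1 < p.2} → ℂ) => ((p.1.1.1, p.1.2), (p.1.1.2, p.2))) (by fun_prop)
  rw [lintegral_prod_symm _ (h3.lintegral_prod_right'.lintegral_prod_right').aemeasurable]
  refine lintegral_congr fun d => ?_
  have h4 : ∀ x : ℝ, (∫⁻ v : Fin N → ℂ, ∫⁻ c, f (border x v (ofCoords (d, c))))
      = ∫⁻ c, ∫⁻ v : Fin N → ℂ, f (border x v (ofCoords (d, c))) := fun x => by
    rw [lintegral_lintegral_swap]
    exact (hF2.comp (f := fun p : (Fin N → ℂ) × ({p : Fin N × Fin N // p.1 < p.2} → ℂ) =>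
      ((x, p.1), (d, p.2))) (by fun_prop)).aemeasurable
  simp_rw [h4]
  rw [lintegral_lintegral_swap]
  refine Measurable.aemeasurable ?_
  have h5 : Measurable fun p : (ℝ × ({p : Fin N × Fin N // p.1 < p.2} → ℂ)) × (Fin N → ℂ) =>
      f (border p.1.1 p.2 (ofCoords (d, p.1.2))) :=
    hF2.comp (f := fun p : (ℝ × ({p : Fin N × Fin N // p.1 < p.2} → ℂ)) × (Fin N → ℂ) =>
      ((p.1.1, p.2), (d, p.1.2))) (by fun_prop)
  exact h5.lintegral_prod_right'

end Border

end

/-! ### Moduli, unitary invariance and class functions -/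

section

open Finset

section Moduli

theorem lintegral_normSq (F : ℝ → ENNReal) (hF : Measurable F) :
    ∫⁻ z : ℂ, F (Complex.normSq z) = ENNReal.ofReal Real.pi * ∫⁻ r in Set.Ioi (0 : ℝ), F r := by
  have himg : (fun r : ℝ => r ^ 2) '' Set.Ioi 0 = Set.Ioi 0 := by
    ext y
    constructor
    · rintro ⟨r, hr, rfl⟩
      exact pow_pos (Set.mem_Ioi.1 hr) 2
    · intro hy
      exact ⟨√y, Real.sqrt_pos.2 hy, Real.sq_sqrt (le_of_lt hy)⟩
  have hinj : Set.InjOn (fun r : ℝ => r ^ 2) (Set.Ioi 0) := fun a ha b hb h =>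
    (pow_left_inj₀ (le_of_lt ha) (le_of_lt hb) two_ne_zero).1 h
  have h1 := lintegral_image_eq_lintegral_abs_deriv_mul measurableSet_Ioi
    (fun r _ => (hasDerivAt_pow 2 r).hasDerivWithinAt) hinj F
  rw [himg] at h1
  rw [← Complex.lintegral_comp_polarCoord_symm, h1]
  have hpi : (volume : Measure (ℝ × ℝ)).restrict polarCoord.target
      = (volume.restrict (Set.Ioi (0 : ℝ))).prod
        (volume.restrict (Set.Ioo (-Real.pi) Real.pi)) := by
    rw [Measure.volume_eq_prod, Measure.prod_restrict]
    rfl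
  have h2 : ∀ p : ℝ × ℝ, ENNReal.ofReal p.1 • F (Complex.normSq (Complex.polarCoord.symm p))
      = (fun p : ℝ × ℝ => (fun r => ENNReal.ofReal r * F (r ^ 2)) p.1 * (fun _ => 1) p.2) p := by
    intro p
    simp only [smul_eq_mul, mul_one]
    rw [Complex.normSq_eq_norm_sq, Complex.norm_polarCoord_symm, sq_abs]
  simp_rw [h2]
  rw [hpi, lintegral_prod_mul (f := fun r => ENNReal.ofReal r * F (r ^ 2)) (g := fun _ => 1)
    (by fun_prop) (by fun_prop)]
  have h3 : ∀ r ∈ Set.Ioi (0 : ℝ), ENNReal.ofReal |(↑2 : ℝ) * r ^ (2 - 1)| * F (r ^ 2)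
      = 2 * (ENNReal.ofReal r * F (r ^ 2)) := by
    intro r hr
    rw [abs_of_pos (by have := Set.mem_Ioi.1 hr; positivity), ENNReal.ofReal_mul (by norm_num)]
    simp [mul_assoc]
  have h4 := setLIntegral_congr_fun (μ := volume) measurableSet_Ioi h3
  push_cast at h4 ⊢
  rw [h4, lintegral_const_mul _ (by fun_prop), lintegral_const, Measure.restrict_apply_univ,
    Real.volume_Ioo, one_mul, sub_neg_eq_add, ← two_mul, ENNReal.ofReal_mul (by norm_num),
    ENNReal.ofReal_ofNat]
  ring

/-- The squared moduli of the coordinates of a Lebesgue distributed vector. -/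
theorem map_normSq_volume (N : ℕ) :
    (volume : Measure (Fin N → ℂ)).map (fun v i => Complex.normSq (v i))
      = ENNReal.ofReal Real.pi ^ N • volume.restrict {r : Fin N → ℝ | ∀ i, 0 < r i} := by
  have hns : Measurable Complex.normSq := Complex.continuous_normSq.measurable
  have h1 : (volume : Measure ℂ).map Complex.normSq
      = ENNReal.ofReal Real.pi • volume.restrict (Set.Ioi (0 : ℝ)) := by
    refine Measure.ext fun s hs => ?_
    rw [← lintegral_indicator_one hs, lintegral_map (measurable_one.indicator hs) hns,
      lintegral_normSq _ (measurable_one.indicator hs), lintegral_indicator_one hs,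
      Measure.smul_apply, smul_eq_mul]
  have hset : {r : Fin N → ℝ | ∀ i, 0 < r i} = Set.univ.pi fun _ => Set.Ioi 0 := by
    ext r
    simp
  have : SigmaFinite ((volume : Measure ℂ).map Complex.normSq) := by
    rw [h1]
    exact inferInstanceAs
      (SigmaFinite (Real.toNNReal Real.pi • volume.restrict (Set.Ioi (0 : ℝ))))
  rw [volume_pi, Measure.pi_map_pi fun _ => hns.aemeasurable]
  refine Measure.pi_eq fun s hs => ?_
  rw [hset, Measure.smul_apply, Measure.restrict_apply (MeasurableSet.univ_pi hs),
    ← Set.pi_inter_distrib, volume_pi_pi, h1]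
  simp only [Measure.smul_apply, smul_eq_mul, Finset.prod_mul_distrib, prod_const, card_univ,
    Fintype.card_fin]
  congr 1
  exact prod_congr rfl fun i _ => (Measure.restrict_apply (hs i)).symm

end Moduli

section Unitary
variable {N : ℕ}

open Matrix

/-- Lebesgue measure on `ℂ ^ N` is invariant under unitary matrices. -/
theorem lintegral_vecMul_unitary {V : Matrix (Fin N) (Fin N) ℂ}
    (hV : V ∈ unitaryGroup (Fin N) ℂ) (F : (Fin N → ℂ) → ENNReal) (hF : Measurable F) :
    ∫⁻ v : Fin N → ℂ, F (v ᵥ* V) = ∫⁻ v, F v := by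
  have hd : ‖V.det‖ = 1 := by
    exact CStarRing.norm_of_mem_unitary (Matrix.det_of_mem_unitary hV)
  let L : (Fin N → ℂ) →ₗ[ℂ] (Fin N → ℂ) := Matrix.toLin' Vᵀ
  have hdet : LinearMap.det (L.restrictScalars ℝ) = 1 := by
    rw [LinearMap.det_restrictScalars, Algebra.norm_complex_apply, LinearMap.det_toLin',
      Matrix.det_transpose, Complex.normSq_eq_norm_sq, hd, one_pow]
  have hmap := Measure.map_linearMap_addHaar_eq_smul_addHaar (volume : Measure (Fin N → ℂ))
    (f := L.restrictScalars ℝ) (by rw [hdet]; exact one_ne_zero)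
  rw [hdet] at hmap
  simp only [inv_one, abs_one, ENNReal.ofReal_one, one_smul] at hmap
  have hLm : Measurable (L.restrictScalars ℝ) :=
    (LinearMap.continuous_of_finiteDimensional _).measurable
  conv_rhs => rw [← hmap, lintegral_map hF hLm]
  refine lintegral_congr fun v => ?_
  congr 1
  simp [L, Matrix.mulVec_transpose]

/-- Invariance of a function of Hermitian matrices under conjugation by unitary matrices. -/
def IsClassFunction (f : HermitianMatrix N → ENNReal) : Prop :=
  ∀ U ∈ unitaryGroup (Fin N) ℂ, ∀ H H' : HermitianMatrix N, H'.1 = U * H.1 * star U → f H' = f H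

/-- The diagonal matrix with given real entries. -/
def diag (l : Fin N → ℝ) : HermitianMatrix N :=
  ⟨Matrix.diagonal fun i => (l i : ℂ), by
    rw [Matrix.IsHermitian, Matrix.diagonal_conjTranspose]
    congr 1
    funext i
    simp⟩

theorem measurable_diag : Measurable (diag (N := N)) := by
  refine measurable_hermitian_of_entry fun i j => ?_
  simp only [diag, Matrix.diagonal_apply]
  split_ifs <;> fun_prop

/-- A Hermitian matrix is unitarily conjugate to the diagonal matrix of its eigenvalues. -/
theorem exists_unitary_diag_eigenvalues (H : HermitianMatrix N) :
    ∃ U ∈ unitaryGroup (Fin N) ℂ, H.1 = U * (diag H.2.eigenvalues).1 * star U := by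
  refine ⟨H.2.eigenvectorUnitary, H.2.eigenvectorUnitary.2, ?_⟩
  conv_lhs => rw [H.2.spectral_theorem]
  rfl

/-- A Hermitian matrix with `N` distinct known eigenvalues is unitarily conjugate to the diagonal
matrix formed by them. -/
theorem exists_unitary_diag_of_eigenvectors (H : HermitianMatrix N) {l : Fin N → ℝ}
    (hl : Function.Injective l)
    (h : ∀ j, ∃ w : Fin N → ℂ, w ≠ 0 ∧ H.1 *ᵥ w = (l j : ℂ) • w) :
    ∃ U ∈ unitaryGroup (Fin N) ℂ, H.1 = U * (diag l).1 * star U := by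
  have hex : ∀ j, ∃ i, H.2.eigenvalues i = l j := by
    intro j
    obtain ⟨w, hw0, hw⟩ := h j
    have hdet : (H.1 - (l j : ℂ) • 1).det = 0 := by
      refine Matrix.exists_mulVec_eq_zero_iff.1 ⟨w, hw0, ?_⟩
      rw [Matrix.sub_mulVec, hw, Matrix.smul_mulVec, Matrix.one_mulVec, sub_self]
    have hmem : l j ∈ spectrum ℝ H.1 := by
      rw [spectrum.mem_iff, ← IsUnit.sub_iff, Matrix.isUnit_iff_isUnit_det]
      have : (H.1 - algebraMap ℝ (Matrix (Fin N) (Fin N) ℂ) (l j)) = H.1 - (l j : ℂ) • 1 := by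
        rw [Algebra.algebraMap_eq_smul_one]
        congr 1
      rw [this, hdet]
      exact not_isUnit_zero
    rw [H.2.spectrum_real_eq_range_eigenvalues] at hmem
    exact hmem
  choose e he using hex
  have hinj : Function.Injective e := fun a b hab => hl (by rw [← he, ← he, hab])
  let E : Fin N ≃ Fin N := Equiv.ofBijective e (Finite.injective_iff_bijective.1 hinj)
  obtain ⟨U, hU, hUH⟩ := exists_unitary_diag_eigenvalues H
  have hdiag : (diag l).1 = (diag H.2.eigenvalues).1.submatrix E E := by
    ext i j
    simp only [diag, Matrix.submatrix_apply, Matrix.diagonal_apply, E.injective.eq_iff]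
    split_ifs
    · rw [← he]; rfl
    · rfl
  refine ⟨U.submatrix id E, ?_, ?_⟩
  · rw [mem_unitaryGroup_iff, star_eq_conjTranspose, conjTranspose_submatrix,
      Matrix.submatrix_mul_equiv, ← star_eq_conjTranspose, mem_unitaryGroup_iff.1 hU,
      Matrix.submatrix_id_id]
  · rw [hdiag, star_eq_conjTranspose, conjTranspose_submatrix, Matrix.submatrix_mul_equiv,
      Matrix.submatrix_mul_equiv, Matrix.submatrix_id_id, ← star_eq_conjTranspose]
    exact hUH

theorem IsClassFunction.eq_diag {f : HermitianMatrix N → ENNReal} (hf : IsClassFunction f)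
    (H : HermitianMatrix N) {l : Fin N → ℝ} (hl : Function.Injective l)
    (h : ∀ j, ∃ w : Fin N → ℂ, w ≠ 0 ∧ H.1 *ᵥ w = (l j : ℂ) • w) : f H = f (diag l) := by
  obtain ⟨U, hU, hUH⟩ := exists_unitary_diag_of_eigenvectors H hl h
  exact hf U hU _ _ hUH

theorem borderMatrix_conj (V W : Matrix (Fin N) (Fin N) ℂ) (a : ℂ) (v w : Fin N → ℂ)
    (M : Matrix (Fin N) (Fin N) ℂ) :
    borderMatrix 1 0 0 V * borderMatrix a v w M * borderMatrix 1 0 0 W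
      = borderMatrix a (v ᵥ* W) (V *ᵥ w) (V * M * W) := by
  ext i j
  refine Fin.cases ?_ (fun i => ?_) i <;> refine Fin.cases ?_ (fun j => ?_) j <;>
    simp [borderMatrix, Matrix.mul_apply, Fin.sum_univ_succ, Matrix.vecMul, Matrix.mulVec,
      dotProduct]

theorem borderMatrix_one : borderMatrix 1 0 0 (1 : Matrix (Fin N) (Fin N) ℂ) = 1 := by
  ext i j
  refine Fin.cases ?_ (fun i => ?_) i <;> refine Fin.cases ?_ (fun j => ?_) j <;>
    simp [borderMatrix, Matrix.one_apply, Fin.succ_ne_zero, (Fin.succ_ne_zero _).symm]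

theorem star_borderMatrix (V : Matrix (Fin N) (Fin N) ℂ) :
    star (borderMatrix 1 0 0 V) = borderMatrix 1 0 0 (star V) := by
  ext i j
  refine Fin.cases ?_ (fun i => ?_) i <;> refine Fin.cases ?_ (fun j => ?_) j <;>
    simp [borderMatrix, Matrix.star_apply]

/-- Integrating out the border turns class functions into class functions. -/
theorem IsClassFunction.border {f : HermitianMatrix (N + 1) → ENNReal} (hf : IsClassFunction f)
    (hfm : Measurable f) : IsClassFunction fun H : HermitianMatrix N =>
      ∫⁻ x : ℝ, ∫⁻ v : Fin N → ℂ, f (HuaPickrell.border x v H) := by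
  intro U hU H H' hH
  refine lintegral_congr fun x => ?_
  rw [← lintegral_vecMul_unitary (V := star U) (Unitary.star_mem hU)
    (fun v => f (HuaPickrell.border x v H'))
    (hfm.comp (measurable_border.comp ((measurable_const.prodMk measurable_id).prodMk
      measurable_const)))]
  refine lintegral_congr fun v => ?_
  refine hf (borderMatrix 1 0 0 U) ?_ _ _ ?_
  · rw [mem_unitaryGroup_iff, star_borderMatrix]
    have := borderMatrix_conj U (star U) 1 0 0 1
    rw [borderMatrix_one, mul_one, mul_one, mem_unitaryGroup_iff.1 hU] at this
    simpa [borderMatrix_one] using this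
  · rw [star_borderMatrix]
    simp only [HuaPickrell.border]
    rw [borderMatrix_conj, hH]
    congr 1
    funext i
    simp [Matrix.vecMul, Matrix.mulVec, dotProduct, Matrix.star_apply, mul_comm]

end Unitary

end

/-! ### The Weyl integration formula -/

section

open Finset

section Weyl
variable {N : ℕ}

open Matrix

/-- The roots of the secular equation are eigenvalues of the bordered diagonal matrix, with explicit
eigenvectors `(1, conj (v i) / (l j - m i))`. -/
theorem exists_eigenvector_border {m : Fin N → ℝ} {l : Fin (N + 1) → ℝ} (h : Interlaces m l)
    {v : Fin N → ℂ} (hv : ∀ i, Complex.normSq (v i) = secularWeight m l i) (j : Fin (N + 1)) :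
    ∃ w : Fin (N + 1) → ℂ, w ≠ 0 ∧
      (border (secularShift m l) v (diag m)).1 *ᵥ w = (l j : ℂ) • w := by
  have hne : ∀ i, l j - m i ≠ 0 := by
    intro i
    rcases lt_or_ge i.castSucc j with hij | hij
    · exact (sub_pos.2 (h.succ_le (Fin.castSucc_lt_iff_succ_le.1 hij))).ne'
    · exact (sub_neg.2 (h.le_castSucc hij)).ne
  have hsec : secularFun m (secularShift m l) (secularWeight m l) (l j) = 0 := by
    have h1 := eval_secularPoly m (secularShift m l) (secularWeight m l) hne
    rw [secularPoly_eq_prod h.strictMono_left.injective, Polynomial.eval_prod,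
      Finset.prod_eq_zero (mem_univ j) (by simp)] at h1
    exact (mul_eq_zero.1 h1.symm).resolve_right (Finset.prod_ne_zero_iff.2 fun i _ => hne i)
  refine ⟨Fin.cons 1 fun i => star (v i) / ((l j - m i : ℝ) : ℂ), fun h0 => ?_, ?_⟩
  · simpa using congrFun h0 0
  funext i
  refine Fin.cases ?_ (fun i => ?_) i
  · have h2 : ((l j - secularShift m l - ∑ i, secularWeight m l i / (l j - m i) : ℝ) : ℂ) = 0 := by
      rw [← Complex.ofReal_zero, ← hsec, secularFun]
    have h3 : ∀ i, v i * (star (v i) / ((l j - m i : ℝ) : ℂ))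
        = ((secularWeight m l i / (l j - m i) : ℝ) : ℂ) := by
      intro i
      rw [← mul_div_assoc, Complex.ofReal_div, ← hv i]
      congr 1
      exact Complex.mul_conj (v i)
    simp only [border, borderMatrix, Matrix.mulVec, dotProduct, Fin.sum_univ_succ, Matrix.of_apply,
      Fin.cons_zero, Fin.cons_succ, Pi.smul_apply, smul_eq_mul, mul_one, h3]
    push_cast at h2 ⊢
    linear_combination -h2
  · have h4 : ((l j - m i : ℝ) : ℂ) ≠ 0 := Complex.ofReal_ne_zero.2 (hne i)
    simp only [border, borderMatrix, Matrix.mulVec, dotProduct, Fin.sum_univ_succ, Matrix.of_apply,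
      Fin.cons_zero, Fin.cons_succ, Pi.smul_apply, smul_eq_mul, mul_one, diag,
      Matrix.diagonal_apply, ite_mul, zero_mul, Finset.sum_ite_eq, mem_univ, if_true]
    field_simp
    push_cast
    ring

theorem isOpen_strictMono : IsOpen {l : Fin N → ℝ | StrictMono l} := by
  simp only [StrictMono, Set.ofPred_forall]
  refine isOpen_iInter_of_finite fun i => isOpen_iInter_of_finite fun j =>
    isOpen_iInter_of_finite fun _ => ?_
  exact isOpen_lt (continuous_apply _) (continuous_apply _)

theorem measurable_abs_det_vandermonde :
    Measurable fun l : Fin N → ℝ => ENNReal.ofReal |(Matrix.vandermonde l).det| := by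
  simp_rw [Matrix.det_vandermonde]
  fun_prop

/-- A class function of a bordered diagonal matrix, averaged over the border. -/
theorem vandermonde_mul_lintegral_border_diag {f : HermitianMatrix (N + 1) → ENNReal}
    (hf : IsClassFunction f) (hfm : Measurable f) {m : Fin N → ℝ} (hm : StrictMono m) :
    ENNReal.ofReal |(Matrix.vandermonde m).det| *
        ∫⁻ x : ℝ, ∫⁻ v : Fin N → ℂ, f (border x v (diag m))
      = ENNReal.ofReal Real.pi ^ N * ∫⁻ l in {l | Interlaces m l},
          ENNReal.ofReal |(Matrix.vandermonde l).det| * f (diag l) := by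
  let G : ℝ → (Fin N → ℝ) → ENNReal := fun x r => f (border x (fun i => (√(r i) : ℂ)) (diag m))
  have hG : Measurable (Function.uncurry G) := by
    refine hfm.comp (measurable_border.comp (Measurable.prodMk (Measurable.prodMk ?_ ?_)
      measurable_const))
    · exact measurable_fst
    · exact measurable_pi_lambda _ fun i => Complex.measurable_ofReal.comp
        ((measurable_pi_apply i).comp measurable_snd).sqrt
  have hGl : ∀ l, Interlaces m l → ∀ v : Fin N → ℂ,
      (∀ i, Complex.normSq (v i) = secularWeight m l i) →
      f (border (secularShift m l) v (diag m)) = f (diag l) := fun l hl v hv =>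
    hf.eq_diag _ hl.strictMono_right.injective (exists_eigenvector_border hl hv)
  have hsq : ∀ r : Fin N → ℝ, (∀ i, 0 < r i) → ∀ i, Complex.normSq (√(r i) : ℂ) = r i := by
    intro r hr i
    rw [Complex.normSq_ofReal, Real.mul_self_sqrt (hr i).le]
  -- the spectrum, and so the value of `f`, depends on the border `v` only through the squared
  -- moduli
  have hGv : ∀ (x : ℝ) (v : Fin N → ℂ), (∀ i, v i ≠ 0) →
      f (border x v (diag m)) = G x fun i => Complex.normSq (v i) := by
    intro x v hv
    have hpos : ∀ i, 0 < Complex.normSq (v i) := fun i => Complex.normSq_pos.2 (hv i)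
    obtain ⟨l, hl, hx, hr⟩ := exists_interlaces hm x hpos
    have h1 := hGl l hl v fun i => by rw [hr]
    have h2 := hGl l hl (fun i => (√(Complex.normSq (v i)) : ℂ)) fun i => by
      rw [hr, hsq _ hpos]
    rw [hx] at h1 h2
    exact h1.trans h2.symm
  have hae : ∀ᵐ v : Fin N → ℂ, ∀ i, v i ≠ 0 := by
    refine ae_all_iff.2 fun i => ?_
    have : (volume : Measure (Fin N → ℂ)) {v | v i = 0} = 0 := by
      have h0 := Measure.quasiMeasurePreserving_eval (fun _ : Fin N => (volume : Measure ℂ)) i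
      exact h0.preimage_null (s := {0}) (by simp)
    exact measure_eq_zero_iff_ae_notMem.1 this
  have hns : Measurable fun (v : Fin N → ℂ) i => Complex.normSq (v i) :=
    measurable_pi_lambda _ fun i =>
      Complex.continuous_normSq.measurable.comp (measurable_pi_apply i)
  have h1 : ∀ x, ∫⁻ v : Fin N → ℂ, f (border x v (diag m))
      = ENNReal.ofReal Real.pi ^ N * ∫⁻ r in {r : Fin N → ℝ | ∀ i, 0 < r i}, G x r := by
    intro x
    rw [lintegral_congr_ae (hae.mono fun v hv => hGv x v hv),
      ← lintegral_map (hG.of_uncurry_left) hns, map_normSq_volume, lintegral_smul_measure,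
      smul_eq_mul]
  simp_rw [h1]
  rw [lintegral_const_mul' _ _ (ENNReal.pow_ne_top ENNReal.ofReal_ne_top), mul_left_comm]
  congr 1
  let g : (Fin (N + 1) → ℝ) → ENNReal := fun w => G (w 0) fun i => w i.succ
  have h2 : ∫⁻ w in {w : Fin (N + 1) → ℝ | ∀ i : Fin N, 0 < w i.succ}, g w
      = ∫⁻ x, ∫⁻ r in {r : Fin N → ℝ | ∀ i, 0 < r i}, G x r := by
    have hms : MeasurableSet {r : Fin N → ℝ | ∀ i, 0 < r i} := by
      simp only [Set.ofPred_forall]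
      exact MeasurableSet.iInter fun i => measurableSet_lt measurable_const (measurable_pi_apply i)
    have e1 := volume_preserving_piFinSuccAbove (fun _ : Fin (N + 1) => ℝ) 0
    have h3 : ∫⁻ w in {w : Fin (N + 1) → ℝ | ∀ i : Fin N, 0 < w i.succ}, g w
        = ∫⁻ p in Set.univ ×ˢ {r : Fin N → ℝ | ∀ i, 0 < r i}, Function.uncurry G p := by
      rw [← e1.setLIntegral_comp_preimage (MeasurableSet.univ.prod hms) hG]
      have hset : {w : Fin (N + 1) → ℝ | ∀ i : Fin N, 0 < w i.succ}
          = MeasurableEquiv.piFinSuccAbove (fun _ : Fin (N + 1) => ℝ) 0 ⁻¹'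
            (Set.univ ×ˢ {r : Fin N → ℝ | ∀ i, 0 < r i}) := by
        ext w
        simp [MeasurableEquiv.piFinSuccAbove, Fin.tail]
      rw [hset]
      rfl
    rw [h3, Measure.volume_eq_prod, ← Measure.prod_restrict, Measure.restrict_univ,
      lintegral_prod _ hG.aemeasurable]
    rfl
  rw [← h2, vandermonde_mul_lintegral_border hm g]
  refine setLIntegral_congr_fun (isOpen_interlaces m).measurableSet fun l hl => ?_
  congr 1
  refine hGl l hl _ fun i => ?_
  exact hsq _ (fun i => Interlaces.secularWeight_pos hl i) i

/-- The constant of the Weyl integration formula on `ℍ(N)`. -/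
def weylConst : ℕ → ENNReal
  | 0 => 1
  | N + 1 => weylConst N * (ENNReal.ofReal Real.pi ^ N * ENNReal.ofReal ((N.factorial : ℝ)⁻¹))

theorem weylConst_ne_zero (N : ℕ) : weylConst N ≠ 0 := by
  induction N with
  | zero => exact one_ne_zero
  | succ N ih =>
    refine mul_ne_zero ih (mul_ne_zero (pow_ne_zero _ ?_) ?_)
    · exact (ENNReal.ofReal_pos.2 Real.pi_pos).ne'
    · exact (ENNReal.ofReal_pos.2 (by positivity)).ne'

theorem weylConst_ne_top (N : ℕ) : weylConst N ≠ ⊤ := by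
  induction N with
  | zero => exact ENNReal.one_ne_top
  | succ N ih =>
    exact ENNReal.mul_ne_top ih (ENNReal.mul_ne_top (ENNReal.pow_ne_top ENNReal.ofReal_ne_top)
      ENNReal.ofReal_ne_top)

theorem isOpen_interlaces_prod :
    IsOpen {p : (Fin N → ℝ) × (Fin (N + 1) → ℝ) | Interlaces p.1 p.2} := by
  simp only [Interlaces, Set.ofPred_forall]
  refine isOpen_iInter_of_finite fun i => IsOpen.inter ?_ ?_
  · exact isOpen_lt ((continuous_apply _).comp continuous_snd)
      ((continuous_apply _).comp continuous_fst)
  · exact isOpen_lt ((continuous_apply _).comp continuous_fst)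
      ((continuous_apply _).comp continuous_snd)

/-- The Weyl integration formula for class functions of Hermitian matrices. -/
theorem lintegral_lebesgue_of_isClassFunction (N : ℕ) {f : HermitianMatrix N → ENNReal}
    (hf : IsClassFunction f) (hfm : Measurable f) :
    ∫⁻ H, f H ∂(lebesgue N) = weylConst N * ∫⁻ l in {l : Fin N → ℝ | StrictMono l},
      ENNReal.ofReal |(Matrix.vandermonde l).det| *
        (ENNReal.ofReal |(Matrix.vandermonde l).det| * f (diag l)) := by
  induction N with
  | zero =>
    have h : {l : Fin 0 → ℝ | StrictMono l} = Set.univ :=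
      Set.eq_univ_of_forall fun l i => i.elim0
    have hH : ∀ H H' : HermitianMatrix 0, H = H' := fun H H' =>
      Subtype.ext (Matrix.ext fun i => i.elim0)
    rw [lintegral_lebesgue f hfm, h, weylConst, one_mul, Measure.restrict_univ]
    simp only [Matrix.det_fin_zero, abs_one, ENNReal.ofReal_one, one_mul]
    refine lintegral_congr fun d => ?_
    rw [lintegral_congr fun c => congrArg f (hH (ofCoords (d, c)) (diag d)), lintegral_const]
    have : (volume : Measure ({p : Fin 0 × Fin 0 // p.1 < p.2} → ℂ)) Set.univ = 1 := by
      simp [volume_pi]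
    rw [this, mul_one]
  | succ N ih =>
    have hgm : Measurable fun H : HermitianMatrix N =>
        ∫⁻ x : ℝ, ∫⁻ v : Fin N → ℂ, f (border x v H) := by
      have h1 : Measurable fun p : (HermitianMatrix N × ℝ) × (Fin N → ℂ) =>
          f (border p.1.2 p.2 p.1.1) :=
        (hfm.comp measurable_border).comp
          (((measurable_snd.comp measurable_fst).prodMk measurable_snd).prodMk
          (measurable_fst.comp measurable_fst))
      exact (h1.lintegral_prod_right').lintegral_prod_right'
    rw [lintegral_lebesgue_succ f hfm, ih (hf.border hfm) hgm, weylConst, mul_assoc]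
    congr 1
    let D : (n : ℕ) → (Fin n → ℝ) → ENNReal := fun n l =>
      ENNReal.ofReal |(Matrix.vandermonde l).det|
    have hD : ∀ n, Measurable (D n) := fun n => measurable_abs_det_vandermonde
    have hfd : Measurable fun l => f (diag l) := hfm.comp measurable_diag
    -- the integrand over the pairs of interlacing spectra, to be integrated in either order
    let K : (Fin N → ℝ) × (Fin (N + 1) → ℝ) → ENNReal :=
      {p : (Fin N → ℝ) × (Fin (N + 1) → ℝ) | Interlaces p.1 p.2}.indicator
        fun p => D N p.1 * (D (N + 1) p.2 * f (diag p.2))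
    have hK : Measurable K := by
      refine Measurable.indicator ?_ isOpen_interlaces_prod.measurableSet
      exact ((hD N).comp measurable_fst).mul
        (((hD (N + 1)).mul hfd).comp measurable_snd)
    have h1 : ∫⁻ m in {m : Fin N → ℝ | StrictMono m}, D N m * (D N m *
          ∫⁻ x : ℝ, ∫⁻ v : Fin N → ℂ, f (border x v (diag m)))
        = ENNReal.ofReal Real.pi ^ N * ∫⁻ m, ∫⁻ l, K (m, l) := by
      rw [← lintegral_const_mul' _ _ (ENNReal.pow_ne_top ENNReal.ofReal_ne_top),
        ← lintegral_indicator isOpen_strictMono.measurableSet]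
      refine lintegral_congr fun m => ?_
      by_cases hm : StrictMono m
      · rw [Set.indicator_of_mem (show m ∈ {m : Fin N → ℝ | StrictMono m} from hm),
          vandermonde_mul_lintegral_border_diag hf hfm hm, mul_left_comm]
        congr 1
        rw [← lintegral_const_mul' _ _ ENNReal.ofReal_ne_top,
          ← lintegral_indicator (isOpen_interlaces m).measurableSet]
        rfl
      · rw [Set.indicator_of_notMem (show m ∉ {m : Fin N → ℝ | StrictMono m} from hm)]
        have : ∀ l, K (m, l) = 0 := fun l =>
          Set.indicator_of_notMem (fun h => hm (Interlaces.strictMono_left h)) _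
        simp [this]
    have h2 : ∫⁻ m, ∫⁻ l, K (m, l) = ENNReal.ofReal ((N.factorial : ℝ)⁻¹) *
        ∫⁻ l in {l : Fin (N + 1) → ℝ | StrictMono l}, D (N + 1) l * (D (N + 1) l * f (diag l)) := by
      rw [lintegral_lintegral_swap (f := fun m l => K (m, l)) hK.aemeasurable,
        ← lintegral_const_mul' _ _ ENNReal.ofReal_ne_top,
        ← lintegral_indicator isOpen_strictMono.measurableSet]
      refine lintegral_congr fun l => ?_
      by_cases hl : StrictMono l
      · rw [Set.indicator_of_mem (show l ∈ {l : Fin (N + 1) → ℝ | StrictMono l} from hl),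
          ← mul_assoc, ← lintegral_vandermonde_interlaces hl,
          ← lintegral_mul_const _ (hD N)]
        have hms : MeasurableSet {m : Fin N → ℝ | Interlaces m l} :=
          isOpen_interlaces_prod.measurableSet.preimage (measurable_id.prodMk measurable_const)
        rw [← lintegral_indicator hms]
        rfl
      · rw [Set.indicator_of_notMem (show l ∉ {l : Fin (N + 1) → ℝ | StrictMono l} from hl)]
        have : ∀ m, K (m, l) = 0 := fun m =>
          Set.indicator_of_notMem (fun h => hl (Interlaces.strictMono_right h)) _
        simp [this]
    rw [mul_assoc, ← h2]
    exact h1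

end Weyl

end

/-! ### Andréief's identity and Hankel determinants of measures -/

section

open Finset

section Andreief
variable {n : ℕ}

theorem ae_injective : ∀ᵐ l : Fin n → ℝ, Function.Injective l := by
  have h : ∀ i j : Fin n, i ≠ j → ∀ᵐ l : Fin n → ℝ, l i ≠ l j := by
    intro i j hij
    let S : Submodule ℝ (Fin n → ℝ) := LinearMap.ker
      ((LinearMap.proj i : (Fin n → ℝ) →ₗ[ℝ] ℝ) - LinearMap.proj j)
    have hS : S ≠ ⊤ := by
      intro hT
      have : (Pi.single i 1 : Fin n → ℝ) ∈ S := hT ▸ Submodule.mem_top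
      simp [S, hij.symm] at this
    have h0 := Measure.addHaar_submodule (volume : Measure (Fin n → ℝ)) S hS
    refine (measure_eq_zero_iff_ae_notMem.1 h0).mono fun l hl h => hl ?_
    simp [S, h]
  have h' : ∀ᵐ l : Fin n → ℝ, ∀ i j : Fin n, i ≠ j → l i ≠ l j :=
    ae_all_iff.2 fun i => ae_all_iff.2 fun j => ae_all_iff.2 fun hij => h i j hij
  filter_upwards [h'] with l hl i j hij
  by_contra hne
  exact hl i j hne hij

/-- The regions of given ordering of the coordinates cover the space up to a null set, so an
integral is the integral over the increasing tuples of the sum over all permutations. -/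
theorem integral_eq_sum_perm {F : (Fin n → ℝ) → ℂ} (hF : Integrable F) :
    IntegrableOn (fun l => ∑ σ : Equiv.Perm (Fin n), F (l ∘ σ)) {l | StrictMono l} ∧
    ∫ l in {l : Fin n → ℝ | StrictMono l}, ∑ σ : Equiv.Perm (Fin n), F (l ∘ σ) = ∫ l, F l := by
  have hpres : ∀ σ : Equiv.Perm (Fin n),
      MeasurePreserving (MeasurableEquiv.arrowCongr' σ.symm (MeasurableEquiv.refl ℝ)) :=
    fun σ => volume_preserving_arrowCongr' σ.symm _ (MeasurePreserving.id volume)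
  have hcoe : ∀ (σ : Equiv.Perm (Fin n)) (l : Fin n → ℝ),
      MeasurableEquiv.arrowCongr' σ.symm (MeasurableEquiv.refl ℝ) l = l ∘ σ := fun σ l => rfl
  have hint : ∀ σ : Equiv.Perm (Fin n), Integrable fun l => F (l ∘ σ) := fun σ =>
    (hpres σ).integrable_comp_of_integrable hF
  refine ⟨integrable_finsetSum _ fun σ _ => (hint σ).integrableOn, ?_⟩
  rw [integral_finsetSum _ fun σ _ => (hint σ).integrableOn]
  let T : Equiv.Perm (Fin n) → Set (Fin n → ℝ) := fun σ => {l | StrictMono (l ∘ σ.symm)}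
  have hTm : ∀ σ, MeasurableSet (T σ) := fun σ =>
    (isOpen_strictMono.measurableSet).preimage
      (measurable_pi_lambda _ fun i => measurable_pi_apply (σ.symm i))
  have h1 : ∀ σ : Equiv.Perm (Fin n), ∫ l in {l : Fin n → ℝ | StrictMono l}, F (l ∘ σ)
      = ∫ l in T σ, F l := by
    intro σ
    have hset : {l : Fin n → ℝ | StrictMono l}
        = MeasurableEquiv.arrowCongr' σ.symm (MeasurableEquiv.refl ℝ) ⁻¹' T σ := by
      ext l
      simp only [T, Set.mem_preimage, hcoe, Set.mem_ofPred_eq]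
      rw [Function.comp_assoc, Equiv.self_comp_symm, Function.comp_id]
    rw [hset]
    exact (hpres σ).setIntegral_preimage_emb (MeasurableEquiv.measurableEmbedding _) F (T σ)
  simp_rw [h1]
  have hdisj : Pairwise fun σ τ => Disjoint (T σ) (T τ) := by
    intro σ τ hne
    rw [Set.disjoint_left]
    intro l hσ hτ
    have hinj : Function.Injective l := by
      have := (StrictMono.injective hσ).comp σ.injective
      rwa [Function.comp_assoc, Equiv.symm_comp_self, Function.comp_id] at this
    have hr : Set.range (l ∘ σ.symm) = Set.range (l ∘ τ.symm) := by
      rw [Set.range_comp, Set.range_comp, σ.symm.range_eq_univ, τ.symm.range_eq_univ]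
    have h := (StrictMono.range_inj hσ hτ).1 hr
    refine hne (Equiv.symm_bijective.injective (Equiv.ext fun i => hinj (congrFun h i)))
  rw [← integral_iUnion_fintype hTm hdisj fun σ => hF.integrableOn]
  have hae : (⋃ σ, T σ) =ᵐ[volume] Set.univ := by
    rw [eventuallyEq_univ]
    filter_upwards [ae_injective] with l hl
    refine Set.mem_iUnion.2 ⟨(Tuple.sort l).symm, ?_⟩
    exact (Tuple.monotone_sort l).strictMono_of_injective (hl.comp (Tuple.sort l).injective)
  rw [setIntegral_congr_set hae, setIntegral_univ]

/-- Andréief's identity: the integral of a squared Vandermonde determinant against a product weight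
is a Hankel determinant of moments. -/
theorem andreief {g : ℝ → ℂ}
    (hg : ∀ i j : Fin n, Integrable fun x : ℝ => (x : ℂ) ^ ((i : ℕ) + j) * g x) :
    IntegrableOn (fun l => (((Matrix.vandermonde l).det ^ 2 : ℝ) : ℂ) * ∏ i, g (l i))
      {l : Fin n → ℝ | StrictMono l} ∧
    ∫ l in {l : Fin n → ℝ | StrictMono l},
        (((Matrix.vandermonde l).det ^ 2 : ℝ) : ℂ) * ∏ i, g (l i)
      = (Matrix.of fun i j : Fin n => ∫ x : ℝ, (x : ℂ) ^ ((i : ℕ) + j) * g x).det := by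
  let F : (Fin n → ℝ) → ℂ := fun l =>
    (Matrix.of fun i j : Fin n => (l i : ℂ) ^ ((i : ℕ) + j) * g (l i)).det
  have hF := integrable_det_pi (fun _ => volume) _ hg
  have hF2 := integral_det_pi (fun _ => volume) _ hg
  rw [← volume_pi] at hF hF2
  have hprod : ∀ l : Fin n → ℝ, F l
      = (∏ i, (l i : ℂ) ^ (i : ℕ) * g (l i)) * ((Matrix.vandermonde l).det : ℂ) := by
    intro l
    have : (Matrix.of fun i j : Fin n => (l i : ℂ) ^ ((i : ℕ) + j) * g (l i))
        = Matrix.of fun i j => ((l i : ℂ) ^ (i : ℕ) * g (l i)) *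
          ((Matrix.vandermonde l).map Complex.ofRealHom) i j := by
      ext i j
      simp [Matrix.vandermonde_apply, pow_add]
      ring
    simp only [F]
    rw [this, Matrix.det_mul_column]
    congr 1
    exact (RingHom.map_det Complex.ofRealHom _).symm
  have hsum : ∀ l : Fin n → ℝ, ∑ σ : Equiv.Perm (Fin n), F (l ∘ σ)
      = (((Matrix.vandermonde l).det ^ 2 : ℝ) : ℂ) * ∏ i, g (l i) := by
    intro l
    have h1 : ∀ σ : Equiv.Perm (Fin n), F (l ∘ σ)
        = (((Equiv.Perm.sign σ : ℤ) : ℂ) * ∏ i, (l (σ i) : ℂ) ^ (i : ℕ)) *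
          (((Matrix.vandermonde l).det : ℂ) * ∏ i, g (l i)) := by
      intro σ
      have hd : (Matrix.vandermonde (l ∘ σ)).det
          = (Equiv.Perm.sign σ : ℤ) * (Matrix.vandermonde l).det :=
        Matrix.det_permute σ (Matrix.vandermonde l)
      rw [hprod, prod_mul_distrib, hd]
      have : ∏ i, g ((l ∘ σ) i) = ∏ i, g (l i) := Equiv.prod_comp σ fun i => g (l i)
      rw [this]
      simp only [Function.comp_apply]
      push_cast
      ring
    have h2 : ((Matrix.vandermonde l).det : ℂ)
        = ∑ σ : Equiv.Perm (Fin n), ((Equiv.Perm.sign σ : ℤ) : ℂ) *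
          ∏ i, (l (σ i) : ℂ) ^ (i : ℕ) := by
      rw [Matrix.det_apply']
      push_cast
      simp [Matrix.vandermonde_apply]
    simp_rw [h1]
    rw [← sum_mul, ← h2]
    push_cast
    ring
  have h := integral_eq_sum_perm hF
  simp only [F] at hsum
  simp_rw [hsum] at h
  exact ⟨h.1, h.2.trans hF2⟩

end Andreief

/-- Hankel determinants of moments of a nonzero diffuse measure are positive. -/
theorem det_hankel_pos {n : ℕ} (ν : Measure ℝ) [NullSingletonClass ν] (hν : ν ≠ 0)
    (hint : ∀ i j : Fin n, Integrable (fun x : ℝ => x ^ ((i : ℕ) + j)) ν) :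
    0 < (Matrix.of fun i j : Fin n => ∫ x, x ^ ((i : ℕ) + j) ∂ν).det := by
  refine Matrix.PosDef.det_pos (Matrix.PosDef.of_dotProduct_mulVec_pos ?_ fun v hv => ?_)
  · ext i j
    simp [add_comm]
  · let p : Polynomial ℝ := ∑ i : Fin n, Polynomial.monomial (i : ℕ) (v i)
    have hp : p ≠ 0 := by
      intro h0
      refine hv (funext fun i => ?_)
      have := congrArg (fun q => q.coeff (i : ℕ)) h0
      simpa [p, Polynomial.finsetSum_coeff, Polynomial.coeff_monomial, Fin.val_inj] using this
    have hexp : ∀ x, p.eval x ^ 2 = ∑ i, ∑ j, v i * v j * x ^ ((i : ℕ) + j) := by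
      intro x
      simp only [p, Polynomial.eval_finsetSum, Polynomial.eval_monomial]
      rw [sq, sum_mul_sum]
      exact sum_congr rfl fun i _ => sum_congr rfl fun j _ => by ring
    have hI : Integrable (fun x => p.eval x ^ 2) ν := by
      simp_rw [hexp]
      exact integrable_finsetSum _ fun i _ => integrable_finsetSum _ fun j _ =>
        (hint i j).const_mul _
    have heq : star v ⬝ᵥ (Matrix.of fun i j : Fin n => ∫ x, x ^ ((i : ℕ) + j) ∂ν).mulVec v
        = ∫ x, p.eval x ^ 2 ∂ν := by
      simp_rw [hexp]
      rw [integral_finsetSum _ fun i _ => integrable_finsetSum _ fun j _ =>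
        (hint i j).const_mul _]
      simp only [dotProduct, Matrix.mulVec, Matrix.of_apply, star_trivial, mul_sum]
      refine sum_congr rfl fun i _ => ?_
      rw [integral_finsetSum _ fun j _ => (hint i j).const_mul _]
      refine sum_congr rfl fun j _ => ?_
      rw [integral_const_mul]
      ring
    rw [heq, integral_pos_iff_support_of_nonneg (fun x => sq_nonneg _) hI, pos_iff_ne_zero]
    intro h0
    refine hν (Measure.measure_univ_eq_zero.1 ?_)
    have hroots : ν {x | p.IsRoot x} = 0 := (p.finite_setOfPred_isRoot hp).measure_zero ν
    refine measure_mono_null (fun x _ => ?_) (measure_union_null h0 hroots)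
    by_cases hx : p.eval x = 0
    · exact Or.inr hx
    · exact Or.inl (by simpa using hx)

end

/-! ### The characteristic function as a Hankel determinant -/

section

open Finset

section Trace
variable {N : ℕ}

open Matrix

/-- The pair `(Tr H, det (1 + H ^ 2))` of real numbers. -/
def traceDet (H : HermitianMatrix N) : ℝ × ℝ := (H.1.trace.re, (1 + H.1 ^ 2).det.re)

theorem measurable_traceDet : Measurable (traceDet (N := N)) := by
  have h1 : ∀ i j : Fin N, Measurable fun H : HermitianMatrix N =>
      ((1 : Matrix (Fin N) (Fin N) ℂ) + H.1 ^ 2) i j := by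
    intro i j
    simp only [sq, Matrix.add_apply, Matrix.mul_apply]
    exact (Finset.measurable_sum _ fun k _ =>
      (measurable_entry i k).mul (measurable_entry k j)).const_add _
  refine Measurable.prodMk ?_ ?_
  · refine Complex.measurable_re.comp ?_
    exact Finset.measurable_sum _ fun i _ => measurable_entry i i
  · refine Complex.measurable_re.comp ?_
    simp_rw [Matrix.det_apply']
    exact Finset.measurable_sum _ fun σ _ =>
      (Finset.measurable_prod _ fun i _ => h1 _ _).const_mul _

theorem traceDet_conj {U : Matrix (Fin N) (Fin N) ℂ} (hU : U ∈ unitaryGroup (Fin N) ℂ)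
    {H H' : HermitianMatrix N} (h : H'.1 = U * H.1 * star U) : traceDet H' = traceDet H := by
  have h1 : star U * U = 1 := mem_unitaryGroup_iff'.1 hU
  have h2 : U * star U = 1 := mem_unitaryGroup_iff.1 hU
  have h3 : 1 + H'.1 ^ 2 = U * (1 + H.1 ^ 2) * star U := by
    rw [h, mul_add, add_mul, mul_one, h2, sq, sq]
    congr 1
    calc U * H.1 * star U * (U * H.1 * star U) = U * H.1 * (star U * U) * H.1 * star U := by
          simp only [mul_assoc]
      _ = _ := by rw [h1]; simp only [mul_assoc, one_mul]
  unfold traceDet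
  rw [h3, h, Matrix.det_mul_right_comm, h2, one_mul, Matrix.trace_mul_comm, ← mul_assoc, h1,
    one_mul]

theorem traceDet_diag (l : Fin N → ℝ) : traceDet (diag l) = (∑ i, l i, ∏ i, (1 + l i ^ 2)) := by
  unfold traceDet
  congr 1
  · simp [diag, Matrix.trace]
  · have : (1 : Matrix (Fin N) (Fin N) ℂ) + (diag l).1 ^ 2
        = Matrix.diagonal fun i => ((1 + l i ^ 2 : ℝ) : ℂ) := by
      rw [diag, Matrix.diagonal_pow, ← Matrix.diagonal_one, Matrix.diagonal_add]
      congr 1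
      funext i
      simp
    rw [this, Matrix.det_diagonal, ← Complex.ofReal_prod, Complex.ofReal_re]

theorem map_traceDet_lebesgue (N : ℕ) :
    (lebesgue N).map traceDet
      = weylConst N • (((volume.restrict {l : Fin N → ℝ | StrictMono l}).withDensity fun l =>
          ENNReal.ofReal ((Matrix.vandermonde l).det ^ 2)).map fun l => traceDet (diag l)) := by
  have hD : Measurable fun l : Fin N → ℝ => ENNReal.ofReal ((Matrix.vandermonde l).det ^ 2) := by
    simp_rw [Matrix.det_vandermonde]
    fun_prop
  refine Measure.ext fun S hS => ?_
  have hSm : Measurable (S.indicator (1 : ℝ × ℝ → ENNReal)) := measurable_one.indicator hS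
  have hm : Measurable fun l : Fin N → ℝ => traceDet (diag l) :=
    measurable_traceDet.comp measurable_diag
  rw [← lintegral_indicator_one hS, lintegral_map hSm measurable_traceDet,
    lintegral_lebesgue_of_isClassFunction N (f := fun H => S.indicator 1 (traceDet H))
      (fun U hU H H' h => by simp only [traceDet_conj hU h]) (hSm.comp measurable_traceDet),
    Measure.smul_apply, smul_eq_mul, ← lintegral_indicator_one hS, lintegral_map hSm hm,
    lintegral_withDensity_eq_lintegral_mul _ hD (g := fun l => S.indicator 1 (traceDet (diag l)))
      (hSm.comp hm)]
  congr 1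
  refine lintegral_congr fun l => ?_
  rw [Pi.mul_apply, ← mul_assoc, ← ENNReal.ofReal_mul (abs_nonneg _), ← sq, sq_abs]

theorem integral_traceDet {k : ℝ × ℝ → ℂ} (hk : Measurable k) :
    ∫ H, k (traceDet H) ∂(lebesgue N) = (weylConst N).toReal *
      ∫ l in {l : Fin N → ℝ | StrictMono l},
        (((Matrix.vandermonde l).det ^ 2 : ℝ) : ℂ) * k (traceDet (diag l)) := by
  have hD : Measurable fun l : Fin N → ℝ => ENNReal.ofReal ((Matrix.vandermonde l).det ^ 2) := by
    simp_rw [Matrix.det_vandermonde]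
    fun_prop
  have hm : Measurable fun l : Fin N → ℝ => traceDet (diag l) :=
    measurable_traceDet.comp measurable_diag
  rw [← integral_map measurable_traceDet.aemeasurable hk.aestronglyMeasurable,
    map_traceDet_lebesgue, integral_smul_measure, integral_map hm.aemeasurable
      hk.aestronglyMeasurable, integral_withDensity_eq_integral_toReal_smul hD
      (Eventually.of_forall fun _ => ENNReal.ofReal_lt_top), Complex.real_smul]
  congr 2
  funext l
  rw [ENNReal.toReal_ofReal (sq_nonneg _), Complex.real_smul]

end Trace

/-- The moments `∫ x ^ k (1 + x ^ 2) ^ (-a) exp (i u x) dx`. -/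
def moment (a u : ℝ) (k : ℕ) : ℂ :=
  ∫ x : ℝ, (x : ℂ) ^ k * ((((1 + x ^ 2) ^ (-a) : ℝ) : ℂ) * Complex.exp (Complex.I * u * x))

/-- The Hankel determinant of size `n` of the moments. -/
def hankel (a : ℝ) (n : ℕ) (u : ℝ) : ℂ :=
  (Matrix.of fun i j : Fin n => moment a u ((i : ℕ) + j)).det

theorem integrable_pow_mul_weight {a : ℝ} {k : ℕ} (h : (k : ℝ) + 1 < 2 * a) :
    Integrable fun x : ℝ => x ^ k * (1 + x ^ 2) ^ (-a) := by
  have h1 : Integrable fun x : ℝ => (1 + ‖x‖ ^ 2) ^ (-(2 * a - k) / 2) :=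
    integrable_rpow_neg_one_add_norm_sq (by simp; linarith)
  refine h1.mono (by fun_prop) (Eventually.of_forall fun x => ?_)
  have hx : 0 < 1 + x ^ 2 := by positivity
  have h2 : |x| ^ k ≤ (1 + x ^ 2) ^ ((k : ℝ) / 2) := by
    have : |x| ≤ (1 + x ^ 2) ^ ((1 : ℝ) / 2) := by
      rw [← Real.sqrt_eq_rpow]
      exact Real.le_sqrt_of_sq_le (by rw [sq_abs]; linarith)
    calc |x| ^ k ≤ ((1 + x ^ 2) ^ ((1 : ℝ) / 2)) ^ k := by gcongr
      _ = _ := by rw [← Real.rpow_natCast, ← Real.rpow_mul hx.le]; congr 1; ring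
  rw [norm_mul, norm_pow, Real.norm_eq_abs, Real.norm_eq_abs, Real.norm_eq_abs, sq_abs,
    abs_of_pos (Real.rpow_pos_of_pos hx _), abs_of_pos (Real.rpow_pos_of_pos hx _)]
  calc |x| ^ k * (1 + x ^ 2) ^ (-a) ≤ (1 + x ^ 2) ^ ((k : ℝ) / 2) * (1 + x ^ 2) ^ (-a) := by gcongr
    _ = _ := by rw [← Real.rpow_add hx]; congr 1; ring

theorem integrable_moment {a : ℝ} {k : ℕ} (h : (k : ℝ) + 1 < 2 * a) (u : ℝ) :
    Integrable fun x : ℝ =>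
      (x : ℂ) ^ k * ((((1 + x ^ 2) ^ (-a) : ℝ) : ℂ) * Complex.exp (Complex.I * u * x)) := by
  refine (integrable_pow_mul_weight h).mono (by fun_prop) (Eventually.of_forall fun x => ?_)
  have hexp : ‖Complex.exp (Complex.I * u * x)‖ = 1 := by
    rw [mul_assoc, mul_comm, ← Complex.ofReal_mul]
    exact Complex.norm_exp_ofReal_mul_I _
  rw [norm_mul, norm_mul, norm_mul, hexp, mul_one, norm_pow, norm_pow, Complex.norm_real,
    Complex.norm_real]

theorem add_one_lt_two_mul {s : ℝ} (hs : -(1 / 2 : ℝ) < s) {n N : ℕ} (hn : n ≤ N) (i j : Fin n) :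
    (((i : ℕ) + (j : ℕ) : ℕ) : ℝ) + 1 < 2 * (s + N) := by
  have hi : ((i : ℕ) : ℝ) + 1 ≤ N := by exact_mod_cast i.2.trans_le hn
  have hj : ((j : ℕ) : ℝ) + 1 ≤ N := by exact_mod_cast j.2.trans_le hn
  push_cast
  linarith

/-- The unnormalised characteristic function of the trace. -/
theorem integral_exp_trace {s : ℝ} (hs : -(1 / 2 : ℝ) < s) (N : ℕ) (u : ℝ) :
    ∫ H : HermitianMatrix N, (weight s N H : ℂ) * Complex.exp (Complex.I * u * H.1.trace)
      ∂(lebesgue N) = (weylConst N).toReal * hankel (s + N) N u := by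
  let k : ℝ × ℝ → ℂ := fun p => ((p.2 ^ (-s - (N : ℝ)) : ℝ) : ℂ) * Complex.exp (Complex.I * u * p.1)
  have hk : Measurable k := by
    refine (Complex.measurable_ofReal.comp (measurable_snd.pow_const _)).mul ?_
    exact Complex.measurable_exp.comp ((Complex.measurable_ofReal.comp measurable_fst).const_mul _)
  have h1 : ∀ H : HermitianMatrix N,
      (weight s N H : ℂ) * Complex.exp (Complex.I * u * H.1.trace) = k (traceDet H) := by
    intro H
    have : ((H.1.trace.re : ℝ) : ℂ) = H.1.trace := by
      refine Complex.conj_eq_iff_re.1 ?_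
      have := congrArg Matrix.trace H.2
      rwa [Matrix.trace_conjTranspose] at this
    simp only [k, traceDet, weight, this]
  simp_rw [h1]
  rw [integral_traceDet hk]
  congr 1
  have h2 : ∀ l : Fin N → ℝ, k (traceDet (diag l)) = ∏ i,
      ((((1 + l i ^ 2) ^ (-(s + N)) : ℝ) : ℂ) * Complex.exp (Complex.I * u * l i)) := by
    intro l
    rw [prod_mul_distrib, ← Complex.exp_sum, ← Complex.ofReal_prod,
      Real.finsetProd_rpow _ _ fun i _ => by positivity]
    simp only [k, traceDet_diag]
    rw [neg_add', Complex.ofReal_sum, mul_sum]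
  simp_rw [h2]
  exact (andreief fun i j => integrable_moment (add_one_lt_two_mul hs le_rfl i j) u).2

/-- At `u = 0` the Hankel determinant is a Gram determinant of the weight `(1 + x ^ 2) ^ (-a)`. -/
theorem hankel_zero_pos {s : ℝ} (hs : -(1 / 2 : ℝ) < s) (N : ℕ) :
    ∃ r : ℝ, 0 < r ∧ hankel (s + N) N 0 = r := by
  let f : ℝ → ENNReal := fun x => ENNReal.ofReal ((1 + x ^ 2) ^ (-(s + N)))
  have hfm : Measurable f := by fun_prop
  have hpos : ∀ x : ℝ, 0 < (1 + x ^ 2) ^ (-(s + N)) := fun x => by positivity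
  let ν : Measure ℝ := volume.withDensity f
  have hν : ν ≠ 0 := by
    intro h
    have := (withDensity_eq_zero_iff hfm.aemeasurable).1 h
    obtain ⟨x, hx⟩ := this.exists
    exact (ENNReal.ofReal_pos.2 (hpos x)).ne' hx
  have hint : ∀ i j : Fin N, Integrable (fun x : ℝ => x ^ ((i : ℕ) + j)) ν := by
    intro i j
    rw [integrable_withDensity_iff_integrable_smul' hfm
      (Eventually.of_forall fun _ => ENNReal.ofReal_lt_top)]
    refine (integrable_pow_mul_weight (add_one_lt_two_mul hs le_rfl i j)).congr
      (Eventually.of_forall fun x => ?_)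
    simp only [f]
    rw [ENNReal.toReal_ofReal (hpos x).le, smul_eq_mul, mul_comm]
  refine ⟨_, det_hankel_pos ν hν hint, ?_⟩
  rw [hankel]
  refine Eq.trans ?_ (RingHom.map_det Complex.ofRealHom _).symm
  congr 1
  ext i j
  simp only [Matrix.of_apply, RingHom.mapMatrix_apply, Matrix.map_apply, moment]
  rw [integral_withDensity_eq_integral_toReal_smul hfm
      (Eventually.of_forall fun _ => ENNReal.ofReal_lt_top)]
  refine Eq.trans ?_ (integral_ofReal (𝕜 := ℂ))
  refine integral_congr_ae (Eventually.of_forall fun x => ?_)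
  simp only [f]
  rw [ENNReal.toReal_ofReal (hpos x).le]
  simp [mul_comm]

/-- The characteristic function of the trace is a normalised Hankel determinant. -/
theorem phi_eq_hankel {s : ℝ} (hs : -(1 / 2 : ℝ) < s) (N : ℕ) (t : ℝ) :
    phi s N t = hankel (s + N) N (t / (2 * N)) / hankel (s + N) N 0 := by
  have hwm' : Measurable fun H : HermitianMatrix N => weight s N H :=
    (measurable_snd.comp measurable_traceDet).pow_const _
  have hwm := hwm'.ennreal_ofReal
  have hw0 : ∀ H : HermitianMatrix N, 0 ≤ weight s N H := by
    intro H
    obtain ⟨U, hU, hUH⟩ := exists_unitary_diag_eigenvalues H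
    have h : (1 + H.1 ^ 2).det.re = ∏ i, (1 + H.2.eigenvalues i ^ 2) :=
      congrArg Prod.snd ((traceDet_conj hU hUH).trans (traceDet_diag _))
    rw [weight, h]
    exact Real.rpow_nonneg (prod_nonneg fun i _ => by positivity) _
  have hc : ((weylConst N).toReal : ℂ) ≠ 0 := by
    rw [Complex.ofReal_ne_zero, ENNReal.toReal_ne_zero]
    exact ⟨weylConst_ne_zero N, weylConst_ne_top N⟩
  have hZ : ((unnormalized s N Set.univ).toReal : ℂ)
      = (weylConst N).toReal * hankel (s + N) N 0 := by
    rw [← integral_exp_trace hs N 0, unnormalized, withDensity_apply _ MeasurableSet.univ,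
      Measure.restrict_univ, ← integral_eq_lintegral_of_nonneg_ae (Eventually.of_forall hw0)
        hwm'.aestronglyMeasurable]
    refine Eq.trans (integral_ofReal (𝕜 := ℂ)).symm ?_
    simp
  rw [phi, measure, integral_smul_measure, unnormalized,
    integral_withDensity_eq_integral_toReal_smul hwm
      (Eventually.of_forall fun _ => ENNReal.ofReal_lt_top), ← unnormalized, Complex.real_smul,
    ENNReal.toReal_inv, Complex.ofReal_inv, hZ]
  have h1 : ∀ H : HermitianMatrix N, (ENNReal.ofReal (weight s N H)).toReal •
      Complex.exp (Complex.I * t / (2 * N) * H.1.trace)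
      = (weight s N H : ℂ) * Complex.exp (Complex.I * ((t / (2 * N) : ℝ) : ℂ) * H.1.trace) := by
    intro H
    rw [ENNReal.toReal_ofReal (hw0 H), Complex.real_smul]
    congr 3
    push_cast
    ring
  simp_rw [h1]
  rw [integral_exp_trace hs, mul_inv, mul_mul_mul_comm, inv_mul_cancel₀ hc, one_mul,
    inv_mul_eq_div]

end

/-! ### Orthogonal polynomials of a moment functional -/

section

open Finset Polynomial

section OrthogonalPolynomials

/-- The linear functional on polynomials with moments `c`. -/
def functional (c : ℕ → ℝ) : ℝ[X] →ₗ[ℝ] ℝ :=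
  Polynomial.lsum fun k => c k • LinearMap.id

theorem functional_monomial (c : ℕ → ℝ) (k : ℕ) (x : ℝ) :
    functional c (monomial k x) = x * c k := by
  simp [functional, Polynomial.lsum_apply, mul_comm]

theorem functional_X_pow (c : ℕ → ℝ) (k : ℕ) : functional c (X ^ k) = c k := by
  rw [← monomial_one_right_eq_X_pow, functional_monomial, one_mul]

theorem functional_C_mul (c : ℕ → ℝ) (x : ℝ) (p : ℝ[X]) :
    functional c (C x * p) = x * functional c p := by
  rw [← smul_eq_C_mul, map_smul, smul_eq_mul]

/-- The Hankel matrix of size `n` of the moments `c`. -/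
def hankelMatrix (c : ℕ → ℝ) (n : ℕ) : Matrix (Fin n) (Fin n) ℝ :=
  Matrix.of fun i j => c ((i : ℕ) + j)

/-- The coefficients of the projection of `X ^ n` to the polynomials of degree less than `n`. -/
def orthCoeff (c : ℕ → ℝ) (n : ℕ) : Fin n → ℝ :=
  (hankelMatrix c n)⁻¹.mulVec fun i => c ((i : ℕ) + n)

/-- The monic orthogonal polynomial of degree `n` of the functional with moments `c`. -/
def orthPoly (c : ℕ → ℝ) (n : ℕ) : ℝ[X] :=
  X ^ n - ∑ j : Fin n, C (orthCoeff c n j) * X ^ (j : ℕ)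

theorem degree_sum_C_mul_X_pow_lt {n : ℕ} (x : Fin n → ℝ) :
    (∑ j : Fin n, C (x j) * X ^ (j : ℕ)).degree < ((n : ℕ) : WithBot ℕ) := by
  refine (degree_sum_le _ _).trans_lt ?_
  rw [Finset.sup_lt_iff (by simp)]
  intro j _
  exact (degree_C_mul_X_pow_le _ _).trans_lt (by exact_mod_cast j.2)

theorem coeff_sum_C_mul_X_pow {n : ℕ} (x : Fin n → ℝ) (k : Fin n) :
    (∑ j : Fin n, C (x j) * X ^ (j : ℕ)).coeff k = x k := by
  simp [Polynomial.finsetSum_coeff, Polynomial.coeff_C_mul, Polynomial.coeff_X_pow, Fin.val_inj]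

theorem eq_sum_C_mul_X_pow {n : ℕ} {q : ℝ[X]} (hq : q.degree < (n : ℕ)) :
    q = ∑ j : Fin n, C (q.coeff j) * X ^ (j : ℕ) := by
  ext k
  by_cases hk : k < n
  · exact (coeff_sum_C_mul_X_pow (fun j : Fin n => q.coeff j) ⟨k, hk⟩).symm
  · have hk' : ((n : ℕ) : WithBot ℕ) ≤ k := by exact_mod_cast not_lt.1 hk
    rw [coeff_eq_zero_of_degree_lt (hq.trans_le hk'), coeff_eq_zero_of_degree_lt
      ((degree_sum_C_mul_X_pow_lt _).trans_le hk')]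

variable {c : ℕ → ℝ} {n : ℕ}

theorem monic_orthPoly (c : ℕ → ℝ) (n : ℕ) : (orthPoly c n).Monic :=
  monic_X_pow_sub (degree_sum_C_mul_X_pow_lt _)

theorem degree_orthPoly (c : ℕ → ℝ) (n : ℕ) : (orthPoly c n).degree = (n : ℕ) := by
  rw [orthPoly, degree_sub_eq_left_of_degree_lt, degree_X_pow]
  rw [degree_X_pow]
  exact degree_sum_C_mul_X_pow_lt _

theorem coeff_orthPoly_self (c : ℕ → ℝ) (n : ℕ) : (orthPoly c n).coeff n = 1 := by
  have := (monic_orthPoly c n).coeff_natDegree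
  rwa [natDegree_eq_of_degree_eq_some (degree_orthPoly c n)] at this

theorem coeff_orthPoly_of_lt {k : ℕ} (h : n < k) : (orthPoly c n).coeff k = 0 :=
  coeff_eq_zero_of_degree_lt (by rw [degree_orthPoly]; exact_mod_cast h)

theorem coeff_orthPoly (c : ℕ → ℝ) (n : ℕ) (k : Fin n) :
    (orthPoly c n).coeff k = -orthCoeff c n k := by
  rw [orthPoly, coeff_sub, coeff_sum_C_mul_X_pow, coeff_X_pow, if_neg k.2.ne, zero_sub]

theorem functional_sum_mul_X_pow {m : ℕ} (x : Fin m → ℝ) (k : ℕ) :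
    functional c ((∑ j : Fin m, C (x j) * X ^ (j : ℕ)) * X ^ k)
      = ∑ j : Fin m, x j * c (j + k) := by
  rw [sum_mul, map_sum]
  refine sum_congr rfl fun j _ => ?_
  rw [mul_assoc, ← pow_add, functional_C_mul, functional_X_pow]

theorem functional_orthPoly_mul_X_pow (hD : (hankelMatrix c n).det ≠ 0) {k : ℕ} (hk : k < n) :
    functional c (orthPoly c n * X ^ k) = 0 := by
  have h : (hankelMatrix c n).mulVec (orthCoeff c n) = fun i : Fin n => c ((i : ℕ) + n) := by
    rw [orthCoeff, Matrix.mulVec_mulVec, Matrix.mul_nonsing_inv _ (isUnit_iff_ne_zero.2 hD),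
      Matrix.one_mulVec]
  have h' := congrFun h ⟨k, hk⟩
  simp only [Matrix.mulVec, dotProduct, hankelMatrix, Matrix.of_apply] at h'
  rw [orthPoly, sub_mul, map_sub, ← pow_add, functional_X_pow, functional_sum_mul_X_pow,
    sub_eq_zero, add_comm, ← h']
  exact sum_congr rfl fun j _ => by rw [mul_comm, add_comm]

theorem functional_orthPoly_mul (hD : (hankelMatrix c n).det ≠ 0) {q : ℝ[X]}
    (hq : q.degree < (n : ℕ)) : functional c (orthPoly c n * q) = 0 := by
  rw [eq_sum_C_mul_X_pow hq, mul_sum, map_sum]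
  refine sum_eq_zero fun j _ => ?_
  rw [mul_left_comm, functional_C_mul, functional_orthPoly_mul_X_pow hD j.2, mul_zero]

/-- The value of the functional on `P n * q` depends only on the coefficient of `X ^ n` in `q`, if
`q` has degree at most `n`. -/
theorem functional_orthPoly_mul_of_degree_le (hD : (hankelMatrix c n).det ≠ 0) {q : ℝ[X]}
    (hq : ∀ k, n < k → q.coeff k = 0) :
    functional c (orthPoly c n * q) = q.coeff n * functional c (orthPoly c n * orthPoly c n) := by
  have h : (q - C (q.coeff n) * orthPoly c n).degree < (n : ℕ) := by
    rw [degree_lt_iff_coeff_zero]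
    intro k hk
    rw [coeff_sub, coeff_C_mul]
    rcases hk.eq_or_lt with rfl | hk
    · rw [coeff_orthPoly_self, mul_one, sub_self]
    · rw [hq k hk, coeff_orthPoly_of_lt hk, mul_zero, sub_zero]
  have := functional_orthPoly_mul hD h
  rw [mul_sub, map_sub, mul_left_comm, functional_C_mul, sub_eq_zero] at this
  exact this

theorem eq_zero_of_orthogonal (hD : (hankelMatrix c n).det ≠ 0) {q : ℝ[X]}
    (hq : q.degree < (n : ℕ)) (h : ∀ k < n, functional c (q * X ^ k) = 0) : q = 0 := by
  have h1 : (hankelMatrix c n).mulVec (fun j => q.coeff j) = 0 := by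
    funext i
    have := h i i.2
    rw [eq_sum_C_mul_X_pow hq, functional_sum_mul_X_pow] at this
    simp only [Matrix.mulVec, dotProduct, hankelMatrix, Matrix.of_apply, Pi.zero_apply]
    rw [← this]
    exact sum_congr rfl fun j _ => by rw [mul_comm, add_comm]
  have h2 := Matrix.eq_zero_of_mulVec_eq_zero hD h1
  rw [eq_sum_C_mul_X_pow hq]
  exact sum_eq_zero fun j _ => by rw [congrFun h2 j]; simp

theorem functional_orthPoly_sq_ne_zero {k : ℕ} (hD : (hankelMatrix c k).det ≠ 0)
    (hD' : (hankelMatrix c (k + 1)).det ≠ 0) :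
    functional c (orthPoly c k * orthPoly c k) ≠ 0 := by
  intro h0
  refine (monic_orthPoly c k).ne_zero (eq_zero_of_orthogonal hD'
    (by rw [degree_orthPoly]; exact_mod_cast k.lt_succ_self) fun j hj => ?_)
  rw [functional_orthPoly_mul_of_degree_le hD, h0, mul_zero]
  intro i hi
  rw [coeff_X_pow, if_neg (by omega)]

/-- Consecutive orthogonal polynomials have no common zero. -/
theorem orthPoly_no_common_root {k : ℕ} (hD : (hankelMatrix c k).det ≠ 0)
    (hD' : (hankelMatrix c (k + 1)).det ≠ 0) (z : ℝ)
    (hP : (orthPoly c (k + 1)).eval z = 0) (hQ : (orthPoly c k).eval z = 0) : False := by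
  obtain ⟨p, hp⟩ := dvd_iff_isRoot.2 hP
  obtain ⟨q, hq⟩ := dvd_iff_isRoot.2 hQ
  have hdp : p.degree = (k : ℕ) := by
    have h := degree_orthPoly c (k + 1)
    have hp0 : p ≠ 0 := by
      rintro rfl
      exact (monic_orthPoly c (k + 1)).ne_zero (by rw [hp, mul_zero])
    rw [hp, degree_mul, degree_X_sub_C, degree_eq_natDegree hp0] at h
    rw [degree_eq_natDegree hp0]
    have h' : 1 + p.natDegree = k + 1 := by exact_mod_cast h
    have : p.natDegree = k := by omega
    rw [this]
  have hmp : p.Monic := by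
    have := monic_orthPoly c (k + 1)
    rw [hp] at this
    exact (monic_X_sub_C z).of_mul_monic_left this
  have hcp : p.coeff k = 1 := by
    have := hmp.coeff_natDegree
    rwa [natDegree_eq_of_degree_eq_some hdp] at this
  have h1 := functional_orthPoly_mul_of_degree_le hD (q := p) fun i hi =>
    coeff_eq_zero_of_degree_lt (by rw [hdp]; exact_mod_cast hi)
  have hdq : q.degree < ((k + 1 : ℕ) : WithBot ℕ) := by
    have h := degree_orthPoly c k
    rw [hq, degree_mul, degree_X_sub_C] at h
    refine lt_of_le_of_lt (b := ((k : ℕ) : WithBot ℕ)) ?_ (by exact_mod_cast k.lt_succ_self)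
    rw [← h]
    exact le_add_of_nonneg_left zero_le_one
  have h2 : orthPoly c k * p = orthPoly c (k + 1) * q := by
    rw [hp]
    conv_lhs => rw [hq]
    ring
  rw [h2, functional_orthPoly_mul hD' hdq, hcp, one_mul] at h1
  exact functional_orthPoly_sq_ne_zero hD hD' h1.symm

end OrthogonalPolynomials

end

/-! ### Structure relations of semiclassical orthogonal polynomials -/

section

open Finset Polynomial

section Structure
variable {c : ℕ → ℝ} {k : ℕ}

theorem functional_orthPoly_mul_X_pow_self {n : ℕ} (hD : (hankelMatrix c n).det ≠ 0) :
    functional c (orthPoly c n * X ^ n) = functional c (orthPoly c n * orthPoly c n) := by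
  rw [functional_orthPoly_mul_of_degree_le hD, coeff_X_pow_self, one_mul]
  intro i hi
  rw [coeff_X_pow, if_neg (by omega)]

theorem eq_zero_of_orthogonal' (hD' : (hankelMatrix c (k + 1)).det ≠ 0) {q : ℝ[X]}
    (hq : q.degree < ((k + 1 : ℕ) : WithBot ℕ)) (h : ∀ j < k, functional c (q * X ^ j) = 0)
    (h' : functional c (q * orthPoly c k) = 0) : q = 0 := by
  refine eq_zero_of_orthogonal hD' hq fun j hj => ?_
  rcases (Nat.lt_succ_iff.1 hj).lt_or_eq with hj | rfl
  · exact h j hj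
  · rw [orthPoly, mul_sub, map_sub, mul_sum, map_sum, sub_eq_zero] at h'
    rw [h']
    refine sum_eq_zero fun i _ => ?_
    rw [mul_left_comm, functional_C_mul, h i i.2, mul_zero]

theorem coeff_X_mul_derivative' (p : ℝ[X]) (m : ℕ) :
    (X * derivative p).coeff m = m * p.coeff m := by
  cases m with
  | zero => simp
  | succ m => rw [coeff_X_mul, coeff_derivative]; push_cast; ring

/-- The recurrence coefficient `L (X Q ^ 2) / L (Q ^ 2)` is the difference of two subleading
coefficients. -/
theorem functional_X_mul_sq (hD : (hankelMatrix c k).det ≠ 0)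
    (hD' : (hankelMatrix c (k + 1)).det ≠ 0) :
    functional c (X * orthPoly c k * orthPoly c k)
      = ((X * orthPoly c k).coeff k + orthCoeff c (k + 1) (Fin.last k)) *
        functional c (orthPoly c k * orthPoly c k) := by
  have h := functional_orthPoly_mul_of_degree_le hD (q := X * orthPoly c k - orthPoly c (k + 1)) ?_
  · have h0 := functional_orthPoly_mul hD' (q := orthPoly c k)
      (by rw [degree_orthPoly]; exact_mod_cast k.lt_succ_self)
    have hc := coeff_orthPoly c (k + 1) (Fin.last k)
    rw [Fin.val_last] at hc
    rw [mul_sub, map_sub, mul_comm _ (orthPoly c (k + 1)), h0, sub_zero, coeff_sub, hc,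
      sub_neg_eq_add] at h
    rw [mul_comm (X * _), h]
  · intro i hi
    obtain ⟨i, rfl⟩ : ∃ j, i = j + 1 := ⟨i - 1, by omega⟩
    rw [coeff_sub, coeff_X_mul]
    rcases (Nat.lt_succ_iff.1 hi).eq_or_lt with rfl | hi
    · rw [coeff_orthPoly_self, coeff_orthPoly_self, sub_self]
    · rw [coeff_orthPoly_of_lt hi, coeff_orthPoly_of_lt (by omega), sub_self]

theorem functional_X_mul_mul (hD' : (hankelMatrix c (k + 1)).det ≠ 0) :
    functional c (X * orthPoly c (k + 1) * orthPoly c k)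
      = functional c (orthPoly c (k + 1) * orthPoly c (k + 1)) := by
  have h := functional_orthPoly_mul_of_degree_le hD' (q := X * orthPoly c k) ?_
  · rw [coeff_X_mul, coeff_orthPoly_self, one_mul] at h
    rw [← h]
    congr 1
    ring
  · intro i hi
    obtain ⟨i, rfl⟩ : ∃ j, i = j + 1 := ⟨i - 1, by omega⟩
    rw [coeff_X_mul, coeff_orthPoly_of_lt (by omega)]

theorem functional_X_sq_mul_mul (hD' : (hankelMatrix c (k + 1)).det ≠ 0) :
    functional c (X ^ 2 * orthPoly c (k + 1) * orthPoly c k)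
      = functional c (X * orthPoly c (k + 1) * orthPoly c (k + 1)) +
        ((X * orthPoly c k).coeff k + orthCoeff c (k + 1) (Fin.last k)) *
        functional c (orthPoly c (k + 1) * orthPoly c (k + 1)) := by
  set P := orthPoly c (k + 1) with hP
  set Q := orthPoly c k with hQ
  set x := (X * Q).coeff k + orthCoeff c (k + 1) (Fin.last k) with hx
  have hc := coeff_orthPoly c (k + 1) (Fin.last k)
  rw [Fin.val_last] at hc
  have hr : (X * (X * Q - P - C x * Q)).degree < ((k + 1 : ℕ) : WithBot ℕ) := by
    rw [degree_lt_iff_coeff_zero]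
    intro i hi
    obtain ⟨i, rfl⟩ : ∃ j, i = j + 1 := ⟨i - 1, by omega⟩
    rw [coeff_X_mul, coeff_sub, coeff_sub, coeff_C_mul]
    rcases (Nat.le_of_succ_le_succ hi).eq_or_lt with rfl | hi
    · rw [hQ, hP, hc, coeff_orthPoly_self, hx]
      ring
    · obtain ⟨i, rfl⟩ : ∃ j, i = j + 1 := ⟨i - 1, by omega⟩
      rw [coeff_X_mul, hQ, hP, coeff_orthPoly_of_lt hi]
      rcases (Nat.le_of_lt_succ hi).eq_or_lt with rfl | hi
      · rw [coeff_orthPoly_self, coeff_orthPoly_self]; ring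
      · rw [coeff_orthPoly_of_lt hi, coeff_orthPoly_of_lt (by omega)]; ring
  have h := functional_orthPoly_mul hD' hr
  have e : orthPoly c (k + 1) * (X * (X * Q - P - C x * Q))
      = X ^ 2 * P * Q - X * P * P - C x * (X * P * Q) := by rw [← hP]; ring
  rw [e, map_sub, map_sub, functional_C_mul, hP, hQ, functional_X_mul_mul hD'] at h
  linear_combination h

theorem functional_mul_X_sq_derivative (hD' : (hankelMatrix c (k + 1)).det ≠ 0) :
    functional c (orthPoly c (k + 1) * (X * (X * derivative (orthPoly c k))))
      = k * functional c (orthPoly c (k + 1) * orthPoly c (k + 1)) := by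
  rw [functional_orthPoly_mul_of_degree_le hD', coeff_X_mul, coeff_X_mul_derivative',
    coeff_orthPoly_self, mul_one]
  intro i hi
  obtain ⟨i, rfl⟩ : ∃ j, i = j + 1 := ⟨i - 1, by omega⟩
  rw [coeff_X_mul, coeff_X_mul_derivative', coeff_orthPoly_of_lt (by omega), mul_zero]

theorem functional_mul_X_sq_derivative_self (hD : (hankelMatrix c k).det ≠ 0) :
    functional c (orthPoly c k * (X * (X * derivative (orthPoly c k))))
      = k * functional c (X * orthPoly c k * orthPoly c k) -
        (X * orthPoly c k).coeff k * functional c (orthPoly c k * orthPoly c k) := by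
  have h := functional_orthPoly_mul_of_degree_le hD
    (q := X * (X * derivative (orthPoly c k)) - C (k : ℝ) * (X * orthPoly c k)) ?_
  · have e : (X * (X * derivative (orthPoly c k)) - C (k : ℝ) * (X * orthPoly c k)).coeff k
        = -(X * orthPoly c k).coeff k := by
      rw [coeff_sub, coeff_C_mul]
      cases k with
      | zero => simp
      | succ k =>
        rw [coeff_X_mul, coeff_X_mul_derivative', coeff_X_mul]
        push_cast
        ring
    rw [e, mul_sub, map_sub, mul_left_comm _ (C (k : ℝ)), functional_C_mul,
      mul_comm (orthPoly c k) (X * orthPoly c k)] at h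
    linear_combination h
  · intro i hi
    obtain ⟨i, rfl⟩ : ∃ j, i = j + 1 := ⟨i - 1, by omega⟩
    rw [coeff_sub, coeff_C_mul, coeff_X_mul, coeff_X_mul, coeff_X_mul_derivative']
    rcases (Nat.le_of_lt_succ hi).eq_or_lt with rfl | hi
    · ring
    · rw [coeff_orthPoly_of_lt hi]; ring

/-- The integration by parts identity of a functional with the weight
`exp (u z) (z ^ 2 - 1) ^ (-a)`. -/
def IsPearson (a u : ℝ) (c : ℕ → ℝ) : Prop :=
  ∀ q : ℝ[X], functional c (C u * ((X ^ 2 - 1) * q) + C (2 * (1 - a)) * (X * q)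
    + (X ^ 2 - 1) * derivative q) = 0

/-- The facts about two consecutive monic orthogonal polynomials `P` of degree `k + 1` and `Q` of
degree `k` used to derive their differential equations: `h = L (Q ^ 2)`, `β * h = L (P ^ 2)`,
`Y * h = L (X P ^ 2)`, `A * h = L (X Q ^ 2)`, and `-S` is the subleading coefficient of `P`. -/
structure IsOrthPair (L : ℝ[X] →ₗ[ℝ] ℝ) (k : ℕ) (P Q : ℝ[X]) (S β Y A h : ℝ) : Prop where
  P_lt : ∀ i, k + 1 < i → P.coeff i = 0
  P_self : P.coeff (k + 1) = 1
  P_pred : P.coeff k = -S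
  Q_lt : ∀ i, k < i → Q.coeff i = 0
  Q_self : Q.coeff k = 1
  X_Q : (X * Q).coeff k = A - S
  P_pow : ∀ j < k + 1, L (P * X ^ j) = 0
  P_pow_self : L (P * X ^ (k + 1)) = β * h
  Q_pow : ∀ j < k, L (Q * X ^ j) = 0
  Q_pow_self : L (Q * X ^ k) = h
  P_Q : L (P * Q) = 0
  P_derivative_Q : L (P * derivative Q) = 0
  Q_derivative_Q : L (Q * derivative Q) = 0
  Q_Q : L (Q * Q) = h
  X_P_Q : L (X * P * Q) = β * h
  X_Q_Q : L (X * Q * Q) = A * h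
  X_sq_P_Q : L (X ^ 2 * P * Q) = (Y + A * β) * h
  P_X_sq_derivative_Q : L (P * (X * (X * derivative Q))) = k * β * h
  Q_X_sq_derivative_Q : L (Q * (X * (X * derivative Q))) = (k * A - (A - S)) * h
  eq_zero : ∀ q : ℝ[X], (∀ i, k < i → q.coeff i = 0) → (∀ j < k, L (q * X ^ j) = 0) →
    L (q * Q) = 0 → q = 0

variable {a u β Y A S h : ℝ}

theorem isOrthPair_orthPoly (hD : (hankelMatrix c k).det ≠ 0)
    (hD' : (hankelMatrix c (k + 1)).det ≠ 0)
    (hS : orthCoeff c (k + 1) (Fin.last k) = S)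
    (hh : functional c (orthPoly c k * orthPoly c k) = h)
    (hβ : functional c (orthPoly c (k + 1) * orthPoly c (k + 1)) = β * h)
    (hY : functional c (X * orthPoly c (k + 1) * orthPoly c (k + 1)) = Y * h)
    (hA : functional c (X * orthPoly c k * orthPoly c k) = A * h) :
    IsOrthPair (functional c) k (orthPoly c (k + 1)) (orthPoly c k) S β Y A h := by
  have hQ0 := functional_orthPoly_sq_ne_zero hD hD'
  rw [hh] at hQ0
  have hXA := functional_X_mul_sq hD hD'
  have hXX := functional_X_sq_mul_mul hD'
  have hQD := functional_mul_X_sq_derivative_self hD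
  rw [hS, hA, hh] at hXA
  have hAκ : (X * orthPoly c k).coeff k = A - S := by
    have := mul_right_cancel₀ hQ0 hXA
    linarith
  rw [hS, hAκ, hY, hβ] at hXX
  rw [hAκ, hA, hh] at hQD
  refine
  { P_lt := fun i hi => coeff_orthPoly_of_lt hi
    P_self := coeff_orthPoly_self _ _
    P_pred := hS ▸ coeff_orthPoly c (k + 1) (Fin.last k)
    Q_lt := fun i hi => coeff_orthPoly_of_lt hi
    Q_self := coeff_orthPoly_self _ _
    X_Q := hAκ
    P_pow := fun j hj => functional_orthPoly_mul_X_pow hD' hj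
    P_pow_self := (functional_orthPoly_mul_X_pow_self hD').trans hβ
    Q_pow := fun j hj => functional_orthPoly_mul_X_pow hD hj
    Q_pow_self := (functional_orthPoly_mul_X_pow_self hD).trans hh
    P_Q := functional_orthPoly_mul hD'
      (by rw [degree_orthPoly]; exact_mod_cast k.lt_succ_self)
    P_derivative_Q := functional_orthPoly_mul hD' (lt_of_le_of_lt degree_derivative_le
      (by rw [degree_orthPoly]; exact_mod_cast k.lt_succ_self))
    Q_derivative_Q := functional_orthPoly_mul hD (lt_of_lt_of_eq
      (degree_derivative_lt (monic_orthPoly c k).ne_zero) (degree_orthPoly c k))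
    Q_Q := hh
    X_P_Q := (functional_X_mul_mul hD').trans hβ
    X_Q_Q := hA
    X_sq_P_Q := by rw [hXX]; ring
    P_X_sq_derivative_Q := by rw [functional_mul_X_sq_derivative hD', hβ]; ring
    Q_X_sq_derivative_Q := by rw [hQD]; ring
    eq_zero := fun q hq h1 h2 => eq_zero_of_orthogonal' hD'
      ((degree_lt_iff_coeff_zero _ _).2 fun i hi => hq i hi) h1 h2 }

variable {P Q : ℝ[X]}

/-- The derivative of the polynomial of degree `k + 1` in terms of the pair. -/
theorem IsOrthPair.structure_relation (H : IsOrthPair (functional c) k P Q S β Y A h)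
    (hc : IsPearson a u c) :
    (X ^ 2 - 1) * derivative P = (C (k + 1 : ℝ) * X + C (S + u * β)) * P
        + (C (-(u * β)) * X + C (-(u * Y) + (2 * a - 2 * k - 3) * β)) * Q := by
  set d := -(u * Y) + (2 * a - 2 * k - 3) * β with hd
  rw [← sub_eq_zero]
  generalize hE : (X ^ 2 - 1) * derivative P - ((C (k + 1 : ℝ) * X + C (S + u * β)) * P
    + (C (-(u * β)) * X + C d) * Q) = E
  have key : ∀ q, functional c (E * q) = -(functional c (P * (C u * ((X ^ 2 - 1) * q)
      + C (2 * (1 - a)) * (X * q) + (X ^ 2 - 1) * derivative q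
      + (C (k + 1 : ℝ) * X + C (S + u * β)) * q))
      + functional c (Q * ((C (-(u * β)) * X + C d) * q))) := by
    intro q
    have h := hc (P * q)
    rw [eq_neg_iff_add_eq_zero, ← LinearMap.map_add, ← LinearMap.map_add, ← h, ← hE, derivative_mul]
    congr 1
    ring
  -- the difference `E` of the two sides has degree at most `k` and is orthogonal to `Q` and to all
  -- lower powers
  refine H.eq_zero _ (fun i hi => ?_) (fun j hj => ?_) ?_
  · obtain ⟨i, rfl⟩ : ∃ j, i = j + 1 := ⟨i - 1, by omega⟩
    have hE' : E = X * (X * derivative P) - derivative P - C (k + 1 : ℝ) * (X * P)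
        - C (S + u * β) * P + C (u * β) * (X * Q) - C d * Q := by
      rw [← hE, C_neg]; ring
    rw [hE']
    simp only [coeff_sub, coeff_add, coeff_C_mul, coeff_X_mul, coeff_X_mul_derivative',
      coeff_derivative]
    rw [H.Q_lt (i + 1) (by omega), H.P_lt (i + 1 + 1) (by omega)]
    rcases (Nat.le_of_succ_le_succ hi).eq_or_lt with rfl | hi
    · rw [H.P_pred, H.P_self, H.Q_self]
      ring
    · rw [H.Q_lt i hi, H.P_lt (i + 1) (by omega)]
      rcases (Nat.succ_le_of_lt hi).eq_or_lt with rfl | hi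
      · push_cast
        ring
      · rw [H.P_lt i hi]
        ring
  · rw [key, neg_eq_zero]
    have e2 : Q * ((C (-(u * β)) * X + C d) * X ^ j)
        = C (-(u * β)) * (Q * X ^ (j + 1)) + C d * (Q * X ^ j) := by ring
    have e1 : functional c (P * (C u * ((X ^ 2 - 1) * X ^ j)
        + C (2 * (1 - a)) * (X * X ^ j) + (X ^ 2 - 1) * derivative (X ^ j)
        + (C (k + 1 : ℝ) * X + C (S + u * β)) * X ^ j)) = u * functional c (P * X ^ (j + 2)) := by
      cases j with
      | zero =>
        have : P * (C u * ((X ^ 2 - 1) * X ^ 0)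
          + C (2 * (1 - a)) * (X * X ^ 0) + (X ^ 2 - 1) * derivative (X ^ 0)
          + (C (k + 1 : ℝ) * X + C (S + u * β)) * X ^ 0)
          = C u * (P * X ^ (0 + 2)) + C (2 * (1 - a)) * (P * X ^ 1) + C (k + 1 : ℝ) * (P * X ^ 1)
            + C (S + u * β) * (P * X ^ 0) - C u * (P * X ^ 0) := by
          rw [pow_zero, derivative_one]; ring
        rw [this, LinearMap.map_sub, LinearMap.map_add, LinearMap.map_add, LinearMap.map_add]
        simp only [functional_C_mul]
        rw [H.P_pow 1 (by omega), H.P_pow 0 (by omega)]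
        ring
      | succ j =>
        have : P * (C u * ((X ^ 2 - 1) * X ^ (j + 1))
          + C (2 * (1 - a)) * (X * X ^ (j + 1)) + (X ^ 2 - 1) * derivative (X ^ (j + 1))
          + (C (k + 1 : ℝ) * X + C (S + u * β)) * X ^ (j + 1))
          = C u * (P * X ^ (j + 1 + 2)) + C (2 * (1 - a)) * (P * X ^ (j + 2))
            + C (k + 1 : ℝ) * (P * X ^ (j + 2)) + C ((j + 1 : ℕ) : ℝ) * (P * X ^ (j + 2))
            + C (S + u * β) * (P * X ^ (j + 1)) - C u * (P * X ^ (j + 1))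
            - C ((j + 1 : ℕ) : ℝ) * (P * X ^ j) := by
          rw [derivative_X_pow, Nat.add_sub_cancel]; ring
        rw [this, LinearMap.map_sub, LinearMap.map_sub, LinearMap.map_add, LinearMap.map_add,
          LinearMap.map_add, LinearMap.map_add]
        simp only [functional_C_mul]
        rw [H.P_pow (j + 2) (by omega), H.P_pow (j + 1) (by omega), H.P_pow j (by omega)]
        ring
    rw [e1, e2, LinearMap.map_add, functional_C_mul, functional_C_mul, H.Q_pow j hj]
    rcases (Nat.succ_le_of_lt hj).eq_or_lt with h | h
    · have h1 : j + 2 = k + 1 := by omega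
      have h2 : j + 1 = k := by omega
      rw [h1, h2, H.P_pow_self, H.Q_pow_self]
      ring
    · rw [H.P_pow (j + 2) (by omega), H.Q_pow (j + 1) (by omega)]
      ring
  · rw [key, neg_eq_zero]
    have e1 : P * (C u * ((X ^ 2 - 1) * Q)
        + C (2 * (1 - a)) * (X * Q) + (X ^ 2 - 1) * derivative Q
        + (C (k + 1 : ℝ) * X + C (S + u * β)) * Q)
        = C u * (X ^ 2 * P * Q) + C (2 * (1 - a)) * (X * P * Q) + C (k + 1 : ℝ) * (X * P * Q)
          + P * (X * (X * derivative Q)) + C (S + u * β - u) * (P * Q) - P * derivative Q := by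
      rw [C_sub]; ring
    have e2 : Q * ((C (-(u * β)) * X + C d) * Q) = C (-(u * β)) * (X * Q * Q) + C d * (Q * Q) := by
      ring
    rw [e1, e2, LinearMap.map_sub, LinearMap.map_add, LinearMap.map_add, LinearMap.map_add,
          LinearMap.map_add, LinearMap.map_add]
    simp only [functional_C_mul]
    rw [H.X_sq_P_Q, H.X_P_Q, H.P_X_sq_derivative_Q, H.P_Q, H.P_derivative_Q, H.X_Q_Q, H.Q_Q, hd]
    ring

/-- The derivative of the polynomial of degree `k` in terms of the pair. -/
theorem IsOrthPair.structure_relation_pred (H : IsOrthPair (functional c) k P Q S β Y A h)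
    (hc : IsPearson a u c) :
    (X ^ 2 - 1) * derivative Q = (C u * X + C (u * A + 2 * k + 1 - 2 * a)) * P
        + (C (-u) * X ^ 2 + C (2 * a - k - 1) * X + C (u - S - u * β)) * Q := by
  set g := u * A + 2 * k + 1 - 2 * a with hg
  rw [← sub_eq_zero]
  generalize hE : (X ^ 2 - 1) * derivative Q - ((C u * X + C g) * P
    + (C (-u) * X ^ 2 + C (2 * a - k - 1) * X + C (u - S - u * β)) * Q) = E
  have key : ∀ q, functional c (E * q) = -(functional c (Q * (C (1 - k : ℝ) * (X * q)
      + (X ^ 2 - 1) * derivative q - C (S + u * β) * q))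
      + functional c (P * ((C u * X + C g) * q))) := by
    intro q
    have h := hc (Q * q)
    rw [eq_neg_iff_add_eq_zero, ← LinearMap.map_add, ← LinearMap.map_add, ← h, ← hE, derivative_mul]
    congr 1
    simp only [C_sub, C_add, C_mul, C_neg, C_1]
    have : (C 2 : ℝ[X]) = 2 := rfl
    rw [this]
    ring
  -- the difference `E` of the two sides has degree at most `k` and is orthogonal to `Q` and to all
  -- lower powers
  refine H.eq_zero _ (fun i hi => ?_) (fun j hj => ?_) ?_
  · obtain ⟨i, rfl⟩ : ∃ j, i = j + 1 := ⟨i - 1, by omega⟩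
    have hE' : E = X * (X * derivative Q) - derivative Q - C u * (X * P) - C g * P
        + C u * (X * (X * Q)) - C (2 * a - k - 1) * (X * Q) - C (u - S - u * β) * Q := by
      rw [← hE, C_neg]; ring
    rw [hE']
    simp only [coeff_sub, coeff_add, coeff_C_mul, coeff_X_mul _ i, coeff_X_mul_derivative',
      coeff_derivative]
    rw [H.Q_lt (i + 1) (by omega), H.Q_lt (i + 1 + 1) (by omega)]
    rcases (Nat.le_of_succ_le_succ hi).eq_or_lt with rfl | hi
    · rw [H.P_pred, H.P_self, H.Q_self, H.X_Q, hg]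
      ring
    · obtain ⟨i, rfl⟩ : ∃ j, i = j + 1 := ⟨i - 1, by omega⟩
      rw [H.Q_lt (i + 1) hi, H.P_lt (i + 1 + 1) (by omega), coeff_X_mul]
      rcases (Nat.le_of_lt_succ hi).eq_or_lt with rfl | hi
      · rw [H.P_self, H.Q_self]
        ring
      · rw [H.P_lt (i + 1) (by omega), H.Q_lt i hi]
        ring
  · rw [key, neg_eq_zero]
    have e2 : P * ((C u * X + C g) * X ^ j)
        = C u * (P * X ^ (j + 1)) + C g * (P * X ^ j) := by ring
    have e1 : functional c (Q * (C (1 - k : ℝ) * (X * X ^ j)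
        + (X ^ 2 - 1) * derivative (X ^ j) - C (S + u * β) * X ^ j))
        = (j + 1 - k) * functional c (Q * X ^ (j + 1)) := by
      cases j with
      | zero =>
        have : Q * (C (1 - k : ℝ) * (X * X ^ 0)
          + (X ^ 2 - 1) * derivative (X ^ 0) - C (S + u * β) * X ^ 0)
          = C (1 - k : ℝ) * (Q * X ^ (0 + 1)) - C (S + u * β) * (Q * X ^ 0) := by
          rw [pow_zero, derivative_one]; ring
        rw [this, LinearMap.map_sub]
        simp only [functional_C_mul]
        rw [H.Q_pow 0 hj]
        push_cast
        ring
      | succ j =>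
        have : Q * (C (1 - k : ℝ) * (X * X ^ (j + 1))
          + (X ^ 2 - 1) * derivative (X ^ (j + 1)) - C (S + u * β) * X ^ (j + 1))
          = C (1 - k : ℝ) * (Q * X ^ (j + 1 + 1)) + C ((j + 1 : ℕ) : ℝ) * (Q * X ^ (j + 1 + 1))
            - C (S + u * β) * (Q * X ^ (j + 1)) - C ((j + 1 : ℕ) : ℝ) * (Q * X ^ j) := by
          rw [derivative_X_pow, Nat.add_sub_cancel]; ring
        rw [this, LinearMap.map_sub, LinearMap.map_sub, LinearMap.map_add]
        simp only [functional_C_mul]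
        rw [H.Q_pow (j + 1) hj, H.Q_pow j (by omega)]
        push_cast
        ring
    rw [e1, e2, LinearMap.map_add, functional_C_mul, functional_C_mul, H.P_pow (j + 1) (by omega),
      H.P_pow j (by omega)]
    rcases (Nat.succ_le_of_lt hj).eq_or_lt with h | h
    · rw [← h]
      push_cast
      ring
    · rw [H.Q_pow (j + 1) (by omega)]
      ring
  · rw [key, neg_eq_zero]
    have e1 : Q * (C (1 - k : ℝ) * (X * Q) + (X ^ 2 - 1) * derivative Q - C (S + u * β) * Q)
        = C (1 - k : ℝ) * (X * Q * Q) + Q * (X * (X * derivative Q)) - Q * derivative Q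
          - C (S + u * β) * (Q * Q) := by
      ring
    have e2 : P * ((C u * X + C g) * Q) = C u * (X * P * Q) + C g * (P * Q) := by
      ring
    rw [e1, e2, LinearMap.map_sub, LinearMap.map_sub, LinearMap.map_add, LinearMap.map_add]
    simp only [functional_C_mul]
    rw [H.X_Q_Q, H.Q_X_sq_derivative_Q, H.Q_derivative_Q, H.Q_Q, H.X_P_Q, H.P_Q]
    ring

/-- The algebraic relation between `S`, its first two derivatives `β` and `Y - β * A`, and `u`. It
expresses that the matrix of the differential system of the pair is singular at the points `1`
and `-1`. -/
theorem IsOrthPair.quadratic_relation (H : IsOrthPair (functional c) k P Q S β Y A h)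
    (hc : IsPearson a u c) (hroot : ∀ z : ℝ, P.eval z = 0 → Q.eval z = 0 → False) :
    (u * (u * (Y - β * A) + 2 * β)) ^ 2 = 4 * (a - (k + 1)) ^ 2 * (S + u * β) ^ 2
      + 4 * (u ^ 2 * β) * ((k + 1) * (2 * a - (k + 1)) - (S + u * β) ^ 2 + u ^ 2 * β) := by
  have h1 := H.structure_relation hc
  have h2 := H.structure_relation_pred hc
  -- at `z = ± 1` the system degenerates to two linear equations for the nonzero vector `(P z, Q z)`
  have hdet : ∀ z : ℝ, z ^ 2 = 1 →
      ((k + 1) * z + (S + u * β)) * (-u * z ^ 2 + (2 * a - k - 1) * z + (u - S - u * β))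
      = (-(u * β) * z + (-(u * Y) + (2 * a - 2 * k - 3) * β)) *
        (u * z + (u * A + 2 * k + 1 - 2 * a)) := by
    intro z hz
    have e1 := congrArg (eval z) h1
    have e2 := congrArg (eval z) h2
    simp only [eval_mul, eval_sub, eval_add, eval_pow, eval_X, eval_one, eval_C, hz, sub_self,
      zero_mul] at e1 e2
    rw [← sub_eq_zero]
    by_contra hne
    refine hroot z ?_ ?_
    · refine (mul_eq_zero.1 ?_).resolve_left hne
      rw [hz]
      linear_combination (-(-(u * β) * z + (-(u * Y) + (2 * a - 2 * k - 3) * β))) * e2 * (-1)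
        - (-u * 1 + (2 * a - k - 1) * z + (u - S - u * β)) * e1
    · refine (mul_eq_zero.1 ?_).resolve_left hne
      rw [hz]
      linear_combination (u * z + (u * A + 2 * k + 1 - 2 * a)) * e1
        - ((k + 1) * z + (S + u * β)) * e2
  have d1 := hdet 1 (by norm_num)
  have d2 := hdet (-1) (by norm_num)
  have e1 : (-(u * Y) + (2 * a - 2 * k - 3) * β) * (u * A + 2 * k + 1 - 2 * a)
      = (k + 1) * (2 * a - (k + 1)) - (S + u * β) ^ 2 + u ^ 2 * β := by
    linear_combination (-1 / 2) * (d1 + d2)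
  have e2 : u * ((-(u * Y) + (2 * a - 2 * k - 3) * β) - β * (u * A + 2 * k + 1 - 2 * a))
      = 2 * (a - (k + 1)) * (S + u * β) := by
    linear_combination (-1 / 2) * (d1 - d2)
  linear_combination (u * ((-(u * Y) + (2 * a - 2 * k - 3) * β)
    - β * (u * A + 2 * k + 1 - 2 * a)) + 2 * (a - (k + 1)) * (S + u * β)) * e2
    + 4 * (u ^ 2 * β) * e1

end Structure

end

/-! ### Dependence on the parameter and the `σ`-form -/

section

open Finset Polynomial

section Flow

theorem hasDerivAt_det {n : ℕ} {M : ℝ → Matrix (Fin n) (Fin n) ℝ} {M' : Matrix (Fin n) (Fin n) ℝ}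
    {u : ℝ} (h : ∀ i j, HasDerivAt (fun u => M u i j) (M' i j) u) :
    HasDerivAt (fun u => (M u).det) (∑ j, ((M u).updateCol j fun i => M' i j).det) u := by
  simp_rw [Matrix.det_apply']
  have h1 : HasDerivAt (fun u => ∑ σ : Equiv.Perm (Fin n), ((Equiv.Perm.sign σ : ℤ) : ℝ) *
      ∏ i, M u (σ i) i) (∑ σ : Equiv.Perm (Fin n), ((Equiv.Perm.sign σ : ℤ) : ℝ) *
      ∑ j, (∏ i ∈ univ.erase j, M u (σ i) i) • M' (σ j) j) u :=
    HasDerivAt.fun_sum fun σ _ => (HasDerivAt.fun_finsetProd fun i _ => h (σ i) i).const_mul _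
  refine h1.congr_deriv ?_
  rw [sum_comm]
  refine sum_congr rfl fun σ _ => ?_
  rw [mul_sum]
  refine sum_congr rfl fun j _ => ?_
  rw [← mul_prod_erase univ _ (mem_univ j), Matrix.updateCol_self, smul_eq_mul, mul_comm (M' _ _)]
  congr 2
  refine prod_congr rfl fun i hi => ?_
  rw [Matrix.updateCol_ne (mem_erase.1 hi).1]

variable {c : ℕ → ℝ → ℝ} {n k : ℕ} {u : ℝ}

theorem det_mul_orthCoeff {c : ℕ → ℝ} (hD : (hankelMatrix c n).det ≠ 0) (j : Fin n) :
    (hankelMatrix c n).det * orthCoeff c n j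
      = ((hankelMatrix c n).updateCol j fun i => c ((i : ℕ) + n)).det := by
  have h := Matrix.det_smul_inv_mulVec_eq_cramer (hankelMatrix c n) (fun i => c ((i : ℕ) + n))
    (isUnit_iff_ne_zero.2 hD)
  rw [← Matrix.cramer_apply, ← h]
  rfl

/-- The logarithmic derivative of a Hankel determinant of moments evolving by `c k' = c (k + 1)` is
minus the subleading coefficient of the orthogonal polynomial. -/
theorem hasDerivAt_det_hankelMatrix (hc : ∀ k, HasDerivAt (c k) (c (k + 1) u) u)
    (hD : (hankelMatrix (fun k => c k u) (n + 1)).det ≠ 0) :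
    HasDerivAt (fun u => (hankelMatrix (fun k => c k u) (n + 1)).det)
      ((hankelMatrix (fun k => c k u) (n + 1)).det *
        orthCoeff (fun k => c k u) (n + 1) (Fin.last n)) u := by
  refine (hasDerivAt_det (M := fun u => hankelMatrix (fun k => c k u) (n + 1))
    (M' := Matrix.of fun i j : Fin (n + 1) => c ((i : ℕ) + j + 1) u)
    fun i j => hc _).congr_deriv ?_
  rw [det_mul_orthCoeff hD, Finset.sum_eq_single (Fin.last n)]
  · simp [add_assoc]
  · intro j _ hj
    obtain ⟨j, rfl⟩ := Fin.exists_castSucc_eq.2 hj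
    refine Matrix.det_zero_of_column_eq (i := j.castSucc) (j := j.succ)
      (Fin.castSucc_lt_succ).ne fun i => ?_
    rw [Matrix.updateCol_self, Matrix.updateCol_ne (Fin.castSucc_lt_succ).ne']
    simp [hankelMatrix, add_assoc]
  · simp

theorem differentiableAt_orthCoeff (hc : ∀ k, HasDerivAt (c k) (c (k + 1) u) u)
    (hD : (hankelMatrix (fun k => c k u) n).det ≠ 0) (j : Fin n) :
    DifferentiableAt ℝ (fun u => orthCoeff (fun k => c k u) n j) u := by
  have h1 : HasDerivAt (fun u => (hankelMatrix (fun k => c k u) n).det) _ u :=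
    hasDerivAt_det (M' := Matrix.of fun i j : Fin n => c ((i : ℕ) + j + 1) u) fun i j => hc _
  have h2 : DifferentiableAt ℝ (fun u => ((hankelMatrix (fun k => c k u) n).updateCol j
      fun i => c ((i : ℕ) + n) u).det) u := by
    refine (hasDerivAt_det (M' := Matrix.of fun i j' : Fin n =>
      if j' = j then c ((i : ℕ) + n + 1) u else c ((i : ℕ) + j' + 1) u)
      fun i j' => ?_).differentiableAt
    by_cases hj : j' = j
    · subst hj
      simp only [Matrix.updateCol_self, Matrix.of_apply, if_true]
      exact hc _
    · simp only [Matrix.updateCol_ne hj, Matrix.of_apply, if_neg hj]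
      exact hc _
  have h3 := h2.div h1.differentiableAt hD
  refine h3.congr_of_eventuallyEq ?_
  filter_upwards [h1.continuousAt.eventually_ne hD] with v hv
  rw [Pi.div_apply, eq_div_iff hv, mul_comm, det_mul_orthCoeff hv]

/-- The derivative of the orthogonal polynomial with respect to the parameter. -/
def orthPolyDot (c : ℕ → ℝ → ℝ) (n : ℕ) (u : ℝ) : ℝ[X] :=
  ∑ j : Fin n, C (-deriv (fun u => orthCoeff (fun k => c k u) n j) u) * X ^ (j : ℕ)

theorem functional_orthPoly_X_pow (c : ℕ → ℝ) (n i : ℕ) :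
    functional c (orthPoly c n * X ^ i) = c (n + i) - ∑ j : Fin n, orthCoeff c n j * c (j + i) := by
  rw [orthPoly, sub_mul, map_sub, ← pow_add, functional_X_pow, functional_sum_mul_X_pow]

theorem hasDerivAt_functional_orthPoly_X_pow (hc : ∀ k, HasDerivAt (c k) (c (k + 1) u) u)
    (hD : (hankelMatrix (fun k => c k u) n).det ≠ 0) (i : ℕ) :
    HasDerivAt (fun u => functional (fun k => c k u) (orthPoly (fun k => c k u) n * X ^ i))
      (functional (fun k => c k u) (orthPoly (fun k => c k u) n * X ^ (i + 1))
        + functional (fun k => c k u) (orthPolyDot c n u * X ^ i)) u := by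
  simp_rw [functional_orthPoly_X_pow]
  rw [orthPolyDot, functional_sum_mul_X_pow]
  refine ((hc _).sub (HasDerivAt.fun_sum fun j _ =>
    (differentiableAt_orthCoeff hc hD j).hasDerivAt.mul (hc _))).congr_deriv ?_
  rw [sum_add_distrib]
  simp only [neg_mul, sum_neg_distrib]
  simp only [← add_assoc]
  ring

theorem degree_orthPolyDot_lt : (orthPolyDot c n u).degree < ((n : ℕ) : WithBot ℕ) :=
  degree_sum_C_mul_X_pow_lt _

theorem functional_orthPolyDot (hc : ∀ k, ∀ u > 0, HasDerivAt (c k) (c (k + 1) u) u)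
    (hD : ∀ u > 0, (hankelMatrix (fun k => c k u) n).det ≠ 0) (hu : 0 < u) {i : ℕ} (hi : i < n) :
    functional (fun k => c k u) (orthPolyDot c n u * X ^ i)
      = -functional (fun k => c k u) (orthPoly (fun k => c k u) n * X ^ (i + 1)) := by
  have h1 := hasDerivAt_functional_orthPoly_X_pow (fun k => hc k u hu) (hD u hu) i
  have h2 : (fun u => functional (fun k => c k u) (orthPoly (fun k => c k u) n * X ^ i))
      =ᶠ[𝓝 u] fun _ => 0 := by
    filter_upwards [lt_mem_nhds hu] with v hv
    exact functional_orthPoly_mul_X_pow (hD v hv) hi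
  have h3 := h1.unique ((hasDerivAt_const u (0 : ℝ)).congr_of_eventuallyEq h2)
  linarith

/-- The derivative of `L (P ^ 2)` is `L (X P ^ 2)`, since the derivative of `P` is orthogonal
to `P`. -/
theorem hasDerivAt_functional_orthPoly_sq (hc : ∀ k, ∀ u > 0, HasDerivAt (c k) (c (k + 1) u) u)
    (hD : ∀ u > 0, (hankelMatrix (fun k => c k u) n).det ≠ 0) (hu : 0 < u) :
    HasDerivAt (fun u => functional (fun k => c k u)
        (orthPoly (fun k => c k u) n * orthPoly (fun k => c k u) n))
      (functional (fun k => c k u)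
        (X * orthPoly (fun k => c k u) n * orthPoly (fun k => c k u) n)) u := by
  have h1 := hasDerivAt_functional_orthPoly_X_pow (fun k => hc k u hu) (hD u hu) n
  have h2 : (fun u => functional (fun k => c k u)
        (orthPoly (fun k => c k u) n * orthPoly (fun k => c k u) n))
      =ᶠ[𝓝 u] fun u => functional (fun k => c k u) (orthPoly (fun k => c k u) n * X ^ n) := by
    filter_upwards [lt_mem_nhds hu] with v hv
    exact (functional_orthPoly_mul_X_pow_self (hD v hv)).symm
  refine (h1.congr_of_eventuallyEq h2).congr_deriv ?_
  have h3 : functional (fun k => c k u) (orthPoly (fun k => c k u) n * orthPolyDot c n u) = 0 :=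
    functional_orthPoly_mul (hD u hu) degree_orthPolyDot_lt
  have h4 : ∀ p : ℝ[X], functional (fun k => c k u) (p * orthPoly (fun k => c k u) n)
      = functional (fun k => c k u) (p * X ^ n) - ∑ j : Fin n,
        orthCoeff (fun k => c k u) n j * functional (fun k => c k u) (p * X ^ (j : ℕ)) := by
    intro p
    conv_lhs => rw [orthPoly, mul_sub, map_sub, mul_sum, map_sum]
    congr 1
    refine sum_congr rfl fun j _ => ?_
    rw [mul_left_comm, functional_C_mul]
  rw [mul_comm, h4] at h3
  rw [h4]
  have h5 : ∀ i, X * orthPoly (fun k => c k u) n * X ^ i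
      = orthPoly (fun k => c k u) n * X ^ (i + 1) := fun i => by ring
  simp only [h5]
  rw [sum_congr rfl fun j _ => by rw [functional_orthPolyDot hc hD hu j.2]] at h3
  simp only [mul_neg, sum_neg_distrib] at h3
  linarith

/-- The derivative of `P` has lower degree than `P` and is orthogonal to all polynomials of degree
less than `k`, so it is a multiple of `Q`. -/
theorem orthPolyDot_eq (hc : ∀ k, ∀ u > 0, HasDerivAt (c k) (c (k + 1) u) u)
    (hD : ∀ u > 0, (hankelMatrix (fun k => c k u) k).det ≠ 0)
    (hD' : ∀ u > 0, (hankelMatrix (fun k => c k u) (k + 1)).det ≠ 0) (hu : 0 < u) {β : ℝ}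
    (hβ : functional (fun k => c k u)
        (orthPoly (fun k => c k u) (k + 1) * orthPoly (fun k => c k u) (k + 1))
      = β * functional (fun k => c k u)
        (orthPoly (fun k => c k u) k * orthPoly (fun k => c k u) k)) :
    orthPolyDot c (k + 1) u = -(C β * orthPoly (fun k => c k u) k) := by
  rw [eq_neg_iff_add_eq_zero]
  refine eq_zero_of_orthogonal (hD' u hu) ?_ fun i hi => ?_
  · refine (degree_add_le _ _).trans_lt (max_lt degree_orthPolyDot_lt ?_)
    refine (degree_mul_le _ _).trans_lt ((add_le_add_left degree_C_le _).trans_lt ?_)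
    rw [zero_add, degree_orthPoly]
    exact_mod_cast k.lt_succ_self
  · rw [add_mul, LinearMap.map_add, functional_orthPolyDot hc hD' hu hi, mul_assoc,
      functional_C_mul]
    rcases (Nat.lt_succ_iff.1 hi).lt_or_eq with h | rfl
    · rw [functional_orthPoly_mul_X_pow (hD' u hu) (by omega),
        functional_orthPoly_mul_X_pow (hD u hu) h]
      ring
    · rw [functional_orthPoly_mul_X_pow_self (hD' u hu),
        functional_orthPoly_mul_X_pow_self (hD u hu), hβ]
      ring

/-- The second logarithmic derivative of the Hankel determinant is the recurrence
coefficient `β`. -/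
theorem hasDerivAt_orthCoeff_last (hc : ∀ k, ∀ u > 0, HasDerivAt (c k) (c (k + 1) u) u)
    (hD : ∀ u > 0, (hankelMatrix (fun k => c k u) k).det ≠ 0)
    (hD' : ∀ u > 0, (hankelMatrix (fun k => c k u) (k + 1)).det ≠ 0) (hu : 0 < u) {β : ℝ}
    (hβ : functional (fun k => c k u)
        (orthPoly (fun k => c k u) (k + 1) * orthPoly (fun k => c k u) (k + 1))
      = β * functional (fun k => c k u)
        (orthPoly (fun k => c k u) k * orthPoly (fun k => c k u) k)) :
    HasDerivAt (fun u => orthCoeff (fun k => c k u) (k + 1) (Fin.last k)) β u := by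
  have h := congrArg (fun p => p.coeff k) (orthPolyDot_eq hc hD hD' hu hβ)
  have h2 := coeff_sum_C_mul_X_pow (fun j : Fin (k + 1) =>
    -deriv (fun u => orthCoeff (fun k => c k u) (k + 1) j) u) (Fin.last k)
  rw [Fin.val_last] at h2
  simp only [orthPolyDot] at h
  rw [h2, coeff_neg, coeff_C_mul, coeff_orthPoly_self, mul_one, neg_inj] at h
  rw [← h]
  exact (differentiableAt_orthCoeff (fun k => hc k u hu) (hD' u hu) _).hasDerivAt

/-- The `σ`-form of Painlevé V for Hankel determinants of semiclassical moments, in terms of the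
logarithmic derivative `S` of the determinant. -/
theorem exists_sigma_form {a : ℝ} (hc : ∀ k, ∀ u > 0, HasDerivAt (c k) (c (k + 1) u) u)
    (hD : ∀ u > 0, (hankelMatrix (fun k => c k u) k).det ≠ 0)
    (hD' : ∀ u > 0, (hankelMatrix (fun k => c k u) (k + 1)).det ≠ 0)
    (hPe : ∀ u > 0, IsPearson a u fun k => c k u) :
    ∃ S β W : ℝ → ℝ, ∀ u > 0,
      HasDerivAt (fun u => (hankelMatrix (fun k => c k u) (k + 1)).det)
        ((hankelMatrix (fun k => c k u) (k + 1)).det * S u) u ∧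
      HasDerivAt S (β u) u ∧ HasDerivAt β (W u) u ∧
      (u * (u * W u + 2 * β u)) ^ 2 = 4 * (a - (k + 1)) ^ 2 * (S u + u * β u) ^ 2
        + 4 * (u ^ 2 * β u) *
          ((k + 1) * (2 * a - (k + 1)) - (S u + u * β u) ^ 2 + u ^ 2 * β u) := by
  let p : ℝ → ℝ := fun u => functional (fun k => c k u)
    (orthPoly (fun k => c k u) (k + 1) * orthPoly (fun k => c k u) (k + 1))
  let q : ℝ → ℝ := fun u => functional (fun k => c k u)
    (orthPoly (fun k => c k u) k * orthPoly (fun k => c k u) k)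
  let p' : ℝ → ℝ := fun u => functional (fun k => c k u)
    (X * orthPoly (fun k => c k u) (k + 1) * orthPoly (fun k => c k u) (k + 1))
  let q' : ℝ → ℝ := fun u => functional (fun k => c k u)
    (X * orthPoly (fun k => c k u) k * orthPoly (fun k => c k u) k)
  refine ⟨fun u => orthCoeff (fun k => c k u) (k + 1) (Fin.last k), fun u => p u / q u,
    fun u => p' u / q u - p u / q u * (q' u / q u), fun u hu => ?_⟩
  have hq0 : q u ≠ 0 := functional_orthPoly_sq_ne_zero (hD u hu) (hD' u hu)
  have hβ : p u = p u / q u * q u := (div_mul_cancel₀ _ hq0).symm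
  refine ⟨hasDerivAt_det_hankelMatrix (fun k => hc k u hu) (hD' u hu),
    hasDerivAt_orthCoeff_last hc hD hD' hu hβ, ?_, ?_⟩
  · refine ((hasDerivAt_functional_orthPoly_sq hc hD' hu).fun_div
      (hasDerivAt_functional_orthPoly_sq hc hD hu) hq0).congr_deriv ?_
    change (p' u * q u - p u * q' u) / q u ^ 2 = _
    field_simp
  · exact (isOrthPair_orthPoly (hD u hu) (hD' u hu) rfl rfl hβ
      (div_mul_cancel₀ _ hq0).symm (div_mul_cancel₀ _ hq0).symm).quadratic_relation (hPe u hu)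
      (orthPoly_no_common_root (hD u hu) (hD' u hu))

end Flow

end

/-! ### Confluent hypergeometric integrals -/

section

open Finset Polynomial

section Kernel

/-- The integral `∫ y ^ p (y + u) ^ q e ^ (-2 y) dy` over `y > 0`, a confluent hypergeometric
function of Tricomi type; it converges for `p > -1`, `u > 0` and every real `q`. -/
def tricomi (p q u : ℝ) : ℝ :=
  ∫ y in Set.Ioi (0 : ℝ), y ^ p * (y + u) ^ q * Real.exp (-2 * y)

variable {p q u : ℝ}

theorem exists_rpow_le_mul_exp (hu : 0 < u) (q : ℝ) : ∃ C, ∀ x ≥ u, x ^ q ≤ C * Real.exp x := by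
  obtain ⟨n, hn⟩ := exists_nat_ge q
  refine ⟨u ^ q / u ^ n * n.factorial, fun x hx => ?_⟩
  have hx0 : 0 < x := hu.trans_le hx
  have h1 : (x / u) ^ q ≤ (x / u) ^ n := by
    rw [← Real.rpow_natCast]
    exact Real.rpow_le_rpow_of_exponent_le ((one_le_div hu).2 hx) hn
  have h2 := Real.pow_div_factorial_le_exp x hx0.le n
  rw [div_le_iff₀ (by positivity)] at h2
  calc x ^ q = u ^ q * (x / u) ^ q := by
        rw [← Real.mul_rpow hu.le (by positivity), mul_div_cancel₀ _ hu.ne']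
    _ ≤ u ^ q * (x / u) ^ n := by gcongr
    _ = u ^ q / u ^ n * x ^ n := by rw [div_pow]; ring
    _ ≤ u ^ q / u ^ n * (Real.exp x * n.factorial) := by gcongr
    _ = _ := by ring

theorem integrableOn_tricomi (hp : -1 < p) (hu : 0 < u) (q : ℝ) :
    IntegrableOn (fun y : ℝ => y ^ p * (y + u) ^ q * Real.exp (-2 * y)) (Set.Ioi 0) := by
  obtain ⟨C, hC⟩ := exists_rpow_le_mul_exp hu q
  have h := (Real.GammaIntegral_convergent (s := p + 1) (by linarith)).const_mul (C * Real.exp u)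
  refine Integrable.mono' h (by fun_prop) ?_
  filter_upwards [ae_restrict_mem measurableSet_Ioi] with y hy
  have hy : 0 < y := hy
  rw [Real.norm_of_nonneg (by positivity), add_sub_cancel_right]
  calc y ^ p * (y + u) ^ q * Real.exp (-2 * y)
      ≤ y ^ p * (C * Real.exp (y + u)) * Real.exp (-2 * y) := by
        gcongr; exact hC _ (by linarith)
    _ = C * Real.exp u * (Real.exp (-y) * y ^ p) := by
        rw [Real.exp_add, show -2 * y = -y + -y by ring, Real.exp_add, Real.exp_neg]
        field_simp

theorem hasDerivAt_tricomi (hp : -1 < p) (hu : 0 < u) (q : ℝ) :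
    HasDerivAt (tricomi p q) (q * tricomi p (q - 1) u) u := by
  have h := hasDerivAt_integral_of_dominated_loc_of_deriv_le
    (μ := volume.restrict (Set.Ioi (0 : ℝ))) (x₀ := u) (s := Set.Ioo (u / 2) (2 * u))
    (F := fun v y => y ^ p * (y + v) ^ q * Real.exp (-2 * y))
    (F' := fun v y => y ^ p * (q * (y + v) ^ (q - 1)) * Real.exp (-2 * y))
    (bound := fun y => |q| * (y ^ p * (y + u / 2) ^ (q - 1) * Real.exp (-2 * y))
      + |q| * (y ^ p * (y + 2 * u) ^ (q - 1) * Real.exp (-2 * y)))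
    (Ioo_mem_nhds (by linarith) (by linarith)) (Eventually.of_forall fun v => by fun_prop)
    (integrableOn_tricomi hp hu q) (by fun_prop) ?_
    (((integrableOn_tricomi hp (by positivity) _).const_mul _).add
      ((integrableOn_tricomi hp (by positivity) _).const_mul _)) ?_
  · refine h.2.congr_deriv ?_
    rw [tricomi, ← integral_const_mul]
    exact integral_congr_ae (Eventually.of_forall fun y => by simp only; ring)
  · filter_upwards [ae_restrict_mem measurableSet_Ioi] with y hy v hv
    have hy : 0 < y := hy
    have hv0 : 0 < v := (half_pos hu).trans hv.1
    rw [norm_mul, norm_mul, norm_mul, Real.norm_of_nonneg (Real.rpow_nonneg hy.le p),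
      Real.norm_of_nonneg (by positivity : 0 ≤ (y + v) ^ (q - 1)),
      Real.norm_of_nonneg (Real.exp_pos _).le, Real.norm_eq_abs]
    -- a power is monotone in one direction or the other on the interval
    have key : (y + v) ^ (q - 1) ≤ (y + u / 2) ^ (q - 1) + (y + 2 * u) ^ (q - 1) := by
      rcases le_total 0 (q - 1) with h | h
      · have h1 : (y + v) ^ (q - 1) ≤ (y + 2 * u) ^ (q - 1) :=
          Real.rpow_le_rpow (by positivity) (by linarith [hv.2]) h
        exact h1.trans (le_add_of_nonneg_left (by positivity))
      · have h1 : (y + v) ^ (q - 1) ≤ (y + u / 2) ^ (q - 1) :=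
          Real.rpow_le_rpow_of_nonpos (by positivity) (by linarith [hv.1]) h
        exact h1.trans (le_add_of_nonneg_right (by positivity))
    calc y ^ p * (|q| * (y + v) ^ (q - 1)) * Real.exp (-2 * y)
        ≤ y ^ p * (|q| * ((y + u / 2) ^ (q - 1) + (y + 2 * u) ^ (q - 1))) *
          Real.exp (-2 * y) := by gcongr
      _ = _ := by ring
  · filter_upwards [ae_restrict_mem measurableSet_Ioi] with y hy v hv
    have hy : 0 < y := hy
    have hv0 : 0 < v := (half_pos hu).trans hv.1
    have h1 : HasDerivAt (fun v => (y + v) ^ q) (q * (y + v) ^ (q - 1)) v := by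
      have := ((hasDerivAt_id v).const_add y).rpow_const (p := q) (Or.inl (by simp; positivity))
      simpa using this
    exact (h1.const_mul _).mul_const _

/-- Integration by parts in `y`. -/
theorem tricomi_parts (hp : -1 < p) (hu : 0 < u) (q : ℝ) :
    (p + 1) * tricomi p q u + q * tricomi (p + 1) (q - 1) u = 2 * tricomi (p + 1) q u := by
  have hp1 : -1 < p + 1 := by linarith
  have i1 := (integrableOn_tricomi hp hu q).const_mul (p + 1)
  have i2 := (integrableOn_tricomi hp1 hu (q - 1)).const_mul q
  have i3 := (integrableOn_tricomi hp1 hu q).const_mul 2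
  have hd : ∀ y ∈ Set.Ioi (0 : ℝ), HasDerivAt
      (fun y : ℝ => y ^ (p + 1) * (y + u) ^ q * Real.exp (-2 * y))
      ((p + 1) * (y ^ p * (y + u) ^ q * Real.exp (-2 * y))
        + q * (y ^ (p + 1) * (y + u) ^ (q - 1) * Real.exp (-2 * y))
        - 2 * (y ^ (p + 1) * (y + u) ^ q * Real.exp (-2 * y))) y := by
    intro y hy
    have hy : 0 < y := hy
    have h1 := Real.hasDerivAt_rpow_const (x := y) (p := p + 1) (Or.inl hy.ne')
    have h2 := ((hasDerivAt_id y).add_const u).rpow_const (p := q)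
      (Or.inl (by simp; positivity))
    have h3 := ((hasDerivAt_id y).const_mul (-2)).exp
    refine ((h1.mul h2).mul h3).congr_deriv ?_
    simp only [id, add_sub_cancel_right, Pi.mul_apply]
    ring
  have hint := (i1.add i2).sub i3
  have h0 : ContinuousWithinAt (fun y : ℝ => y ^ (p + 1) * (y + u) ^ q * Real.exp (-2 * y))
      (Set.Ici 0) 0 := by
    have c1 : ContinuousAt (fun y : ℝ => y ^ (p + 1)) 0 :=
      Real.continuousAt_rpow_const _ _ (Or.inr (by linarith))
    have c2 : ContinuousAt (fun y : ℝ => (y + u) ^ q) 0 :=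
      (by fun_prop : ContinuousAt (fun y : ℝ => y + u) 0).rpow_const
        (Or.inl (by simpa using hu.ne'))
    exact ((c1.mul c2).mul (by fun_prop)).continuousWithinAt
  have h := integral_Ioi_of_hasDerivAt_of_tendsto h0 hd hint
    (tendsto_zero_of_hasDerivAt_of_integrableOn_Ioi hd hint (integrableOn_tricomi hp1 hu q))
  rw [Real.zero_rpow (by linarith), zero_mul, zero_mul, sub_zero] at h
  have e : ∫ y in Set.Ioi (0 : ℝ), ((p + 1) * (y ^ p * (y + u) ^ q * Real.exp (-2 * y))
        + q * (y ^ (p + 1) * (y + u) ^ (q - 1) * Real.exp (-2 * y))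
        - 2 * (y ^ (p + 1) * (y + u) ^ q * Real.exp (-2 * y)))
      = (p + 1) * tricomi p q u + q * tricomi (p + 1) (q - 1) u - 2 * tricomi (p + 1) q u := by
    rw [integral_sub (by exact i1.add i2) i3, integral_add i1 i2, integral_const_mul,
      integral_const_mul, integral_const_mul]
    rfl
  rw [e] at h
  linarith

theorem tricomi_add_one_left (hp : -1 < p) (hu : 0 < u) (q : ℝ) :
    tricomi (p + 1) q u = tricomi p (q + 1) u - u * tricomi p q u := by
  rw [tricomi, tricomi, tricomi, ← integral_const_mul, ← integral_sub
    (integrableOn_tricomi hp hu _) ((integrableOn_tricomi hp hu _).const_mul _)]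
  refine setIntegral_congr_fun measurableSet_Ioi fun y hy => ?_
  have hy : 0 < y := hy
  rw [Real.rpow_add_one hy.ne', Real.rpow_add_one (by positivity)]
  ring

/-- The contiguity relation in the second parameter. -/
theorem tricomi_contiguous (hp : -1 < p) (hu : 0 < u) (q : ℝ) :
    u * ((q - 1) * tricomi p (q - 2) u - 2 * tricomi p (q - 1) u)
      = (p + q) * tricomi p (q - 1) u - 2 * tricomi p q u := by
  have h1 := tricomi_parts hp hu (q - 1)
  rw [tricomi_add_one_left hp hu, tricomi_add_one_left hp hu, sub_add_cancel,
    sub_add_cancel, show q - 1 - 1 = q - 2 by ring] at h1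
  linarith

end Kernel

end

/-! ### Moments of the Bessel type function and positivity -/

section

open Finset Polynomial

section BesselMoments

theorem eq_functional {c : ℕ → ℝ} {L : ℝ[X] →ₗ[ℝ] ℝ} (h : ∀ k, L (X ^ k) = c k) (q : ℝ[X]) :
    L q = functional c q := by
  have : L = functional c := Polynomial.lhom_ext' fun k => LinearMap.ext_ring <| by
    rw [LinearMap.comp_apply, LinearMap.comp_apply, monomial_one_right_eq_X_pow, h,
      functional_X_pow]
  rw [this]

theorem hasDerivAt_functional {d : ℕ → ℝ → ℝ} {d' : ℕ → ℝ} {u : ℝ}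
    (h : ∀ k, HasDerivAt (d k) (d' k) u) (q : ℝ[X]) :
    HasDerivAt (fun u => functional (fun k => d k u) q) (functional d' q) u := by
  have e : ∀ c : ℕ → ℝ, functional c q = ∑ k ∈ q.support, q.coeff k * c k := fun c => by
    rw [functional, Polynomial.lsum_apply, Polynomial.sum]
    simp [mul_comm]
  simp_rw [e]
  exact HasDerivAt.fun_sum fun k _ => (h k).const_mul _

variable {p u : ℝ}

/-- The functions `(1 + ∂) ^ k h` of the variable `u`, where `h u = e ^ (-u) * tricomi p p u`. -/
def shiftedMoment (p : ℝ) (k : ℕ) (u : ℝ) : ℝ :=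
  Real.exp (-u) * (∏ i ∈ range k, (p - i)) * tricomi p (p - k) u

/-- The `k`-th derivative of `h u = e ^ (-u) * tricomi p p u`, expanded in the functions
`(1 + ∂) ^ j h`. -/
def besselMoment (p : ℝ) (k : ℕ) (u : ℝ) : ℝ :=
  functional (fun j => shiftedMoment p j u) ((X - 1) ^ k)

theorem besselMoment_zero (p u : ℝ) : besselMoment p 0 u = Real.exp (-u) * tricomi p p u := by
  rw [besselMoment, pow_zero, ← pow_zero X, functional_X_pow, shiftedMoment]
  simp

theorem hasDerivAt_shiftedMoment (hp : -1 < p) (hu : 0 < u) (k : ℕ) :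
    HasDerivAt (shiftedMoment p k) (shiftedMoment p (k + 1) u - shiftedMoment p k u) u := by
  have h1 := (((hasDerivAt_id u).neg.exp).mul_const (∏ i ∈ range k, (p - i))).mul
    (hasDerivAt_tricomi hp hu (p - k))
  refine h1.congr_deriv ?_
  simp only [shiftedMoment, prod_range_succ, id, Pi.neg_apply]
  push_cast
  rw [sub_add_eq_sub_sub]
  ring

theorem hasDerivAt_besselMoment (hp : -1 < p) (k : ℕ) (u : ℝ) (hu : 0 < u) :
    HasDerivAt (besselMoment p k) (besselMoment p (k + 1) u) u := by
  refine (hasDerivAt_functional (fun j => hasDerivAt_shiftedMoment hp hu j) _).congr_deriv ?_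
  have h := eq_functional (c := fun j => shiftedMoment p (j + 1) u - shiftedMoment p j u)
    (L := functional (fun j => shiftedMoment p j u) ∘ₗ LinearMap.mulLeft ℝ (X - 1)) (fun j => by
      rw [LinearMap.comp_apply, LinearMap.mulLeft_apply, sub_mul, one_mul, ← pow_succ', map_sub,
        functional_X_pow, functional_X_pow]) ((X - 1) ^ k)
  rw [← h, LinearMap.comp_apply, LinearMap.mulLeft_apply, ← pow_succ', besselMoment]

theorem functional_besselMoment (p u : ℝ) (q : ℝ[X]) :
    functional (fun k => besselMoment p k u) q
      = functional (fun k => shiftedMoment p k u) (q.comp (X - 1)) := by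
  have h := eq_functional (c := fun k => besselMoment p k u)
    (L := functional (fun j => shiftedMoment p j u) ∘ₗ (aeval (X - 1 : ℝ[X])).toLinearMap)
    (fun j => by simp [besselMoment]) q
  rw [← h]
  rfl

/-- The differential equation of `h`, in the form of an integration by parts identity. -/
theorem isPearson_besselMoment (hp : -1 < p) (hu : 0 < u) :
    IsPearson (p + 1) u fun k => besselMoment p k u := by
  have key : ∀ r : ℝ[X], functional (fun k => shiftedMoment p k u)
      (C u * ((X ^ 2 - 2 * X) * r) - C (2 * p) * ((X - 1) * r)
        + (X ^ 2 - 2 * X) * derivative r) = 0 := by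
    intro r
    induction r using Polynomial.induction_on' with
    | add r r' h h' =>
      rw [← add_zero (0 : ℝ)]
      nth_rw 1 [← h]
      rw [← h', ← LinearMap.map_add, derivative_add]
      congr 1
      ring
    | monomial k x =>
      have e : (X ^ 2 - 2 * X) * derivative (X ^ k : ℝ[X])
          = C (k : ℝ) * (X ^ (k + 1) - 2 * X ^ k) := by
        cases k with
        | zero => simp
        | succ k => rw [derivative_X_pow]; simp only [Nat.add_sub_cancel]; ring
      have e2 : C u * ((X ^ 2 - 2 * X) * (C x * X ^ k)) - C (2 * p) * ((X - 1) * (C x * X ^ k))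
        + (X ^ 2 - 2 * X) * derivative (C x * X ^ k)
        = C x * (C u * X ^ (k + 2) - C (2 * u) * X ^ (k + 1) - C (2 * p) * X ^ (k + 1)
          + C (2 * p) * X ^ k + C (k : ℝ) * X ^ (k + 1) - C (2 * k : ℝ) * X ^ k) := by
        rw [derivative_C_mul, mul_left_comm _ (C x) (derivative _), e]
        simp only [C_mul, C_ofNat]
        ring
      rw [← C_mul_X_pow_eq_monomial, e2, functional_C_mul]
      simp only [LinearMap.map_add, LinearMap.map_sub, functional_C_mul, functional_X_pow]
      have h := tricomi_contiguous hp hu (p - k)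
      simp only [shiftedMoment, prod_range_succ]
      push_cast
      rw [sub_add_eq_sub_sub, sub_add_eq_sub_sub]
      linear_combination x * Real.exp (-u) * (∏ i ∈ range k, (p - i)) * (p - k) * h
  intro q
  rw [functional_besselMoment, ← key (q.comp (X - 1))]
  congr 1
  rw [derivative_comp]
  simp only [add_comp, mul_comp, sub_comp, C_comp, X_comp, pow_comp, one_comp, derivative_sub,
    derivative_X, derivative_one]
  simp only [C_mul, C_sub, C_add, C_1]
  ring

theorem functional_two_sub_X_pow_mul_X_pow (hu : 0 < u) {j : ℕ} (hj : (j : ℝ) < p + 1)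
    (k : ℕ) : functional (fun k => shiftedMoment p k u) ((2 - X) ^ j * X ^ k)
      = Real.exp (-u) * (∏ i ∈ range j, (p - i)) * (∏ i ∈ range k, (p - i)) *
        tricomi (p - j) (p - k) u := by
  induction j generalizing k with
  | zero =>
    rw [pow_zero, one_mul, functional_X_pow, shiftedMoment]
    simp
  | succ j ih =>
    push_cast at hj
    have e : ((2 : ℝ[X]) - X) ^ (j + 1) * X ^ k
        = C 2 * ((2 - X) ^ j * X ^ k) - (2 - X) ^ j * X ^ (k + 1) := by
      rw [C_ofNat]; ring
    rw [e, map_sub, functional_C_mul, ih (by linarith), ih (by linarith), prod_range_succ,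
      prod_range_succ]
    have h := tricomi_parts (p := p - j - 1) (by linarith) hu (p - k)
    rw [sub_add_cancel] at h
    push_cast
    rw [sub_add_eq_sub_sub, sub_add_eq_sub_sub]
    linear_combination -Real.exp (-u) * (∏ i ∈ range j, (p - i)) * (∏ i ∈ range k, (p - i)) * h

/-- The function `(1 - ∂) ^ j (1 + ∂) ^ k h`. -/
theorem functional_one_sub_X_pow_mul (hu : 0 < u) {j : ℕ} (hj : (j : ℝ) < p + 1)
    (k : ℕ) : functional (fun k => besselMoment p k u) ((1 - X) ^ j * (1 + X) ^ k)
      = Real.exp (-u) * (∏ i ∈ range j, (p - i)) * (∏ i ∈ range k, (p - i)) *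
        tricomi (p - j) (p - k) u := by
  rw [functional_besselMoment, ← functional_two_sub_X_pow_mul_X_pow hu hj]
  congr 1
  simp only [mul_comp, pow_comp, sub_comp, add_comp, one_comp, X_comp]
  ring

end BesselMoments

section Positivity

/-- Change of basis in a Hankel determinant. -/
theorem det_functional_mul (c : ℕ → ℝ) {n : ℕ} {r s : ℕ → ℝ[X]}
    (hr : ∀ i, (r i).natDegree ≤ i) (hs : ∀ i, (s i).natDegree ≤ i) :
    (Matrix.of fun i j : Fin n => functional c (r i * s j)).det
      = (∏ i : Fin n, (r i).coeff i) * (∏ i : Fin n, (s i).coeff i) * (hankelMatrix c n).det := by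
  have tri : ∀ r : ℕ → ℝ[X], (∀ i, (r i).natDegree ≤ i) →
      (Matrix.of fun i j : Fin n => (r i).coeff j).det = ∏ i : Fin n, (r i).coeff i := by
    intro r hr
    refine Matrix.det_of_isLowerTriangular _ fun i j hij => ?_
    exact coeff_eq_zero_of_natDegree_lt ((hr i).trans_lt (by exact_mod_cast hij))
  have e : (Matrix.of fun i j : Fin n => functional c (r i * s j))
      = (Matrix.of fun i j : Fin n => (r i).coeff j) * hankelMatrix c n *
        (Matrix.of fun i j : Fin n => (s i).coeff j).transpose := by
    have ex : ∀ r : ℕ → ℝ[X], (∀ i, (r i).natDegree ≤ i) → ∀ i : Fin n,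
        r i = ∑ j : Fin n, C ((r i).coeff j) * X ^ (j : ℕ) := fun r hr i =>
      eq_sum_C_mul_X_pow (degree_le_natDegree.trans_lt (by exact_mod_cast (hr i).trans_lt i.2))
    ext i j
    have h : functional c (r i * s j)
        = ∑ l : Fin n, ∑ m : Fin n, (r i).coeff l * c ((l : ℕ) + m) * (s j).coeff m := by
      conv_lhs => rw [ex r hr i, ex s hs j, sum_mul, map_sum]
      refine sum_congr rfl fun l _ => ?_
      rw [mul_sum, map_sum]
      refine sum_congr rfl fun m _ => ?_
      rw [mul_mul_mul_comm, ← C_mul, ← pow_add, functional_C_mul, functional_X_pow]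
      ring
    rw [Matrix.of_apply, h, sum_comm]
    simp only [Matrix.mul_apply, Matrix.of_apply, Matrix.transpose_apply, hankelMatrix, sum_mul]
  rw [e, Matrix.det_mul, Matrix.det_mul, Matrix.det_transpose, tri r hr, tri s hs]
  ring

theorem functional_integral {ν : Measure ℝ} (hint : ∀ k : ℕ, Integrable (fun y => y ^ k) ν)
    (q : ℝ[X]) : functional (fun k => ∫ y, y ^ k ∂ν) q = ∫ y, q.eval y ∂ν := by
  simp_rw [eval_eq_sum, Polynomial.sum]
  rw [integral_finsetSum _ fun k _ => (hint k).const_mul _, functional, Polynomial.lsum_apply,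
    Polynomial.sum]
  refine sum_congr rfl fun k _ => ?_
  rw [integral_const_mul]
  simp [mul_comm]

variable {p u : ℝ}

/-- The matrix is, in the basis `y ^ j`, `(y + u) ^ k`, the Gram matrix of the measure
`y ^ p (y + u) ^ p e ^ (-2 y) dy`. -/
theorem det_tricomi_pos (hp : -1 < p) (hu : 0 < u) (n : ℕ) :
    0 < (Matrix.of fun i j : Fin n => tricomi (p + (i : ℕ)) (p + (j : ℕ)) u).det := by
  let w : ℝ → ℝ := fun y => y ^ p * (y + u) ^ p * Real.exp (-2 * y)
  have hw : Measurable w := by fun_prop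
  have hw0 : ∀ y ∈ Set.Ioi (0 : ℝ), 0 < w y := fun y (hy : 0 < y) => by positivity
  let ν : Measure ℝ := (volume.restrict (Set.Ioi 0)).withDensity fun y => ENNReal.ofReal (w y)
  have hν : ν ≠ 0 := by
    intro h
    rw [withDensity_eq_zero_iff hw.ennreal_ofReal.aemeasurable] at h
    have : ∀ᵐ y ∂(volume.restrict (Set.Ioi (0 : ℝ))), False := by
      filter_upwards [h, ae_restrict_mem measurableSet_Ioi] with y h1 h2
      exact (ENNReal.ofReal_pos.2 (hw0 y h2)).ne' h1
    rw [eventually_false_iff_eq_bot, ae_eq_bot, Measure.restrict_eq_zero] at this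
    simp at this
  have hsm : ∀ f : ℝ → ℝ, (fun y => (ENNReal.ofReal (w y)).toReal • f y)
      =ᵐ[volume.restrict (Set.Ioi 0)] fun y => w y * f y := by
    intro f
    filter_upwards [ae_restrict_mem measurableSet_Ioi] with y hy
    rw [ENNReal.toReal_ofReal (hw0 y hy).le, smul_eq_mul]
  have hI : ∀ f : ℝ → ℝ, ∫ y, f y ∂ν = ∫ y in Set.Ioi (0 : ℝ), w y * f y := by
    intro f
    rw [integral_withDensity_eq_integral_toReal_smul hw.ennreal_ofReal
      (Eventually.of_forall fun _ => ENNReal.ofReal_lt_top)]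
    exact integral_congr_ae (hsm f)
  have hint : ∀ k : ℕ, Integrable (fun y => y ^ k) ν := by
    intro k
    rw [integrable_withDensity_iff_integrable_smul' hw.ennreal_ofReal
      (Eventually.of_forall fun _ => ENNReal.ofReal_lt_top), integrable_congr (hsm _)]
    have hk : -1 < p + k := by linarith [k.cast_nonneg (α := ℝ)]
    refine (integrable_congr ?_).1 (integrableOn_tricomi hk hu p)
    filter_upwards [ae_restrict_mem measurableSet_Ioi] with y hy
    have hy : 0 < y := hy
    rw [Real.rpow_add_natCast hy.ne']
    simp only [w]
    ring
  have h1 := det_functional_mul (fun k => ∫ y, y ^ k ∂ν) (n := n) (r := fun i => X ^ i)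
    (s := fun i => (X + C u) ^ i) (fun i => by simp) (fun i => by simp)
  have h2 : (Matrix.of fun i j : Fin n => tricomi (p + (i : ℕ)) (p + (j : ℕ)) u)
      = Matrix.of fun i j : Fin n => functional (fun k => ∫ y, y ^ k ∂ν)
        (X ^ (i : ℕ) * (X + C u) ^ (j : ℕ)) := by
    ext i j
    rw [Matrix.of_apply, Matrix.of_apply, functional_integral hint, hI, tricomi]
    refine setIntegral_congr_fun measurableSet_Ioi fun y hy => ?_
    have hy : 0 < y := hy
    simp only [eval_mul, eval_pow, eval_add, eval_X, eval_C, w]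
    rw [Real.rpow_add_natCast hy.ne', Real.rpow_add_natCast (by positivity)]
    ring
  have h3 : ∀ i : ℕ, ((X + C u) ^ i).coeff i = 1 := fun i => by
    have := coeff_pow_of_natDegree_le (p := X + C u) (n := 1) (m := i) (by simp)
    simpa using this
  rw [h2, h1]
  simp only [coeff_X_pow_self, h3, prod_const_one, one_mul]
  exact det_hankel_pos ν hν fun i j => hint _

/-- The sign of the Hankel determinant of the derivatives of `h`. In the basis `(1 - X) ^ j`,
`(1 + X) ^ k` its entries are, up to positive factors, the integrals
`∫ y ^ (p - j) (y + u) ^ (p - k) e ^ (-2 y) dy`, and reversing the order of rows and columns gives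
the Gram matrix of a positive measure. -/
theorem det_hankelMatrix_besselMoment_pos (hu : 0 < u) {n : ℕ} (hn : (n : ℝ) < p + 2) :
    0 < (∏ i : Fin n, (-1 : ℝ) ^ (i : ℕ)) *
      (hankelMatrix (fun k => besselMoment p k u) n).det := by
  cases n with
  | zero => simp
  | succ n =>
  push_cast at hn
  have hle : ∀ i : Fin (n + 1), ((i : ℕ) : ℝ) ≤ n := fun i => by
    exact_mod_cast Nat.lt_succ_iff.1 i.2
  have hs1 : (1 - X : ℝ[X]).natDegree ≤ 1 := by compute_degree
  have ha1 : (1 + X : ℝ[X]).natDegree ≤ 1 := by compute_degree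
  have h1 := det_functional_mul (fun k => besselMoment p k u) (n := n + 1)
    (r := fun i => (1 - X) ^ i) (s := fun i => (1 + X) ^ i)
    (fun i => (natDegree_pow_le_of_le i hs1).trans (mul_one i).le)
    (fun i => (natDegree_pow_le_of_le i ha1).trans (mul_one i).le)
  have h2 : ∀ i : ℕ, ((1 - X : ℝ[X]) ^ i).coeff i = (-1) ^ i := fun i => by
    have := coeff_pow_of_natDegree_le (p := (1 - X : ℝ[X])) (n := 1) (m := i) hs1
    simpa [coeff_one] using this
  have h3 : ∀ i : ℕ, ((1 + X : ℝ[X]) ^ i).coeff i = 1 := fun i => by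
    have := coeff_pow_of_natDegree_le (p := (1 + X : ℝ[X])) (n := 1) (m := i) ha1
    simpa [coeff_one] using this
  simp only [h2, h3, prod_const_one, mul_one] at h1
  rw [← h1]
  let f : ℕ → ℝ := fun j => ∏ i ∈ range j, (p - i)
  have hf : ∀ j : Fin (n + 1), 0 < f j := fun j => prod_pos fun i hi => by
    have : (i : ℝ) + 1 ≤ n := by
      have := mem_range.1 hi
      exact_mod_cast (show i + 1 ≤ n by omega)
    linarith
  have h4 : (Matrix.of fun i j : Fin (n + 1) => functional (fun k => besselMoment p k u)
      ((1 - X) ^ (i : ℕ) * (1 + X) ^ (j : ℕ)))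
      = Matrix.of fun i j : Fin (n + 1) => (Real.exp (-u) * f i) *
        (Matrix.of fun i j : Fin (n + 1) => f j *
          Matrix.of (fun i j : Fin (n + 1) => tricomi (p - (i : ℕ)) (p - (j : ℕ)) u) i j) i j := by
    ext i j
    simp only [Matrix.of_apply]
    rw [functional_one_sub_X_pow_mul hu (by linarith [hle i])]
    ring
  rw [h4, Matrix.det_mul_column, Matrix.det_mul_row]
  refine mul_pos (prod_pos fun i _ => mul_pos (Real.exp_pos _) (hf i))
    (mul_pos (prod_pos fun i _ => hf i) ?_)
  rw [← Matrix.det_submatrix_equiv_self Fin.revPerm]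
  convert! det_tricomi_pos (p := p - n) (by linarith) hu (n + 1) using 2
  ext i j
  have hrev : ∀ i : Fin (n + 1), p - (Fin.rev i : ℕ) = p - n + (i : ℕ) := fun i => by
    rw [Fin.val_rev, Nat.cast_sub (by omega)]
    push_cast
    ring
  simp only [Matrix.submatrix_apply, Matrix.of_apply, Fin.revPerm_apply, hrev]

end Positivity

end

/-! ### Fourier inversion for the moments -/

section

open Finset

section Fourier

/-- The Fourier transform of the gamma density `y ^ (a - 1) e ^ (-y)` on the positive half line. -/
def gammaFourier (a w : ℝ) : ℂ :=
  ∫ y in Set.Ioi (0 : ℝ), ((Real.exp (-y) * y ^ (a - 1) : ℝ) : ℂ) *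
    Complex.exp (-(Complex.I * w * y))

variable {a : ℝ}

theorem norm_exp_neg_I_mul (w y : ℝ) : ‖Complex.exp (-(Complex.I * w * y))‖ = 1 := by
  rw [show -(Complex.I * w * y) = ((-(w * y) : ℝ) : ℂ) * Complex.I by push_cast; ring,
    Complex.norm_exp_ofReal_mul_I]

theorem integrableOn_gammaFourier (ha : 0 < a) (w : ℝ) :
    IntegrableOn (fun y : ℝ => ((Real.exp (-y) * y ^ (a - 1) : ℝ) : ℂ) *
      Complex.exp (-(Complex.I * w * y))) (Set.Ioi 0) := by
  refine (Real.GammaIntegral_convergent ha).ofReal.mul_bdd (c := 1) (by fun_prop)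
    (Eventually.of_forall fun y => (norm_exp_neg_I_mul w y).le)

theorem hasDerivAt_gammaFourier (ha : 0 < a) (w : ℝ) :
    HasDerivAt (gammaFourier a) (-Complex.I * gammaFourier (a + 1) w) w := by
  have ha1 : 0 < a + 1 := by linarith
  have h := hasDerivAt_integral_of_dominated_loc_of_deriv_le
    (μ := volume.restrict (Set.Ioi (0 : ℝ))) (x₀ := w) (s := Set.univ)
    (F := fun (w : ℝ) (y : ℝ) => ((Real.exp (-y) * y ^ (a - 1) : ℝ) : ℂ) *
      Complex.exp (-(Complex.I * w * y)))
    (F' := fun (w : ℝ) (y : ℝ) => -Complex.I * (((Real.exp (-y) * y ^ (a + 1 - 1) : ℝ) : ℂ) *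
      Complex.exp (-(Complex.I * w * y))))
    (bound := fun y => Real.exp (-y) * y ^ (a + 1 - 1))
    univ_mem (Eventually.of_forall fun v => by fun_prop)
    (integrableOn_gammaFourier ha w) (by fun_prop) ?_ (Real.GammaIntegral_convergent ha1) ?_
  · refine h.2.congr_deriv ?_
    rw [integral_const_mul]
    rfl
  · filter_upwards [ae_restrict_mem measurableSet_Ioi] with y hy v _
    have hy : 0 < y := hy
    rw [norm_mul, norm_mul, norm_exp_neg_I_mul, norm_neg, Complex.norm_I, one_mul, mul_one,
      Complex.norm_real, Real.norm_of_nonneg (by positivity)]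
  · filter_upwards [ae_restrict_mem measurableSet_Ioi] with y hy v _
    have hy : 0 < y := hy
    have h1 : HasDerivAt (fun v : ℝ => Complex.exp (-(Complex.I * v * y)))
        (Complex.exp (-(Complex.I * v * y)) * -(Complex.I * 1 * y)) v :=
      (((Complex.ofRealCLM.hasDerivAt (x := v)).const_mul _).mul_const _).neg.cexp
    refine (h1.const_mul _).congr_deriv ?_
    rw [add_sub_cancel_right, Real.rpow_sub_one hy.ne']
    have : (y : ℂ) ≠ 0 := Complex.ofReal_ne_zero.2 hy.ne'
    push_cast
    field_simp

theorem gammaFourier_add_one (ha : 0 < a) (w : ℝ) :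
    (1 + Complex.I * w) * gammaFourier (a + 1) w = a * gammaFourier a w := by
  have ha1 : 0 < a + 1 := by linarith
  have i1 := (integrableOn_gammaFourier ha w).const_mul (a : ℂ)
  have i2 := (integrableOn_gammaFourier ha1 w).const_mul (1 + Complex.I * w)
  have hd : ∀ y ∈ Set.Ioi (0 : ℝ), HasDerivAt
      (fun y : ℝ => ((Real.exp (-y) * y ^ (a + 1 - 1) : ℝ) : ℂ) *
        Complex.exp (-(Complex.I * w * y)))
      (a * (((Real.exp (-y) * y ^ (a - 1) : ℝ) : ℂ) * Complex.exp (-(Complex.I * w * y)))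
        - (1 + Complex.I * w) * (((Real.exp (-y) * y ^ (a + 1 - 1) : ℝ) : ℂ) *
          Complex.exp (-(Complex.I * w * y)))) y := by
    intro y hy
    have hy : 0 < y := hy
    rw [add_sub_cancel_right]
    have h1 := (((hasDerivAt_id y).neg.exp).mul
      (Real.hasDerivAt_rpow_const (x := y) (p := a) (Or.inl hy.ne'))).ofReal_comp
    have h2 : HasDerivAt (fun v : ℝ => Complex.exp (-(Complex.I * w * v)))
        (Complex.exp (-(Complex.I * w * y)) * -(Complex.I * w * 1)) y :=
      ((Complex.ofRealCLM.hasDerivAt (x := y)).const_mul _).neg.cexp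
    refine (h1.mul h2).congr_deriv ?_
    simp only [id, Pi.mul_apply, Pi.neg_apply]
    push_cast
    ring
  have hint := i1.sub i2
  have h0 : ContinuousWithinAt (fun y : ℝ => ((Real.exp (-y) * y ^ (a + 1 - 1) : ℝ) : ℂ) *
      Complex.exp (-(Complex.I * w * y))) (Set.Ici 0) 0 := by
    rw [add_sub_cancel_right]
    have c1 : ContinuousAt (fun y : ℝ => y ^ a) 0 :=
      Real.continuousAt_rpow_const _ _ (Or.inr ha.le)
    have c2 : ContinuousAt (fun y : ℝ => Real.exp (-y) * y ^ a) 0 :=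
      ContinuousAt.mul (by fun_prop) c1
    have c3 : ContinuousAt (fun y : ℝ => ((Real.exp (-y) * y ^ a : ℝ) : ℂ)) 0 :=
      Complex.continuous_ofReal.continuousAt.comp c2
    exact (c3.mul (by fun_prop)).continuousWithinAt
  have h := integral_Ioi_of_hasDerivAt_of_tendsto h0 hd hint
    (tendsto_zero_of_hasDerivAt_of_integrableOn_Ioi hd hint (integrableOn_gammaFourier ha1 w))
  rw [add_sub_cancel_right, Real.zero_rpow ha.ne', mul_zero, Complex.ofReal_zero, zero_mul,
    sub_zero] at h
  have e := integral_sub i1 i2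
  rw [integral_const_mul, integral_const_mul] at e
  rw [add_sub_cancel_right] at e
  rw [e, sub_eq_zero] at h
  rw [gammaFourier, gammaFourier, add_sub_cancel_right]
  exact h.symm

theorem gammaFourier_zero (ha : 0 < a) : gammaFourier a 0 = Real.Gamma a := by
  rw [Real.Gamma_eq_integral ha, gammaFourier, ← integral_complex_ofReal]
  simp

/-- The squared modulus of the Fourier transform of a gamma density. Both sides satisfy the same
differential equation in `w`. -/
theorem gammaFourier_mul_neg (ha : 0 < a) (w : ℝ) :
    gammaFourier a w * gammaFourier a (-w)
      = ((Real.Gamma a ^ 2 * (1 + w ^ 2) ^ (-a) : ℝ) : ℂ) := by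
  have hd : ∀ w : ℝ, HasDerivAt (fun w : ℝ => gammaFourier a w * gammaFourier a (-w) *
      (((1 + w ^ 2) ^ a : ℝ) : ℂ)) 0 w := by
    intro w
    have n1 : (1 + Complex.I * w) ≠ 0 := fun h => by simpa using congrArg Complex.re h
    have n2 : (1 - Complex.I * w) ≠ 0 := fun h => by simpa using congrArg Complex.re h
    have n3 : (0 : ℝ) < 1 + w ^ 2 := by positivity
    have n4 : (1 + (w : ℂ) ^ 2) = (1 + Complex.I * w) * (1 - Complex.I * w) := by
      ring_nf; rw [Complex.I_sq]; ring
    have e1 : gammaFourier (a + 1) w = a * gammaFourier a w / (1 + Complex.I * w) := by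
      rw [eq_div_iff n1, mul_comm, gammaFourier_add_one ha]
    have e2 : gammaFourier (a + 1) (-w) = a * gammaFourier a (-w) / (1 - Complex.I * w) := by
      rw [eq_div_iff n2, mul_comm, ← gammaFourier_add_one ha]
      push_cast
      ring
    have h1 := hasDerivAt_gammaFourier ha w
    have h2 : HasDerivAt (fun w => gammaFourier a (-w))
        (Complex.I * gammaFourier (a + 1) (-w)) w := by
      refine ((hasDerivAt_gammaFourier ha (-w)).scomp w (hasDerivAt_neg w)).congr_deriv ?_
      simp
    have h3 := (((hasDerivAt_id w).pow 2).const_add 1).rpow_const (p := a) (Or.inl n3.ne')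
    refine ((h1.mul h2).mul h3.ofReal_comp).congr_deriv ?_
    rw [e1, e2]
    simp only [id, Pi.mul_apply, Pi.pow_apply]
    rw [Real.rpow_sub_one n3.ne']
    push_cast
    rw [n4]
    field_simp
    ring_nf
    simp only [Complex.I_sq]
    ring
  have hc := is_const_of_deriv_eq_zero (fun w => (hd w).differentiableAt)
    (fun w => (hd w).deriv) w 0
  simp only [neg_zero, gammaFourier_zero ha] at hc
  norm_num at hc
  have n3 : (0 : ℝ) < 1 + w ^ 2 := by positivity
  have n5 : (((1 + w ^ 2) ^ a : ℝ) : ℂ) ≠ 0 := Complex.ofReal_ne_zero.2 (by positivity)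
  rw [Real.rpow_neg n3.le]
  rw [← eq_div_iff n5] at hc
  rw [hc]
  push_cast
  ring

/-- The gamma density on the real line. -/
def gammaDensity (a y : ℝ) : ℂ :=
  (Set.Ioi (0 : ℝ)).indicator (fun y => ((Real.exp (-y) * y ^ (a - 1) : ℝ) : ℂ)) y

theorem integrable_gammaDensity (ha : 0 < a) : Integrable (gammaDensity a) :=
  IntegrableOn.integrable_indicator (Real.GammaIntegral_convergent ha).ofReal measurableSet_Ioi

open FourierTransform Convolution

theorem fourier_gammaDensity (a x : ℝ) :
    𝓕 (gammaDensity a) x = gammaFourier a (2 * Real.pi * x) := by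
  rw [Real.fourier_real_eq_integral_exp_smul, gammaFourier, ← integral_indicator measurableSet_Ioi]
  refine integral_congr_ae (Eventually.of_forall fun y => ?_)
  simp only [gammaDensity, Set.indicator_apply, smul_eq_mul]
  split_ifs
  · rw [mul_comm]
    congr 2
    push_cast
    ring
  · rw [mul_zero]

theorem fourier_gammaDensity_neg (a x : ℝ) :
    𝓕 (fun y => gammaDensity a (-y)) x = gammaFourier a (-(2 * Real.pi * x)) := by
  rw [← mul_neg, ← fourier_gammaDensity, Real.fourier_real_eq_integral_exp_smul,
    Real.fourier_real_eq_integral_exp_smul, ← integral_neg_eq_self]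
  refine integral_congr_ae (Eventually.of_forall fun y => ?_)
  simp only [neg_neg]
  congr 3
  push_cast
  ring

/-- The autocorrelation of the gamma density. -/
theorem gammaDensity_convolution {u : ℝ} (hu : 0 < u) :
    (gammaDensity a ⋆[ContinuousLinearMap.mul ℂ ℂ] fun y => gammaDensity a (-y)) u
      = besselMoment (a - 1) 0 u := by
  rw [convolution_def, besselMoment_zero, tricomi, ← integral_const_mul, ← integral_complex_ofReal,
    ← integral_add_right_eq_self _ u, ← integral_indicator measurableSet_Ioi]
  refine integral_congr_ae (Eventually.of_forall fun y => ?_)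
  simp only [gammaDensity, Set.indicator_apply, ContinuousLinearMap.mul_apply', Set.mem_Ioi]
  rw [show -(u - (y + u)) = y by ring]
  split_ifs with h1 h2 h2
  · rw [← Complex.ofReal_mul]
    congr 1
    rw [show -2 * y = -y + -y by ring, Real.exp_add, neg_add, Real.exp_add]
    ring
  · rw [mul_zero]
  · exact absurd (add_pos h2 hu) h1
  · rw [mul_zero]

/-- Fourier inversion for the autocorrelation of the gamma density. -/
theorem moment_zero (ha : 1 / 2 < a) {u : ℝ} (hu : 0 < u) :
    moment a u 0 = ((2 * Real.pi / Real.Gamma a ^ 2 : ℝ) : ℂ) * besselMoment (a - 1) 0 u := by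
  have ha0 : 0 < a := by linarith
  have hG : Real.Gamma a ≠ 0 := (Real.Gamma_pos_of_pos ha0).ne'
  have i1 := integrable_gammaDensity ha0
  have i2 : Integrable fun y => gammaDensity a (-y) := i1.comp_neg
  let K : ℝ → ℂ := gammaDensity a ⋆[ContinuousLinearMap.mul ℂ ℂ] fun y => gammaDensity a (-y)
  have hK : Integrable K := i1.integrable_convolution _ i2
  have hF : 𝓕 K = fun x => ((Real.Gamma a ^ 2 * (1 + (2 * Real.pi * x) ^ 2) ^ (-a) : ℝ) : ℂ) := by
    funext x
    rw [Real.fourier_mul_convolution_eq i1 i2, fourier_gammaDensity, fourier_gammaDensity_neg,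
      gammaFourier_mul_neg ha0]
  have hI : Integrable (𝓕 K) := by
    rw [hF]
    have := (integrable_pow_mul_weight (a := a) (k := 0) (by norm_num; linarith)).comp_mul_left'
      (R := 2 * Real.pi) (by positivity)
    simp only [pow_zero, one_mul] at this
    exact (this.const_mul _).ofReal
  have hc : ContinuousAt K u := by
    have h1 : ContinuousAt (fun v => ((besselMoment (a - 1) 0 v : ℝ) : ℂ)) u :=
      (hasDerivAt_besselMoment (by linarith) 0 u hu).continuousAt.ofReal
    refine h1.congr ?_
    filter_upwards [lt_mem_nhds hu] with v hv
    exact (gammaDensity_convolution hv).symm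
  have h := hK.fourierInv_fourier_eq hI hc
  rw [hF, Real.fourierInv_eq', show K u = _ from gammaDensity_convolution hu] at h
  have e := Measure.integral_comp_mul_left (fun x : ℝ => (x : ℂ) ^ 0 *
    ((((1 + x ^ 2) ^ (-a) : ℝ) : ℂ) * Complex.exp (Complex.I * u * x))) (2 * Real.pi)
  have e2 : ∫ v : ℝ, Complex.exp (((2 * Real.pi * inner ℝ v u : ℝ) : ℂ) * Complex.I) •
      ((Real.Gamma a ^ 2 * (1 + (2 * Real.pi * v) ^ 2) ^ (-a) : ℝ) : ℂ)
      = ((Real.Gamma a ^ 2 : ℝ) : ℂ) * ((((2 * Real.pi)⁻¹ : ℝ) : ℂ) * moment a u 0) := by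
    rw [abs_of_pos (by positivity), Complex.real_smul] at e
    rw [moment, ← e, ← integral_const_mul]
    refine integral_congr_ae (Eventually.of_forall fun v => ?_)
    simp only [smul_eq_mul, pow_zero, one_mul, RCLike.inner_apply, conj_trivial]
    rw [mul_comm, Complex.ofReal_mul, mul_assoc]
    congr 3
    push_cast
    ring
  rw [← h, e2]
  have : (Real.Gamma a : ℂ) ≠ 0 := Complex.ofReal_ne_zero.2 hG
  have : (Real.pi : ℂ) ≠ 0 := Complex.ofReal_ne_zero.2 Real.pi_ne_zero
  push_cast
  field_simp

theorem hasDerivAt_moment {k : ℕ} (h : (k : ℝ) + 2 < 2 * a) (u : ℝ) :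
    HasDerivAt (fun u => moment a u k) (Complex.I * moment a u (k + 1)) u := by
  have h1 : ((k + 1 : ℕ) : ℝ) + 1 < 2 * a := by push_cast; linarith
  have hb := (integrable_pow_mul_weight h1).norm
  have hd := hasDerivAt_integral_of_dominated_loc_of_deriv_le
    (μ := volume) (x₀ := u) (s := Set.univ)
    (F := fun (u : ℝ) (x : ℝ) => (x : ℂ) ^ k * ((((1 + x ^ 2) ^ (-a) : ℝ) : ℂ) *
      Complex.exp (Complex.I * u * x)))
    (F' := fun (u : ℝ) (x : ℝ) => Complex.I * ((x : ℂ) ^ (k + 1) *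
      ((((1 + x ^ 2) ^ (-a) : ℝ) : ℂ) * Complex.exp (Complex.I * u * x))))
    univ_mem (Eventually.of_forall fun v => by fun_prop)
    (integrable_moment (by linarith) u) (by fun_prop) ?_ hb ?_
  · refine hd.2.congr_deriv ?_
    rw [integral_const_mul]
    rfl
  · refine Eventually.of_forall fun x v _ => le_of_eq ?_
    have := norm_exp_neg_I_mul (-v) x
    rw [Complex.ofReal_neg, mul_neg, neg_mul, neg_neg] at this
    rw [norm_mul, norm_mul, norm_mul, this, Complex.norm_I, one_mul, mul_one, norm_mul, norm_pow,
      norm_pow, Complex.norm_real, Complex.norm_real]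
  · refine Eventually.of_forall fun x v _ => ?_
    have h1 : HasDerivAt (fun v : ℝ => Complex.exp (Complex.I * v * x))
        (Complex.exp (Complex.I * v * x) * (Complex.I * 1 * x)) v :=
      (((Complex.ofRealCLM.hasDerivAt (x := v)).const_mul _).mul_const _).cexp
    refine ((h1.const_mul _).const_mul _).congr_deriv ?_
    ring

/-- For `u > 0` the moments are multiples of the successive derivatives of `h`. -/
theorem moment_eq {k : ℕ} (h : (k : ℝ) + 1 < 2 * a) {u : ℝ} (hu : 0 < u) :
    moment a u k = (-Complex.I) ^ k *
      (((2 * Real.pi / Real.Gamma a ^ 2 : ℝ) : ℂ) * besselMoment (a - 1) k u) := by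
  induction k generalizing u with
  | zero =>
    rw [pow_zero, one_mul, moment_zero (by norm_num at h; linarith) hu]
  | succ k ih =>
    push_cast at h
    have ha : -1 < a - 1 := by linarith [k.cast_nonneg (α := ℝ)]
    have h1 := hasDerivAt_moment (a := a) (k := k) (by linarith) u
    have h2 := (((hasDerivAt_besselMoment ha k u hu).ofReal_comp).const_mul
      ((2 * Real.pi / Real.Gamma a ^ 2 : ℝ) : ℂ)).const_mul ((-Complex.I) ^ k)
    have h3 := h1.unique (h2.congr_of_eventuallyEq (by
      filter_upwards [lt_mem_nhds hu] with v hv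
      exact ih (by linarith) hv))
    have hI : moment a u (k + 1) = -Complex.I * (Complex.I * moment a u (k + 1)) := by
      rw [← mul_assoc, neg_mul, Complex.I_mul_I, neg_neg, one_mul]
    rw [hI, h3, pow_succ]
    ring

theorem moment_neg (a u : ℝ) (k : ℕ) : moment a (-u) k = (-1) ^ k * moment a u k := by
  rw [moment, ← integral_neg_eq_self, moment, ← integral_const_mul]
  refine integral_congr_ae (Eventually.of_forall fun x => ?_)
  simp only [Complex.ofReal_neg, neg_sq]
  rw [neg_pow (x : ℂ) k]
  ring_nf

theorem hankel_neg (a : ℝ) (n : ℕ) (u : ℝ) : hankel a n (-u) = hankel a n u := by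
  have h : (Matrix.of fun i j : Fin n => moment a (-u) (i + j))
      = Matrix.of fun i j : Fin n => (-1) ^ (i : ℕ) * (Matrix.of fun i j : Fin n =>
        (-1) ^ (j : ℕ) * Matrix.of (fun i j : Fin n => moment a u (i + j)) i j) i j := by
    ext i j
    simp only [Matrix.of_apply, moment_neg]
    ring
  rw [hankel, h, Matrix.det_mul_column, Matrix.det_mul_row, ← mul_assoc, ← prod_mul_distrib]
  simp only [← mul_pow, neg_mul_neg, one_mul, one_pow, prod_const_one, hankel]

/-- For `u > 0` the Hankel determinant is, up to a positive constant and the sign of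
`det_hankelMatrix_besselMoment_pos`, the Hankel determinant of the derivatives of `h`. -/
theorem hankel_eq {s : ℝ} (hs : -(1 / 2 : ℝ) < s) (N : ℕ) {u : ℝ} (hu : 0 < u) :
    hankel (s + N) N u = (((2 * Real.pi / Real.Gamma (s + N) ^ 2) ^ N *
      ((∏ i : Fin N, (-1 : ℝ) ^ (i : ℕ)) *
        (hankelMatrix (fun k => besselMoment (s + N - 1) k u) N).det) : ℝ) : ℂ) := by
  have h : (Matrix.of fun i j : Fin N => moment (s + N) u (i + j))
      = Matrix.of fun i j : Fin N => (((2 * Real.pi / Real.Gamma (s + N) ^ 2 : ℝ) : ℂ) *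
          (-Complex.I) ^ (i : ℕ)) * (Matrix.of fun i j : Fin N => (-Complex.I) ^ (j : ℕ) *
        (Complex.ofRealHom.mapMatrix (hankelMatrix (fun k => besselMoment (s + N - 1) k u) N))
          i j) i j := by
    ext i j
    simp only [Matrix.of_apply]
    rw [moment_eq (by exact_mod_cast add_one_lt_two_mul hs le_rfl i j) hu]
    simp only [RingHom.mapMatrix_apply, Matrix.map_apply, hankelMatrix, Matrix.of_apply,
      Complex.ofRealHom_eq_coe]
    ring
  rw [hankel, h, Matrix.det_mul_column, Matrix.det_mul_row, prod_mul_distrib, prod_const,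
    ← RingHom.map_det, card_univ, Fintype.card_fin, mul_assoc, ← mul_assoc (∏ i : Fin N, _),
    ← prod_mul_distrib]
  simp only [← mul_pow, neg_mul_neg, Complex.I_mul_I]
  push_cast
  rfl

end Fourier

end

/-! ### The characteristic function and its logarithmic derivative -/

section

open Finset

section Smoothness

theorem contDiffOn_of_hasDerivAt_succ {c : ℕ → ℝ → ℝ}
    (hc : ∀ k, ∀ u > 0, HasDerivAt (c k) (c (k + 1) u) u) (m k : ℕ) :
    ContDiffOn ℝ m (c k) (Set.Ioi 0) := by
  induction m generalizing k with
  | zero =>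
    exact contDiffOn_zero.2 fun u hu => (hc k u hu).continuousAt.continuousWithinAt
  | succ m ih =>
    rw [Nat.cast_add, Nat.cast_one, contDiffOn_succ_iff_deriv_of_isOpen isOpen_Ioi]
    refine ⟨fun u hu => (hc k u hu).differentiableAt.differentiableWithinAt, by simp, ?_⟩
    exact (ih (k + 1)).congr fun u hu => (hc k u hu).deriv

theorem contDiffOn_det_hankelMatrix {c : ℕ → ℝ → ℝ}
    (hc : ∀ k, ∀ u > 0, HasDerivAt (c k) (c (k + 1) u) u) (m n : ℕ) :
    ContDiffOn ℝ m (fun u => (hankelMatrix (fun k => c k u) n).det) (Set.Ioi 0) := by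
  simp_rw [Matrix.det_apply']
  refine ContDiffOn.sum fun σ _ => contDiffOn_const.mul ?_
  exact contDiffOn_prod fun i _ => contDiffOn_of_hasDerivAt_succ hc m _

theorem contDiffOn_of_hasDerivAt_mul {D S : ℝ → ℝ} {m : ℕ} {U : Set ℝ} (hU : IsOpen U)
    (hD : ContDiffOn ℝ (m + 1 : ℕ) D U) (h0 : ∀ u ∈ U, D u ≠ 0)
    (h : ∀ u ∈ U, HasDerivAt D (D u * S u) u) : ContDiffOn ℝ m S U := by
  have h1 : ContDiffOn ℝ m (deriv D) U := hD.deriv_of_isOpen hU (by norm_cast)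
  refine (h1.div (hD.of_le (by norm_cast; omega)) h0).congr fun u hu => ?_
  rw [Pi.div_apply, (h u hu).deriv, mul_div_cancel_left₀ _ (h0 u hu)]

end Smoothness

section Scaling

variable {s : ℝ} {N : ℕ} {f S β W : ℝ → ℝ} {r : ℝ}

theorem isOpen_setOf_mul_pos (r : ℝ) : IsOpen {t : ℝ | 0 < r * t} :=
  isOpen_lt continuous_const (by fun_prop)

theorem hasDerivAt_log_phi (hphi : ∀ t, 0 < r * t → phi s N t = f (r * t))
    (hf0 : ∀ u > 0, 0 < f u) (hf : ∀ u > 0, HasDerivAt f (f u * S u) u) {t : ℝ} (ht : 0 < r * t) :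
    HasDerivAt (fun t : ℝ => Complex.log (phi s N t)) ((r * S (r * t) : ℝ) : ℂ) t := by
  have h1 : HasDerivAt (fun t => Real.log (f (r * t))) (r * S (r * t)) t := by
    have h2 : HasDerivAt (fun t => f (r * t)) (f (r * t) * S (r * t) * (r * 1)) t :=
      (hf _ ht).comp t ((hasDerivAt_id t).const_mul r)
    refine (h2.log (hf0 _ ht).ne').congr_deriv ?_
    have := (hf0 _ ht).ne'
    field_simp
  refine h1.ofReal_comp.congr_of_eventuallyEq ?_
  filter_upwards [(isOpen_setOf_mul_pos r).mem_nhds ht] with v hv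
  rw [hphi v hv, Complex.ofReal_log (hf0 _ hv).le]

theorem tau_eq (hphi : ∀ t, 0 < r * t → phi s N t = f (r * t))
    (hf0 : ∀ u > 0, 0 < f u) (hf : ∀ u > 0, HasDerivAt f (f u * S u) u) {t : ℝ} (ht : 0 < r * t) :
    tau s N t = ((r * t * S (r * t) : ℝ) : ℂ) := by
  rw [tau, (hasDerivAt_log_phi hphi hf0 hf ht).deriv]
  push_cast
  ring

theorem deriv_tau (hphi : ∀ t, 0 < r * t → phi s N t = f (r * t))
    (hf0 : ∀ u > 0, 0 < f u) (hf : ∀ u > 0, HasDerivAt f (f u * S u) u)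
    (hS : ∀ u > 0, HasDerivAt S (β u) u) {t : ℝ} (ht : 0 < r * t) :
    deriv (tau s N) t = ((r * (S (r * t) + r * t * β (r * t)) : ℝ) : ℂ) := by
  have h1 : HasDerivAt (fun t => r * t * S (r * t)) (r * (S (r * t) + r * t * β (r * t))) t := by
    have hr : HasDerivAt (fun t => r * t) (r * 1) t := (hasDerivAt_id t).const_mul r
    refine (hr.mul ((hS _ ht).comp t hr)).congr_deriv ?_
    simp only [Function.comp_apply]
    ring
  refine (h1.ofReal_comp.congr_of_eventuallyEq ?_).deriv
  filter_upwards [(isOpen_setOf_mul_pos r).mem_nhds ht] with v hv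
  exact tau_eq hphi hf0 hf hv

theorem deriv_deriv_tau (hphi : ∀ t, 0 < r * t → phi s N t = f (r * t))
    (hf0 : ∀ u > 0, 0 < f u) (hf : ∀ u > 0, HasDerivAt f (f u * S u) u)
    (hS : ∀ u > 0, HasDerivAt S (β u) u) (hβ : ∀ u > 0, HasDerivAt β (W u) u) {t : ℝ}
    (ht : 0 < r * t) :
    deriv (deriv (tau s N)) t = ((r ^ 2 * (r * t * W (r * t) + 2 * β (r * t)) : ℝ) : ℂ) := by
  have h1 : HasDerivAt (fun t => r * (S (r * t) + r * t * β (r * t)))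
      (r ^ 2 * (r * t * W (r * t) + 2 * β (r * t))) t := by
    have hr : HasDerivAt (fun t => r * t) (r * 1) t := (hasDerivAt_id t).const_mul r
    refine ((((hS _ ht).comp t hr).add (hr.mul ((hβ _ ht).comp t hr))).const_mul r).congr_deriv ?_
    simp only [Function.comp_apply]
    ring
  refine (h1.ofReal_comp.congr_of_eventuallyEq ?_).deriv
  filter_upwards [(isOpen_setOf_mul_pos r).mem_nhds ht] with v hv
  exact deriv_tau hphi hf0 hf hS hv

theorem contDiffAt_tau (hphi : ∀ t, 0 < r * t → phi s N t = f (r * t))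
    (hf0 : ∀ u > 0, 0 < f u) (hf : ∀ u > 0, HasDerivAt f (f u * S u) u)
    (hS : ContDiffOn ℝ 2 S (Set.Ioi 0)) {t : ℝ} (ht : 0 < r * t) :
    ContDiffAt ℝ 2 (tau s N) t := by
  have hr : ContDiffAt ℝ 2 (fun t => r * t) t := by fun_prop
  have h1 : ContDiffAt ℝ 2 (fun t => r * t * S (r * t)) t :=
    hr.mul ((hS.contDiffAt (Ioi_mem_nhds ht)).comp t hr)
  have h2 : ContDiffAt ℝ 2 (fun t => ((r * t * S (r * t) : ℝ) : ℂ)) t :=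
    Complex.ofRealCLM.contDiff.contDiffAt.comp t h1
  refine h2.congr_of_eventuallyEq ?_
  filter_upwards [(isOpen_setOf_mul_pos r).mem_nhds ht] with v hv
  exact tau_eq hphi hf0 hf hv

/-- The change of variable `u = r t`, `r = ± 1 / (2 N)`, in the `σ`-form. -/
theorem painleveV_of_sigma_form (hphi : ∀ t, 0 < r * t → phi s N t = f (r * t)) (hN : N ≠ 0)
    (hr : 4 * (N : ℝ) ^ 2 * r ^ 2 = 1)
    (hf0 : ∀ u > 0, 0 < f u) (hf : ∀ u > 0, HasDerivAt f (f u * S u) u)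
    (hS : ∀ u > 0, HasDerivAt S (β u) u) (hβ : ∀ u > 0, HasDerivAt β (W u) u)
    (hσ : ∀ u > 0, (u * (u * W u + 2 * β u)) ^ 2 = 4 * s ^ 2 * (S u + u * β u) ^ 2
        + 4 * (u ^ 2 * β u) * (N * (2 * s + N) - (S u + u * β u) ^ 2 + u ^ 2 * β u))
    {t : ℝ} (ht : 0 < r * t) :
    (t * deriv (deriv (tau s N)) t) ^ 2 = painleveV s N t (tau s N t) (deriv (tau s N) t) := by
  have h := hσ _ ht
  rw [deriv_deriv_tau hphi hf0 hf hS hβ ht, deriv_tau hphi hf0 hf hS ht, tau_eq hphi hf0 hf ht]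
  generalize S (r * t) = S at *
  generalize W (r * t) = W at *
  generalize β (r * t) = β at *
  have hN' : (N : ℝ) ≠ 0 := Nat.cast_ne_zero.2 hN
  have hN2 : (1 : ℝ) / N ^ 2 = 4 * r ^ 2 := by field_simp; linarith
  have key : (t * (r ^ 2 * (r * t * W + 2 * β))) ^ 2
      = -4 * t * (r * (S + r * t * β)) ^ 3
        + (4 * s ^ 2 + 4 * (r * t * S) + t ^ 2 * (1 / N ^ 2)) * (r * (S + r * t * β)) ^ 2
        + t * ((N + 2 * s) * N * (1 / N ^ 2) - 2 * (r * t * S) * (1 / N ^ 2)) *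
          (r * (S + r * t * β))
        - ((N + 2 * s) * N * (1 / N ^ 2) - (r * t * S) * (1 / N ^ 2)) * (r * t * S) := by
    rw [hN2]
    linear_combination r ^ 2 * h
  have e1 : (1 : ℝ) + 2 * s / N = (N + 2 * s) * N * (1 / N ^ 2) := by field_simp
  have := congrArg (fun x : ℝ => (x : ℂ)) key
  simp only [← e1] at this
  rw [painleveV]
  push_cast at this ⊢
  rw [this]
  ring

end Scaling

section Conclusion

variable {s : ℝ}

/-- The characteristic function is, for positive and for negative times, a positive multiple of a
Hankel determinant of functions `c k` with `c k' = c (k + 1)`, and its logarithmic derivative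
satisfies the `σ`-form of Painlevé V. -/
theorem exists_phi_eq (hs : -(1 / 2 : ℝ) < s) (k : ℕ) : ∃ f S β W : ℝ → ℝ,
    (∀ t ≠ 0, phi s (k + 1) t = f (|t| / (2 * (k + 1)))) ∧ (∀ u > 0, 0 < f u) ∧
    ContDiffOn ℝ 2 S (Set.Ioi 0) ∧
    ∀ u > 0, HasDerivAt f (f u * S u) u ∧ HasDerivAt S (β u) u ∧ HasDerivAt β (W u) u ∧
      (u * (u * W u + 2 * β u)) ^ 2 = 4 * s ^ 2 * (S u + u * β u) ^ 2
        + 4 * (u ^ 2 * β u) *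
          ((k + 1) * (2 * s + (k + 1)) - (S u + u * β u) ^ 2 + u ^ 2 * β u) := by
  have hp : -1 < s + k := by linarith [k.cast_nonneg (α := ℝ)]
  have hc := hasDerivAt_besselMoment hp
  have hpos := fun (u : ℝ) (hu : 0 < u) => det_hankelMatrix_besselMoment_pos (p := s + k) hu
    (n := k + 1) (by push_cast; linarith)
  have hD : ∀ u > 0, (hankelMatrix (fun j => besselMoment (s + k) j u) k).det ≠ 0 := fun u hu =>
    right_ne_zero_of_mul (det_hankelMatrix_besselMoment_pos hu (by linarith)).ne'
  have hD' : ∀ u > 0, (hankelMatrix (fun j => besselMoment (s + k) j u) (k + 1)).det ≠ 0 :=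
    fun u hu => right_ne_zero_of_mul (hpos u hu).ne'
  obtain ⟨S, β, W, h⟩ := exists_sigma_form hc hD hD' fun u hu => isPearson_besselMoment hp hu
  obtain ⟨r, hr, hr'⟩ := hankel_zero_pos hs (k + 1)
  have hG : 0 < Real.Gamma (s + (k + 1)) := Real.Gamma_pos_of_pos (by linarith)
  let C : ℝ := (2 * Real.pi / Real.Gamma (s + (k + 1)) ^ 2) ^ (k + 1)
  have hC : 0 < C := by positivity
  refine ⟨fun u => C * ((∏ i : Fin (k + 1), (-1 : ℝ) ^ (i : ℕ)) *
    (hankelMatrix (fun j => besselMoment (s + k) j u) (k + 1)).det) / r, S, β, W, fun t ht => ?_,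
    fun u hu => div_pos (mul_pos hC (hpos u hu)) hr,
    contDiffOn_of_hasDerivAt_mul isOpen_Ioi (contDiffOn_det_hankelMatrix hc _ _) hD'
      fun u hu => (h u hu).1, fun u hu => ?_⟩
  · have hu : 0 < |t| / (2 * ((k + 1 : ℕ) : ℝ)) := by positivity
    have h1 : hankel (s + (k + 1 : ℕ)) (k + 1) (t / (2 * (k + 1 : ℕ)))
        = hankel (s + (k + 1 : ℕ)) (k + 1) (|t| / (2 * (k + 1 : ℕ))) := by
      rcases abs_choice t with h | h
      · rw [h]
      · rw [h, neg_div, hankel_neg]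
    rw [phi_eq_hankel hs, h1, hankel_eq hs _ hu, hr']
    simp only [C]
    push_cast
    rw [show s + ((k : ℝ) + 1) - 1 = s + k by ring]
  · obtain ⟨h1, h2, h3, h4⟩ := h u hu
    refine ⟨(((h1.const_mul (∏ i : Fin (k + 1), (-1 : ℝ) ^ (i : ℕ))).const_mul C).div_const
      r).congr_deriv (by ring), h2, h3, ?_⟩
    rw [h4]
    ring

theorem phi_zero (hs : -(1 / 2 : ℝ) < s) (N : ℕ) : phi s N 0 = 1 := by
  obtain ⟨r, hr, hr'⟩ := hankel_zero_pos hs N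
  rw [phi_eq_hankel hs, zero_div, hr', div_self (Complex.ofReal_ne_zero.2 hr.ne')]

theorem tendsto_painleveV (s : ℝ) (t x p : ℂ) :
    Tendsto (fun N : ℕ => painleveV s N t x p) atTop (𝓝 (painleveIII' s t x p)) := by
  have h : Tendsto (fun N : ℕ => ((N : ℂ))⁻¹) atTop (𝓝 0) :=
    tendsto_inv_atTop_nhds_zero_nat (𝕜 := ℂ)
  have hF : Continuous fun z : ℂ => -4 * t * p ^ 3 + (4 * s ^ 2 + 4 * x + t ^ 2 * z ^ 2) * p ^ 2
    + t * (1 + 2 * s * z - 2 * x * z ^ 2) * p - (1 + 2 * s * z - x * z ^ 2) * x := by fun_prop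
  have h1 := (hF.tendsto 0).comp h
  refine (h1.congr fun N => ?_).trans (le_of_eq ?_)
  · simp only [Function.comp_apply, painleveV, div_eq_mul_inv, inv_pow]
  · congr 1
    rw [painleveIII']
    ring

end Conclusion

end

end HuaPickrell

end

theorem mainTheorem6 (s : ℝ) (hs : -(1 / 2 : ℝ) < s) :
    (∀ N : ℕ, 1 ≤ N →
      (∀ t : ℝ, (HuaPickrell.phi s N t).im = 0 ∧ 0 < (HuaPickrell.phi s N t).re) ∧
      DifferentiableOn ℝ (fun t : ℝ => Complex.log (HuaPickrell.phi s N t)) {0}ᶜ ∧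
      ContDiffOn ℝ 2 (HuaPickrell.tau s N) {0}ᶜ ∧
      ∀ t : ℝ, t ≠ 0 →
        (t * deriv (deriv (HuaPickrell.tau s N)) t) ^ 2 =
          HuaPickrell.painleveV s N t (HuaPickrell.tau s N t)
            (deriv (HuaPickrell.tau s N) t)) ∧
    (∀ t x p : ℂ, Tendsto (fun N : ℕ => HuaPickrell.painleveV s N t x p) atTop
      (𝓝 (HuaPickrell.painleveIII' s t x p))) := by
  refine ⟨fun N hN => ?_, HuaPickrell.tendsto_painleveV s⟩
  obtain ⟨k, rfl⟩ : ∃ k, N = k + 1 := ⟨N - 1, by omega⟩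
  obtain ⟨f, S, β, W, hphi, hf0, hSc, h⟩ := HuaPickrell.exists_phi_eq hs k
  have hf := fun u hu => (h u hu).1
  have hS := fun u hu => (h u hu).2.1
  have hβ := fun u hu => (h u hu).2.2.1
  -- the two half lines are treated alike, with `r = 1 / (2 N)` and `r = -1 / (2 N)`
  have hr : ∀ t : ℝ, t ≠ 0 → ∃ r : ℝ, 4 * ((k + 1 : ℕ) : ℝ) ^ 2 * r ^ 2 = 1 ∧ 0 < r * t ∧
      ∀ v, 0 < r * v → HuaPickrell.phi s (k + 1) v = f (r * v) := by
    intro t ht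
    have hk : (0 : ℝ) < 2 * (k + 1) := by positivity
    have hphi' : ∀ r v : ℝ, |r| = 1 / (2 * (k + 1)) → 0 < r * v →
        HuaPickrell.phi s (k + 1) v = f (r * v) := by
      intro r v hr hv
      rw [hphi v (right_ne_zero_of_mul hv.ne'), ← abs_of_pos hv, abs_mul, hr, one_div_mul_eq_div]
    rcases ht.lt_or_gt with ht | ht
    · refine ⟨-(1 / (2 * (k + 1))), by push_cast; field_simp; norm_num, ?_, fun v =>
        hphi' _ v (by rw [abs_neg, abs_of_pos (by positivity)])⟩
      rw [neg_mul, neg_pos]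
      exact mul_neg_of_pos_of_neg (by positivity) ht
    · exact ⟨1 / (2 * (k + 1)), by push_cast; field_simp; norm_num, by positivity, fun v =>
        hphi' _ v (abs_of_pos (by positivity))⟩
  refine ⟨fun t => ?_, fun t ht => ?_, fun t ht => ?_, fun t ht => ?_⟩
  · rcases eq_or_ne t 0 with rfl | ht
    · simp [HuaPickrell.phi_zero hs]
    · rw [hphi t ht, Complex.ofReal_im, Complex.ofReal_re]
      exact ⟨rfl, hf0 _ (by positivity)⟩
  · obtain ⟨r, -, hrt, hrphi⟩ := hr t ht
    exact (HuaPickrell.hasDerivAt_log_phi hrphi hf0 hf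
      hrt).differentiableAt.differentiableWithinAt
  · obtain ⟨r, -, hrt, hrphi⟩ := hr t ht
    exact (HuaPickrell.contDiffAt_tau hrphi hf0 hf hSc hrt).contDiffWithinAt
  · obtain ⟨r, hr2, hrt, hrphi⟩ := hr t ht
    refine HuaPickrell.painleveV_of_sigma_form hrphi k.succ_ne_zero hr2 hf0 hf hS hβ
      (fun u hu => ?_) hrt
    rw [(h u hu).2.2.2]
    push_cast
    ring
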